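/- Notation. Let $X$ be an open subset of $\mathbf R^n$, let $m$ be a nonnegative integer, and let $\phi$ be a Radon measure over $X$. $\mathscr H^m$ is $m$-dimensional Hausdorff measure (normalised with $\boldsymbol\alpha(m)$, the volume of the unit ball of $\mathbf R^m$). $\boldsymbol\Theta^m(\phi,a)=\lim_{r\to0+}\phi(\mathbf B(a,r))/(\boldsymbol\alpha(m)r^m)$. For $S\subset X$, $\mathrm{Tan}(S,a)$ is the set of $v$ such that for every $\epsilon>0$ there are $x\in S$ and $r>0$ with $|x-a|<\epsilon$ and $|r(x-a)-v|<\epsilon$; $\mathrm{Tan}^m(\phi,a)$ is the intersection of all $\mathrm{Tan}(S,a)$ with $S\subset X$ and $\boldsymbol\Theta^m(\phi\llcorner (X\setminus S),a)=0$. A map $f:X\to\mathbf R^\nu$ is $(\phi,m)$ approximately differentiable at $a$ if there is $h:\mathbf R^n\to\mathbf R^\nu$, differentiable at $a$, with $\boldsymbol\Theta^m(\phi\llcorner\{x: f(x)\neq h(x)\},a)=0$; then $(\phi,m)\,\mathrm{ap}\,Df(a)=Dh(a)|\mathrm{Tan}^m(\phi,a)$, and $(\phi,m)\,\mathrm{ap}\,J_mf(a)=\|\bigwedge_m(\phi,m)\,\mathrm{ap}\,Df(a)\|$.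 $\mathbf G(n,m)$ is the Grassmannian of $m$-dimensional subspaces of $\mathbf R^n$. An $m$-dimensional varifold in $X$ is a Radon measure $V$ over $X\times\mathbf G(n,m)$, its weight is $\|V\|(B)=V(B\times\mathbf G(n,m))$ for Borel sets $B\subset X$ (extended to all subsets of $X$ by Borel regularity), and $\mathrm{spt}\,\|V\|$ is the support of $\|V\|$. It is rectifiable, $V\in\mathbf{RV}_m(X)$, if $V=\sum_{i=1}^\infty c_i\,\mathbf v(E_i)$ for some $0<c_i<\infty$ and $\mathscr H^m$ measurable sets $E_i\subset X$ meeting every compact subset of $X$ in an $(\mathscr H^m,m)$ rectifiable set (a set of finite $\mathscr H^m$ measure, $\mathscr H^m$ almost all of which is covered by countably many Lipschitzian images of bounded subsets of $\mathbf R^m$), where $\mathbf v(E)(B)=\mathscr H^m\{x\in E:(x,\mathrm{Tan}^m(\mathscr H^m\llcorner E,x))\in B\}$. Theorem. Suppose $X\subset\mathbf R^n$ and $Y\subset\mathbf R^\nu$ are open, $f:X\to Y$ is locally Lipschitzian, $m$ is a nonnegative integer with $m\le n$ and $m\le\nu$, $V\in\mathbf{RV}_m(X)$, and $f|\mathrm{spt}\,\|V\|$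 is proper as a map into $Y$. Write $Df(x)$ and $J_mf(x)$ for $(\|V\|,m)\,\mathrm{ap}\,Df(x)$ and $(\|V\|,m)\,\mathrm{ap}\,J_mf(x)$, and let $A=\{x:J_mf(x)>0\}$. (1) For $\|V\|$ almost all $x$, $f$ is $(\|V\|,m)$ approximately differentiable at $x$, $\mathrm{Tan}^m(\|V\|,x)$ is an $m$-dimensional vector space, and $\mathrm{im}\,Df(x)\in\mathbf G(\nu,m)$ if $x\in A$; the function $J_mf$ is $\|V\|$ measurable; and, for every continuous $k:Y\times\mathbf G(\nu,m)\to\mathbf R$ with compact support, $x\mapsto k(f(x),\mathrm{im}\,Df(x))\,J_mf(x)$ is $\|V\|$ integrable over $A$. There is exactly one Radon measure $W$ over $Y\times\mathbf G(\nu,m)$ with $$\int k\,\mathrm dW=\int_A k(f(x),\mathrm{im}\,Df(x))\,J_mf(x)\,\mathrm d\|V\|\,x\quad\text{for all such }k,$$ and $W\in\mathbf{RV}_m(Y)$. (This $W$ is denoted $f_\#V$.) (2) $\|W\|=f_\#(\|V\|\llcorner J_mf)$, that is, $\|W\|(B)=(\|V\|\llcorner J_mf)(f^{-1}[B])$ for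 every $B\subset Y$; here $(\|V\|\llcorner J_mf)(C)$ is the upper integral $\int_C^*J_mf\,\mathrm d\|V\|$ for $C\subset X$. (3) For $\mathscr H^m$ almost all $y\in Y$, the densities $\boldsymbol\Theta^m(\|W\|,y)$ and $\boldsymbol\Theta^m(\|V\|,x)$ for $x\in f^{-1}[\{y\}]$ exist and $$\boldsymbol\Theta^m(\|W\|,y)=\sum_{x\in f^{-1}[\{y\}]}\boldsymbol\Theta^m(\|V\|,x).$$ (4) For $\mathscr H^m$ almost all $y\in Y$, whenever $f(x)=y$ and $\boldsymbol\Theta^m(\|V\|,x)>0$: $f$ is $(\|V\|,m)$ approximately differentiable at $x$, $\mathrm{Tan}^m(\|V\|,x)$ is an $m$-dimensional vector space, and $\mathrm{im}\,Df(x)=\mathrm{Tan}^m(\|W\|,y)$ is an $m$-dimensional vector space. (5) If $\mu$ is a nonnegative integer and $g:Y\to\mathbf R^\mu$ is locally Lipschitzian, then, for $\mathscr H^m$ almost all $y\in Y$, whenever $f(x)=y$ and $\boldsymbol\Theta^m(\|V\|,x)>0$: $g$ is $(\|W\|,m)$ approximately differentiable at $y$, $g\circ f$ is $(\|V\|,m)$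 approximately differentiable at $x$, and $$(\|V\|,m)\,\mathrm{ap}\,D(g\circ f)(x)=(\|W\|,m)\,\mathrm{ap}\,Dg(y)\circ(\|V\|,m)\,\mathrm{ap}\,Df(x).$$ -/

import Mathlib

open MeasureTheory Measure Set Filter Topology
open scoped ENNReal

noncomputable section

/-- `α(m)`, the volume of the unit ball of `ℝᵐ`. -/
def unitBallVolume (m : ℕ) : ℝ≥0∞ :=
  volume (Metric.closedBall (0 : EuclideanSpace ℝ (Fin m)) 1)

/-- `m`-dimensional Hausdorff measure in the normalisation of geometric measure theory: the
weight of a covering set `S` is `α(m) 2⁻ᵐ diam(S)ᵐ`. -/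
def hausdorff (m : ℕ) {Z : Type*} [EMetricSpace Z] [MeasurableSpace Z] [BorelSpace Z] :
    Measure Z :=
  (unitBallVolume m / 2 ^ m) • hausdorffMeasure (m : ℝ)

/-! ### Densities -/

/-- `φ (B(a,r)) / (α(m) rᵐ)`. -/
def densityRatio {Z : Type*} [MetricSpace Z] [MeasurableSpace Z] (φ : Measure Z) (m : ℕ)
    (a : Z) (r : ℝ) : ℝ≥0∞ :=
  φ (Metric.closedBall a r) / (unitBallVolume m * ENNReal.ofReal (r ^ m))

/-- The `m`-dimensional density `Θᵐ(φ,a)` exists in `[0,∞]` and equals `θ`. -/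
def HasDensity {Z : Type*} [MetricSpace Z] [MeasurableSpace Z] (φ : Measure Z) (m : ℕ)
    (a : Z) (θ : ℝ≥0∞) : Prop :=
  Tendsto (densityRatio φ m a) (𝓝[>] (0 : ℝ)) (𝓝 θ)

/-- `Θᵐ(φ,a)`: the limit of the density ratios. It is meaningful where the limit exists, that is,
where `HasDensity φ m a (density φ m a)` holds. -/
def density {Z : Type*} [MetricSpace Z] [MeasurableSpace Z] (φ : Measure Z) (m : ℕ)
    (a : Z) : ℝ≥0∞ :=
  limUnder (𝓝[>] (0 : ℝ)) (densityRatio φ m a)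

/-! ### Approximate tangent cones and approximate differentials -/

/-- The tangent cone `Tan(S,a)`. -/
def tangentCone {n : ℕ} (S : Set (EuclideanSpace ℝ (Fin n))) (a : EuclideanSpace ℝ (Fin n)) :
    Set (EuclideanSpace ℝ (Fin n)) :=
  {v | ∀ ε : ℝ, 0 < ε → ∃ x ∈ S, ∃ r : ℝ, 0 < r ∧ ‖x - a‖ < ε ∧ ‖r • (x - a) - v‖ < ε}

/-- The approximate tangent cone `Tanᵐ(φ,a)`: the intersection of all `Tan(S,a)`, where
`S ⊆ X` and `Θᵐ(φ ⌞ X ∖ S, a) = 0`. -/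
def apTan {n : ℕ} {X : Set (EuclideanSpace ℝ (Fin n))} (φ : Measure X) (m : ℕ) (a : X) :
    Set (EuclideanSpace ℝ (Fin n)) :=
  {v | ∀ S : Set X, HasDensity (φ.restrict Sᶜ) m a 0 →
    v ∈ tangentCone ((↑) '' S) (a : EuclideanSpace ℝ (Fin n))}

/-- The linear span of `Tanᵐ(φ,a)`; it is `Tanᵐ(φ,a)` itself if this is a vector space. -/
def apTanSpan {n : ℕ} {X : Set (EuclideanSpace ℝ (Fin n))} (φ : Measure X) (m : ℕ) (a : X) :
    Submodule ℝ (EuclideanSpace ℝ (Fin n)) :=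
  Submodule.span ℝ (apTan φ m a)

/-- `f` agrees at `a`, up to a set of zero `m`-dimensional `φ` density at `a`, with a map that is
differentiable at `a` with differential `L`. -/
def HasApDerivAt {n q : ℕ} {X : Set (EuclideanSpace ℝ (Fin n))} (φ : Measure X) (m : ℕ)
    (f : X → EuclideanSpace ℝ (Fin q)) (a : X)
    (L : EuclideanSpace ℝ (Fin n) →L[ℝ] EuclideanSpace ℝ (Fin q)) : Prop :=
  ∃ h : EuclideanSpace ℝ (Fin n) → EuclideanSpace ℝ (Fin q),
    HasFDerivAt h L (a : EuclideanSpace ℝ (Fin n)) ∧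
      HasDensity (φ.restrict {x : X | f x ≠ h x}) m a 0

/-- `f` is `(φ,m)` approximately differentiable at `a`. -/
def ApDifferentiableAt {n q : ℕ} {X : Set (EuclideanSpace ℝ (Fin n))} (φ : Measure X) (m : ℕ)
    (f : X → EuclideanSpace ℝ (Fin q)) (a : X) : Prop :=
  ∃ L, HasApDerivAt φ m f a L

open Classical in
/-- The approximate differential `(φ,m) ap Df(a)`, that is, the restriction to `Tanᵐ(φ,a)`
(extended linearly to its span) of any `L` as in `HasApDerivAt`; this restriction does not depend
on `L`. It is `0` if `f` is not approximately differentiable at `a`. -/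
def apDeriv {n q : ℕ} {X : Set (EuclideanSpace ℝ (Fin n))} (φ : Measure X) (m : ℕ)
    (f : X → EuclideanSpace ℝ (Fin q)) (a : X) :
    apTanSpan φ m a →L[ℝ] EuclideanSpace ℝ (Fin q) :=
  if h : ApDifferentiableAt φ m f a then h.choose.comp (apTanSpan φ m a).subtypeL else 0

/-- The image `im (φ,m) ap Df(a)`. -/
def apImage {n q : ℕ} {X : Set (EuclideanSpace ℝ (Fin n))} (φ : Measure X) (m : ℕ)
    (f : X → EuclideanSpace ℝ (Fin q)) (a : X) : Submodule ℝ (EuclideanSpace ℝ (Fin q)) :=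
  LinearMap.range (apDeriv φ m f a : apTanSpan φ m a →ₗ[ℝ] EuclideanSpace ℝ (Fin q))

/-- `‖⋀ₘ L‖`, the operator norm of `⋀ₘ L` with respect to the Euclidean norms on the exterior
powers. -/
def exteriorNorm {E F : Type*} [NormedAddCommGroup E] [InnerProductSpace ℝ E]
    [FiniteDimensional ℝ E] [NormedAddCommGroup F] [InnerProductSpace ℝ F]
    [FiniteDimensional ℝ F] (m : ℕ) (L : E →ₗ[ℝ] F) : ℝ :=
  ‖LinearMap.toContinuousLinearMap (exteriorPower.map m L)‖

/-- The approximate Jacobian `(φ,m) ap Jₘf(a) = ‖⋀ₘ (φ,m) ap Df(a)‖`. -/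
def apJacobian {n q : ℕ} {X : Set (EuclideanSpace ℝ (Fin n))} (φ : Measure X) (m : ℕ)
    (f : X → EuclideanSpace ℝ (Fin q)) (a : X) : ℝ :=
  exteriorNorm m (apDeriv φ m f a : apTanSpan φ m a →ₗ[ℝ] EuclideanSpace ℝ (Fin q))

/-! ### Varifolds -/

/-- The Grassmannian `G(n,m)` of `m`-dimensional subspaces of `ℝⁿ`. -/
def Grassmannian (n m : ℕ) : Type :=
  {T : Submodule ℝ (EuclideanSpace ℝ (Fin n)) // Module.finrank ℝ T = m}

/-- A subspace is identified with the orthogonal projection onto it. -/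
def Grassmannian.proj {n m : ℕ} (T : Grassmannian n m) :
    EuclideanSpace ℝ (Fin n) →L[ℝ] EuclideanSpace ℝ (Fin n) :=
  T.1.starProjection

instance (n m : ℕ) : TopologicalSpace (Grassmannian n m) :=
  TopologicalSpace.induced Grassmannian.proj inferInstance

instance (n m : ℕ) : SecondCountableTopology (Grassmannian n m) :=
  TopologicalSpace.secondCountableTopology_induced _ _ _

instance (n m : ℕ) : MeasurableSpace (Grassmannian n m) := borel _

instance (n m : ℕ) : BorelSpace (Grassmannian n m) := ⟨rfl⟩

/-- The weight `‖V‖(B) = V (B × G(n,m))`. -/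
def weight {n m : ℕ} {X : Set (EuclideanSpace ℝ (Fin n))}
    (V : Measure (X × Grassmannian n m)) : Measure X :=
  V.map Prod.fst

/-- A countable union of Lipschitzian images of bounded subsets of `ℝᵐ`. -/
def IsCountablyRectifiable {n : ℕ} (m : ℕ) (R : Set (EuclideanSpace ℝ (Fin n))) : Prop :=
  ∃ (A : ℕ → Set (EuclideanSpace ℝ (Fin m)))
    (f : ℕ → EuclideanSpace ℝ (Fin m) → EuclideanSpace ℝ (Fin n)),
    (∀ i, Bornology.IsBounded (A i) ∧ ∃ K, LipschitzOnWith K (f i) (A i)) ∧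
      R = ⋃ i, f i '' A i

/-- `S` is `(Hᵐ,m)` rectifiable: `Hᵐ(S) < ∞` and `Hᵐ` almost all of `S` is contained in a
countably `m` rectifiable set. -/
def IsHausdorffRectifiable {n : ℕ} (m : ℕ) (S : Set (EuclideanSpace ℝ (Fin n))) : Prop :=
  hausdorff m S < ∞ ∧ ∃ R, IsCountablyRectifiable m R ∧ hausdorff m (S \ R) = 0

/-- The set of all `x ∈ S` with `(x, Tanᵐ(Hᵐ ⌞ S, x)) ∈ B`. -/
def tangentSlice {n m : ℕ} {X : Set (EuclideanSpace ℝ (Fin n))} (S : Set X)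
    (B : Set (X × Grassmannian n m)) : Set X :=
  {x | x ∈ S ∧ ∃ T : Grassmannian n m,
    apTan ((hausdorff m : Measure X).restrict S) m x = (T.1 : Set _) ∧ (x, T) ∈ B}

/-- `V` is an `m`-dimensional rectifiable varifold in `X`: a Radon measure over `X × G(n,m)` of
the form `V = ∑ᵢ cᵢ v(Eᵢ)`, where `0 < cᵢ < ∞`, the sets `Eᵢ ⊆ X` are `Hᵐ` measurable and meet
every compact subset of `X` in an `(Hᵐ,m)` rectifiable set, and `v(E)` is the varifold
`v(E)(B) = Hᵐ {x ∈ E : (x, Tanᵐ(Hᵐ ⌞ E, x)) ∈ B}`. -/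
structure IsRectifiableVarifold {n m : ℕ} {X : Set (EuclideanSpace ℝ (Fin n))}
    (V : Measure (X × Grassmannian n m)) : Prop where
  radon : IsFiniteMeasureOnCompacts V
  rectifiable : ∃ (c : ℕ → ℝ) (E : ℕ → Set X),
    (∀ i, 0 < c i) ∧
    (∀ i, NullMeasurableSet (E i) (hausdorff m)) ∧
    (∀ i, ∀ K : Set X, IsCompact K → IsHausdorffRectifiable m (Subtype.val '' (E i ∩ K))) ∧
    ∀ B : Set (X × Grassmannian n m), MeasurableSet B →
      V B = ∑' i, ENNReal.ofReal (c i) * hausdorff m (tangentSlice (E i) B)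

/-! ### Push forward -/

/-- A map into `Y ⊆ ℝᵖ`, considered as a map into `ℝᵖ`. -/
abbrev ambient {n p : ℕ} {X : Set (EuclideanSpace ℝ (Fin n))}
    {Y : Set (EuclideanSpace ℝ (Fin p))} (f : X → Y) : X → EuclideanSpace ℝ (Fin p) :=
  fun x => f x

open Classical in
/-- The integrand `k (f(x), im ap Df(x)) · ap Jₘf(x)` with respect to `φ`; it is `0` if
`im ap Df(x)` is not of dimension `m`. -/
def pushIntegrand {n p m : ℕ} {X : Set (EuclideanSpace ℝ (Fin n))}
    {Y : Set (EuclideanSpace ℝ (Fin p))} (φ : Measure X) (f : X → Y)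
    (k : Y × Grassmannian p m → ℝ) (x : X) : ℝ :=
  if h : Module.finrank ℝ (apImage φ m (ambient f) x) = m then
    k (f x, ⟨apImage φ m (ambient f) x, h⟩) *
      apJacobian φ m (ambient f) x
  else 0

/-- The set `A` of all `x` with `(φ,m) ap Jₘf(x) > 0`. -/
def posJacobianSet {n p : ℕ} {X : Set (EuclideanSpace ℝ (Fin n))}
    {Y : Set (EuclideanSpace ℝ (Fin p))} (φ : Measure X) (m : ℕ) (f : X → Y) : Set X :=
  {x | 0 < apJacobian φ m (ambient f) x}

/-- The Radon measure `W` represents the functional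
`k ↦ ∫_A k (f(x), im (‖V‖,m) ap Df(x)) (‖V‖,m) ap Jₘf(x) d‖V‖ x` on continuous functions `k` with
compact support on `Y × G(p,m)`. -/
def IsPushForward {n p m : ℕ} {X : Set (EuclideanSpace ℝ (Fin n))}
    {Y : Set (EuclideanSpace ℝ (Fin p))} (f : X → Y) (V : Measure (X × Grassmannian n m))
    (W : Measure (Y × Grassmannian p m)) : Prop :=
  IsFiniteMeasureOnCompacts W ∧
    ∀ k : Y × Grassmannian p m → ℝ, Continuous k → HasCompactSupport k →
      ∫ z, k z ∂W = ∫ x in posJacobianSet (weight V) m f, pushIntegrand (weight V) f k x ∂weight V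

end

/-! Everything is reduced to parameters in `ℝᵐ`. Up to an `Hᵐ` null set, a rectifiable set is a
disjoint union of charts `P = ψ[t]`, where `t ⊆ ℝᵐ` is bounded and measurable and `ψ` has a
Lipschitzian left inverse `ρ` on `t`. The charts can be cut so that `f = F ∘ ρ` on `P` with `F`
Lipschitzian, and so that either `DF` is nowhere injective on `t` or `F` has a Lipschitzian left
inverse on `t` (`exists_disjoint_adaptedChart`). Hence `‖V‖ = ∑ cⱼ Hᵐ ⌞ Pⱼ`. In the second case `Qⱼ
= f[Pⱼ]` is a chart parametrised by `Fⱼ`; in the first case `f[Pⱼ]` is null by Sard's lemma and `Qⱼ`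
is taken empty. The push forward is `W = ∑ cⱼ v(Qⱼ)`.

At almost every point of a chart, `Tanᵐ(‖V‖,x)` is the image of `Dψ(ρ(x))`, and `ap Df(x) ∘ Dψ(ρ(x))
= DF(ρ(x))`, so the approximate Jacobian is the quotient of the Jacobians of `F` and `ψ`. The area
formula, applied in `Pⱼ` and in `Qⱼ`, turns integrals over both into the same integral over `tⱼ`
(`lintegral_apJacobian_mul`). This exhibits `W` as the image of `‖V‖ ⌞ Jₘf` under `x ↦ (f(x), im
Df(x))`; the integral formula and the weight follow. Properness of `f` on the support makes `W`
finite on compact sets, and Radon measures are determined by their integrals of test functions.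

Almost everywhere, `Hᵐ ⌞ P` has the density `hausdorffConst m` on `P` and density zero off `P`. A
covering argument makes the tails of the sum negligible, so densities may be added
(`ae_hasDensity_sum`). As `f` carries each nondegenerate `Pⱼ` bijectively onto `Qⱼ` with the same
multiplicity, the density identity is an interchange of sums. The constant occurs on both sides; its
value 1, which amounts to the isodiametric inequality, is never needed.

Locally Lipschitzian maps carry `Hᵐ` null sets to null sets, so properties valid almost everywhere
in `X` hold on the whole of almost every fibre of `f`. There the statements on tangent planes and on
the chain rule become the classical chain rule in parameters. -/

/-- Euclidean space `ℝⁿ`. -/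
abbrev Euc (n : ℕ) : Type := EuclideanSpace ℝ (Fin n)

/-! ### Hausdorff measure -/

theorem unitBallVolume_ne_zero (m : ℕ) : unitBallVolume m ≠ 0 :=
  (Metric.measure_closedBall_pos volume _ one_pos).ne'

theorem unitBallVolume_ne_top (m : ℕ) : unitBallVolume m ≠ ∞ :=
  measure_closedBall_lt_top.ne

theorem hausdorff_apply (m : ℕ) {Z : Type*} [EMetricSpace Z] [MeasurableSpace Z] [BorelSpace Z]
    (s : Set Z) :
    hausdorff m s = (unitBallVolume m / 2 ^ m) * hausdorffMeasure (m : ℝ) s := by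
  simp [hausdorff]

theorem hausdorff_eq_zero_iff (m : ℕ) {Z : Type*} [EMetricSpace Z] [MeasurableSpace Z]
    [BorelSpace Z] (s : Set Z) :
    hausdorff m s = 0 ↔ hausdorffMeasure (m : ℝ) s = 0 := by
  rw [hausdorff_apply, mul_eq_zero, or_iff_right]
  exact (ENNReal.div_pos (unitBallVolume_ne_zero m) (by finiteness)).ne'

theorem LipschitzOnWith.hausdorff_image_le {Z Z' : Type*} [EMetricSpace Z] [MeasurableSpace Z]
    [BorelSpace Z] [EMetricSpace Z'] [MeasurableSpace Z'] [BorelSpace Z'] {K : NNReal} {f : Z → Z'}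
    {s : Set Z} (h : LipschitzOnWith K f s) (m : ℕ) :
    hausdorff m (f '' s) ≤ (K : ℝ≥0∞) ^ m * hausdorff m s := by
  rw [hausdorff_apply, hausdorff_apply, mul_left_comm]
  gcongr
  simpa using h.hausdorffMeasure_image_le (d := m) (Nat.cast_nonneg m)

theorem LipschitzOnWith.hausdorff_image_null {Z Z' : Type*} [EMetricSpace Z] [MeasurableSpace Z]
    [BorelSpace Z] [EMetricSpace Z'] [MeasurableSpace Z'] [BorelSpace Z'] {K : NNReal} {f : Z → Z'}
    {s : Set Z} (h : LipschitzOnWith K f s) {m : ℕ} (hs : hausdorff m s = 0) :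
    hausdorff m (f '' s) = 0 := by
  simpa [hs] using h.hausdorff_image_le m

theorem Isometry.hausdorff_image {Z Z' : Type*} [EMetricSpace Z] [MeasurableSpace Z]
    [BorelSpace Z] [EMetricSpace Z'] [MeasurableSpace Z'] [BorelSpace Z'] {f : Z → Z'}
    (h : Isometry f) (m : ℕ) (s : Set Z) : hausdorff m (f '' s) = hausdorff m s := by
  rw [hausdorff_apply, hausdorff_apply, h.hausdorffMeasure_image (Or.inl (Nat.cast_nonneg m))]

theorem hausdorff_image_val {Z : Type*} [EMetricSpace Z] [MeasurableSpace Z]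
    [BorelSpace Z] {X : Set Z} (m : ℕ) (s : Set X) :
    hausdorff m (Subtype.val '' s) = hausdorff m s :=
  isometry_subtype_coe.hausdorff_image m s

theorem LocallyLipschitz.hausdorff_image_null {Z Z' : Type*} [EMetricSpace Z] [MeasurableSpace Z]
    [BorelSpace Z] [SecondCountableTopology Z] [EMetricSpace Z'] [MeasurableSpace Z']
    [BorelSpace Z'] {f : Z → Z'} (hf : LocallyLipschitz f) {m : ℕ} {s : Set Z}
    (hs : hausdorff m s = 0) : hausdorff m (f '' s) = 0 := by
  choose K U hU hK using hf
  obtain ⟨c, hc, hcU⟩ := TopologicalSpace.countable_cover_nhds hU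
  refine measure_mono_null (t := ⋃ x ∈ c, f '' (s ∩ U x)) ?_ ?_
  · rintro _ ⟨x, hx, rfl⟩
    obtain ⟨y, hy, hxy⟩ := mem_iUnion₂.1 (hcU.ge (mem_univ x))
    exact mem_biUnion hy ⟨x, ⟨hx, hxy⟩, rfl⟩
  · rw [measure_biUnion_null_iff hc]
    exact fun x _ => ((hK x).mono inter_subset_right).hausdorff_image_null
      (measure_mono_null inter_subset_left hs)

/-- The ratio of Hausdorff measure and Lebesgue measure on `ℝᵐ`. -/
noncomputable def hausdorffConst (m : ℕ) : ℝ≥0∞ :=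
  (unitBallVolume m / 2 ^ m) *
    addHaarScalarFactor (hausdorffMeasure (m : ℝ) : Measure (Euc m)) volume

theorem isAddHaarMeasure_hausdorff_euclidean (m : ℕ) :
    (hausdorffMeasure (m : ℝ) : Measure (Euc m)).IsAddHaarMeasure := by
  have h : (hausdorffMeasure (Module.finrank ℝ (Euc m)) : Measure (Euc m)).IsAddHaarMeasure := by
    infer_instance
  simpa using h

theorem hausdorffConst_ne_zero (m : ℕ) : hausdorffConst m ≠ 0 := by
  have := isAddHaarMeasure_hausdorff_euclidean m
  refine mul_ne_zero (ENNReal.div_pos (unitBallVolume_ne_zero m) (by finiteness)).ne' ?_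
  have := addHaarScalarFactor_pos_of_isAddHaarMeasure
    (hausdorffMeasure (m : ℝ) : Measure (Euc m)) volume
  exact_mod_cast this.ne'

theorem hausdorffConst_ne_top (m : ℕ) : hausdorffConst m ≠ ∞ :=
  ENNReal.mul_ne_top (ENNReal.div_ne_top (unitBallVolume_ne_top m) (by positivity))
    ENNReal.coe_ne_top

theorem hausdorff_euclidean (m : ℕ) :
    (hausdorff m : Measure (Euc m)) = hausdorffConst m • volume := by
  have := isAddHaarMeasure_hausdorff_euclidean m
  have h := isAddLeftInvariant_eq_smul (hausdorffMeasure (m : ℝ) : Measure (Euc m)) volume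
  ext s -
  have hs := congrArg (fun μ : Measure (Euc m) => μ s) h
  simp only [Measure.smul_apply, ENNReal.smul_def, smul_eq_mul] at hs
  rw [hausdorff_apply, hs, hausdorffConst, Measure.smul_apply, smul_eq_mul, mul_assoc]

theorem hausdorff_euclidean_apply (m : ℕ) (s : Set (Euc m)) :
    hausdorff m s = hausdorffConst m * volume s := by
  simp [hausdorff_euclidean]

theorem volume_closedBall_euc (m : ℕ) (a : Euc m) {r : ℝ} (hr : 0 ≤ r) :
    volume (Metric.closedBall a r) = unitBallVolume m * ENNReal.ofReal (r ^ m) := by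
  rw [unitBallVolume, addHaar_closedBall' _ _ hr, mul_comm]
  simp

theorem LipschitzWith.hausdorff_image_null_of_volume {Z : Type*} [EMetricSpace Z]
    [MeasurableSpace Z] [BorelSpace Z] {m : ℕ} {K : NNReal} {f : Euc m → Z}
    (h : LipschitzWith K f) {s : Set (Euc m)} (hs : volume s = 0) :
    hausdorff m (f '' s) = 0 :=
  (h.lipschitzOnWith (s := s)).hausdorff_image_null (by simp [hausdorff_euclidean_apply, hs])

/-! ### Density estimates by covering -/

/-- Vitali covering: among the small balls in `U` of large ratio one selects disjoint ones whose
fivefold enlargements still cover. Their diameters are at most `10 r`, and `ε α(m) rᵐ` is at most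
the `φ` measure of the ball, so disjointness bounds the sum by `φ U`. -/
theorem hausdorffMeasure_frequently_lt_densityRatio_le {Z : Type*} [MetricSpace Z]
    [MeasurableSpace Z] [BorelSpace Z] [SecondCountableTopology Z] (φ : Measure Z) (m : ℕ)
    {U : Set Z} (hU : IsOpen U) {ε : ℝ≥0∞} (hε : ε ≠ 0) (hε' : ε ≠ ∞) :
    hausdorffMeasure (m : ℝ) {x ∈ U | ∃ᶠ r in 𝓝[>] (0 : ℝ), ε < densityRatio φ m x r} ≤
      10 ^ m / (unitBallVolume m * ε) * φ U := by
  set S := {x ∈ U | ∃ᶠ r in 𝓝[>] (0 : ℝ), ε < densityRatio φ m x r} with hS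
  set δ : ℕ → ℝ := fun k => 1 / ((k : ℝ) + 1)
  have hδ : ∀ k, 0 < δ k := fun k => Nat.one_div_pos_of_nat
  -- Pairs of centre and radius; radii below `δ k` let the mesh of the covers tend to zero.
  let t : ℕ → Set (Z × ℝ) := fun k => {p | p.1 ∈ S ∧ 0 < p.2 ∧ p.2 ≤ δ k ∧
    Metric.closedBall p.1 p.2 ⊆ U ∧ ε < densityRatio φ m p.1 p.2}
  have hV := fun k => Vitali.exists_disjoint_subfamily_covering_enlargement_closedBall
    (t k) Prod.fst Prod.snd (δ k) (fun a ha => ha.2.2.1) 5 (by norm_num)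
  choose u hut hud hcov using hV
  have hucount : ∀ k, (u k).Countable := by
    intro k
    refine (hud k).countable_of_nonempty_interior fun p hp => ?_
    exact ⟨p.1, mem_interior_iff_mem_nhds.2 (Metric.closedBall_mem_nhds _ (hut k hp).2.1)⟩
  have := fun k => (hucount k).to_subtype
  have key : ∀ k, ∑' p : u k, Metric.ediam (Metric.closedBall p.1.1 (5 * p.1.2)) ^ (m : ℝ) ≤
      10 ^ m / (unitBallVolume m * ε) * φ U := by
    intro k
    have h1 : ∀ p : u k, Metric.ediam (Metric.closedBall p.1.1 (5 * p.1.2)) ^ (m : ℝ) ≤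
        10 ^ m / (unitBallVolume m * ε) * φ (Metric.closedBall p.1.1 p.1.2) := by
      rintro ⟨p, hp⟩
      obtain ⟨-, hr, -, -, hlt⟩ := hut k hp
      have h2 : Metric.ediam (Metric.closedBall p.1 (5 * p.2)) ≤ ENNReal.ofReal (10 * p.2) := by
        refine Metric.ediam_le_of_forall_dist_le fun y hy z hz => ?_
        have := dist_triangle_right y z p.1
        rw [Metric.mem_closedBall] at hy hz
        linarith
      have h3 : ε * (unitBallVolume m * ENNReal.ofReal (p.2 ^ m)) ≤
          φ (Metric.closedBall p.1 p.2) := by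
        refine ENNReal.mul_le_of_le_div ?_
        exact hlt.le
      rw [ENNReal.rpow_natCast]
      calc Metric.ediam (Metric.closedBall p.1 (5 * p.2)) ^ m ≤ ENNReal.ofReal (10 * p.2) ^ m := by
            gcongr
        _ = 10 ^ m * ENNReal.ofReal (p.2 ^ m) := by
            rw [ENNReal.ofReal_mul (by norm_num), mul_pow, ENNReal.ofReal_pow hr.le]
            simp
        _ = 10 ^ m / (unitBallVolume m * ε) * (ε * (unitBallVolume m * ENNReal.ofReal (p.2 ^ m))) := by
            rw [← mul_assoc ε, mul_comm ε, ← mul_assoc (_ / _), ENNReal.div_mul_cancel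
              (mul_ne_zero (unitBallVolume_ne_zero m) hε)
              (ENNReal.mul_ne_top (unitBallVolume_ne_top m) hε')]
        _ ≤ _ := by gcongr
    refine (ENNReal.tsum_le_tsum h1).trans ?_
    rw [ENNReal.tsum_mul_left]
    gcongr
    rw [← measure_iUnion]
    · exact measure_mono (iUnion_subset fun p => (hut k p.2).2.2.2.1)
    · intro p q hpq
      exact hud k p.2 q.2 (fun h => hpq (Subtype.ext h))
    · exact fun p => Metric.isClosed_closedBall.measurableSet
  refine (hausdorffMeasure_le_liminf_tsum (l := atTop) (m : ℝ) S
    (fun k => ENNReal.ofReal (10 * δ k)) ?_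
    (fun k (p : u k) => Metric.closedBall p.1.1 (5 * p.1.2)) ?_ ?_).trans ?_
  · have : Tendsto (fun k => 10 * δ k) atTop (𝓝 (10 * 0)) :=
      (tendsto_one_div_add_atTop_nhds_zero_nat (𝕜 := ℝ)).const_mul 10
    simpa using ENNReal.tendsto_ofReal this
  · refine Eventually.of_forall fun k p => ?_
    refine Metric.ediam_le_of_forall_dist_le fun y hy z hz => ?_
    have := dist_triangle_right y z p.1.1
    have := (hut k p.2).2.2.1
    rw [Metric.mem_closedBall] at hy hz
    linarith
  · refine Eventually.of_forall fun k x hx => ?_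
    have h1 : ∀ᶠ r in 𝓝[>] (0 : ℝ), 0 < r ∧ r ≤ δ k ∧ Metric.closedBall x r ⊆ U := by
      obtain ⟨η, hη, hηU⟩ := Metric.nhds_basis_closedBall.mem_iff.1 (hU.mem_nhds hx.1)
      filter_upwards [self_mem_nhdsWithin,
        nhdsWithin_le_nhds (Iic_mem_nhds (hδ k)), nhdsWithin_le_nhds (Iic_mem_nhds hη)]
        with r h1 h2 h3
      exact ⟨h1, h2, (Metric.closedBall_subset_closedBall h3).trans hηU⟩
    obtain ⟨r, hr, h2, h3, h4⟩ := (hx.2.and_eventually h1).exists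
    obtain ⟨q, hq, hsub⟩ := hcov k (x, r) ⟨hx, h2, h3, h4, hr⟩
    exact mem_iUnion.2 ⟨⟨q, hq⟩, hsub (Metric.mem_closedBall_self h2.le)⟩
  · exact (liminf_le_liminf (Eventually.of_forall key)).trans (by simp)

/-- Countably many thresholds suffice, so the exceptional sets in the almost everywhere statements
are countable unions. -/
theorem hasDensity_zero_iff {Z : Type*} [MetricSpace Z] [MeasurableSpace Z] {φ : Measure Z}
    {m : ℕ} {a : Z} :
    HasDensity φ m a 0 ↔ ∀ k : ℕ, ¬ ∃ᶠ r in 𝓝[>] (0 : ℝ), ((k : ℝ≥0∞) + 1)⁻¹ < densityRatio φ m a r := by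
  rw [HasDensity, ENNReal.tendsto_nhds_zero]
  simp only [not_frequently, not_lt]
  constructor
  · intro h k
    exact h _ (by simp)
  · intro h ε hε
    obtain ⟨k, hk⟩ := ENNReal.exists_inv_nat_lt hε.ne'
    filter_upwards [h k] with r hr
    refine hr.trans (le_trans ?_ hk.le)
    gcongr
    simp

/-- A measure has zero density at almost all points of a null set. -/
theorem ae_hasDensity_zero {Z : Type*} [MetricSpace Z] [MeasurableSpace Z] [BorelSpace Z]
    [SecondCountableTopology Z] (φ : Measure Z) [φ.OuterRegular] (m : ℕ) {A : Set Z}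
    (hA : φ A = 0) : hausdorff m {x ∈ A | ¬ HasDensity φ m x 0} = 0 := by
  have h : {x ∈ A | ¬ HasDensity φ m x 0} ⊆ ⋃ k : ℕ,
      {x ∈ A | ∃ᶠ r in 𝓝[>] (0 : ℝ), ((k : ℝ≥0∞) + 1)⁻¹ < densityRatio φ m x r} := by
    rintro x ⟨hx, hx'⟩
    rw [hasDensity_zero_iff] at hx'
    push Not at hx'
    obtain ⟨k, hk⟩ := hx'
    exact mem_iUnion.2 ⟨k, hx, hk⟩
  refine measure_mono_null h (measure_iUnion_null fun k => ?_)
  rw [hausdorff_eq_zero_iff]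
  set ε : ℝ≥0∞ := ((k : ℝ≥0∞) + 1)⁻¹
  have hε : ε ≠ 0 := by simp [ε]
  have hε' : ε ≠ ∞ := by simp [ε]
  set C := 10 ^ m / (unitBallVolume m * ε)
  have hC : C ≠ ∞ := ENNReal.div_ne_top (by finiteness)
    (mul_ne_zero (unitBallVolume_ne_zero m) hε)
  refine le_antisymm (ENNReal.le_of_forall_pos_le_add fun η hη _ => ?_) zero_le
  have hη' : (η : ℝ≥0∞) / (C + 1) ≠ 0 := by
    simp [ENNReal.div_eq_zero_iff, hη.ne', hC]
  -- Outer regularity provides open neighbourhoods of `A` of arbitrarily small `φ` measure, to which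
  -- the covering estimate applies.
  obtain ⟨U, hAU, hU, hφ⟩ := A.exists_isOpen_lt_of_lt _ (hA ▸ pos_iff_ne_zero.2 hη' : φ A < _)
  calc _ ≤ hausdorffMeasure (m : ℝ) {x ∈ U | ∃ᶠ r in 𝓝[>] (0 : ℝ), ε < densityRatio φ m x r} :=
        measure_mono fun x hx => ⟨hAU hx.1, hx.2⟩
    _ ≤ C * φ U := hausdorffMeasure_frequently_lt_densityRatio_le φ m hU hε hε'
    _ ≤ (C + 1) * (η / (C + 1)) := by gcongr; simp
    _ ≤ η := ENNReal.mul_div_le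
    _ = _ := by simp

theorem densityRatio_sum {Z : Type*} [MetricSpace Z] [MeasurableSpace Z] [BorelSpace Z]
    {ι : Type*} (φ : ι → Measure Z) (m : ℕ) (a : Z) (r : ℝ) :
    densityRatio (Measure.sum φ) m a r = ∑' j, densityRatio (φ j) m a r := by
  simp only [densityRatio, Measure.sum_apply _ Metric.isClosed_closedBall.measurableSet,
    div_eq_mul_inv, ENNReal.tsum_mul_right]

/-- The tails of a locally finite sum of measures have small upper densities almost everywhere. -/
theorem ae_exists_tail_densityRatio_le {Z : Type*} [MetricSpace Z] [MeasurableSpace Z]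
    [BorelSpace Z] [SecondCountableTopology Z] (φ : ℕ → Measure Z)
    [IsLocallyFiniteMeasure (Measure.sum φ)] (m : ℕ) :
    ∀ᵐ x ∂(hausdorff m : Measure Z), ∀ k : ℕ, ∃ N : ℕ, ∀ᶠ r in 𝓝[>] (0 : ℝ),
      ∑' j, densityRatio (φ (j + N)) m x r ≤ ((k : ℝ≥0∞) + 1)⁻¹ := by
  rw [ae_all_iff]
  intro k
  rw [ae_iff]
  set ε : ℝ≥0∞ := ((k : ℝ≥0∞) + 1)⁻¹
  have hε : ε ≠ 0 := by simp [ε]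
  have hε' : ε ≠ ∞ := by simp [ε]
  have hloc := fun x => (Measure.sum φ).exists_isOpen_measure_lt_top x
  choose U hxU hU hfin using hloc
  obtain ⟨c, hc, hcU⟩ := TopologicalSpace.countable_cover_nhds
    (fun x => (hU x).mem_nhds (hxU x))
  refine measure_mono_null (t := ⋃ z ∈ c, {x ∈ U z | ∀ N : ℕ, ∃ᶠ r in 𝓝[>] (0 : ℝ),
    ε < densityRatio (Measure.sum fun j => φ (j + N)) m x r}) ?_ ?_
  · intro x hx
    obtain ⟨z, hz, hxz⟩ := mem_iUnion₂.1 (hcU.ge (mem_univ x))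
    refine mem_biUnion hz ⟨hxz, fun N => ?_⟩
    simp only [mem_ofPred_eq, not_exists, not_eventually, not_le] at hx
    simpa only [densityRatio_sum] using hx N
  · rw [measure_biUnion_null_iff hc]
    intro z _
    rw [hausdorff_eq_zero_iff]
    set C := 10 ^ m / (unitBallVolume m * ε)
    have hC : C ≠ ∞ := ENNReal.div_ne_top (by finiteness)
      (mul_ne_zero (unitBallVolume_ne_zero m) hε)
    have hsum : ∑' j, φ j (U z) ≠ ∞ := by
      rw [← Measure.sum_apply _ (hU z).measurableSet]
      exact (hfin z).ne
    -- A bad point is bad for every tail, so the covering estimate applies for each `N`; its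
    -- right-hand side tends to zero because the series of the measures of `U z` converges.
    have hlim : Tendsto (fun N => C * ∑' j, φ (j + N) (U z)) atTop (𝓝 (C * 0)) :=
      ENNReal.Tendsto.const_mul (ENNReal.tendsto_sum_nat_add (fun j => φ j (U z)) hsum)
        (Or.inr hC)
    rw [mul_zero] at hlim
    refine le_antisymm (ge_of_tendsto' hlim fun N => ?_) zero_le
    rw [← Measure.sum_apply (fun j => φ (j + N)) (hU z).measurableSet]
    refine le_trans (measure_mono fun x hx => ?_)
      (hausdorffMeasure_frequently_lt_densityRatio_le _ m (hU z) hε hε')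
    exact ⟨hx.1, hx.2 N⟩

/-- Almost everywhere, the density of a locally finite sum of measures is the sum of the
densities. -/
theorem ae_hasDensity_sum {Z : Type*} [MetricSpace Z] [MeasurableSpace Z]
    [BorelSpace Z] [SecondCountableTopology Z] (φ : ℕ → Measure Z)
    [IsLocallyFiniteMeasure (Measure.sum φ)] (m : ℕ) (θ : ℕ → Z → ℝ≥0∞)
    (h : ∀ j, ∀ᵐ x ∂(hausdorff m : Measure Z), HasDensity (φ j) m x (θ j x)) :
    ∀ᵐ x ∂(hausdorff m : Measure Z), HasDensity (Measure.sum φ) m x (∑' j, θ j x) := by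
  filter_upwards [ae_all_iff.2 h, ae_exists_tail_densityRatio_le φ m] with x hx htail
  have hfin : ∀ N : ℕ, Tendsto (fun r => ∑ j ∈ Finset.range N, densityRatio (φ j) m x r)
      (𝓝[>] (0 : ℝ)) (𝓝 (∑ j ∈ Finset.range N, θ j x)) :=
    fun N => tendsto_finsetSum _ fun j _ => hx j
  have hsplit : ∀ N r, densityRatio (Measure.sum φ) m x r =
      ∑ j ∈ Finset.range N, densityRatio (φ j) m x r +
        ∑' j, densityRatio (φ (j + N)) m x r := by
    intro N r
    rw [densityRatio_sum]
    exact (ENNReal.summable.sum_add_tsum_nat_add' (f := fun j => densityRatio (φ j) m x r)).symm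
  -- Partial sums alone bound the lower limit; the upper limit needs the uniformly small tail.
  refine tendsto_of_le_liminf_of_limsup_le ?_ ?_
  · rw [ENNReal.tsum_eq_iSup_nat]
    refine iSup_le fun N => ?_
    rw [← (hfin N).liminf_eq]
    refine liminf_le_liminf (Eventually.of_forall fun r => ?_)
    rw [hsplit N r]
    exact le_self_add
  · have hk : ∀ k : ℕ, limsup (densityRatio (Measure.sum φ) m x) (𝓝[>] 0) ≤
        ∑' j, θ j x + ((k : ℝ≥0∞) + 1)⁻¹ := by
      intro k
      obtain ⟨N, hN⟩ := htail k
      calc _ ≤ limsup (fun r => ∑ j ∈ Finset.range N, densityRatio (φ j) m x r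
              + ((k : ℝ≥0∞) + 1)⁻¹) (𝓝[>] 0) := by
            refine limsup_le_limsup ?_
            filter_upwards [hN] with r hr
            rw [hsplit N r]
            gcongr
        _ = ∑ j ∈ Finset.range N, θ j x + ((k : ℝ≥0∞) + 1)⁻¹ :=
            ((hfin N).add tendsto_const_nhds).limsup_eq
        _ ≤ _ := by
            gcongr
            exact ENNReal.sum_le_tsum _
    have hlim : Tendsto (fun k : ℕ => ∑' j, θ j x + ((k : ℝ≥0∞) + 1)⁻¹) atTop
        (𝓝 (∑' j, θ j x + 0)) := by
      refine tendsto_const_nhds.add ?_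
      have := (tendsto_add_atTop_iff_nat 1).2 ENNReal.tendsto_inv_nat_nhds_zero
      simpa using this
    rw [add_zero] at hlim
    exact ge_of_tendsto' hlim hk

/-! ### Jacobians of linear maps -/

section Jacobian

variable {m : ℕ} {F G : Type*} [NormedAddCommGroup F] [InnerProductSpace ℝ F]
  [NormedAddCommGroup G] [InnerProductSpace ℝ G]

/-- The `m`-dimensional Jacobian of a linear map on `ℝᵐ`: the square root of the Gram determinant
of the images of the standard basis. -/
noncomputable def jacobian (A : Euc m →L[ℝ] F) : ℝ :=
  √(Matrix.gram ℝ fun i => A (EuclideanSpace.basisFun (Fin m) ℝ i)).det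

theorem jacobian_nonneg (A : Euc m →L[ℝ] F) : 0 ≤ jacobian A := Real.sqrt_nonneg _

theorem continuous_jacobian : Continuous (jacobian : (Euc m →L[ℝ] F) → ℝ) := by
  refine Real.continuous_sqrt.comp (Continuous.matrix_det ?_)
  refine continuous_matrix fun i j => ?_
  simp only [Matrix.gram_apply]
  fun_prop

theorem jacobian_isometry_comp (e : F →ₗᵢ[ℝ] G) (A : Euc m →L[ℝ] F) :
    jacobian (e.toContinuousLinearMap ∘L A) = jacobian A := by
  simp [jacobian, Matrix.gram]

theorem gram_sum_smul (v : Fin m → F) (N : Matrix (Fin m) (Fin m) ℝ) :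
    Matrix.gram ℝ (fun i => ∑ k, N k i • v k) = N.transpose * Matrix.gram ℝ v * N := by
  ext i j
  simp only [Matrix.gram_apply, sum_inner, inner_sum, inner_smul_left, inner_smul_right,
    Matrix.mul_apply, Matrix.transpose_apply, Finset.sum_mul, RCLike.conj_to_real]
  simp only [Finset.mul_sum]
  refine Finset.sum_congr rfl fun k _ => Finset.sum_congr rfl fun l _ => ?_
  rw [real_inner_comm]
  ring

/-- The Gram matrix of the images changes from `G` to `Nᵀ G N`, where `N` is the matrix of `B`. -/
theorem jacobian_comp (A : Euc m →L[ℝ] F) (B : Euc m →L[ℝ] Euc m) :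
    jacobian (A ∘L B) = jacobian A * |LinearMap.det (B : Euc m →ₗ[ℝ] Euc m)| := by
  set b := EuclideanSpace.basisFun (Fin m) ℝ
  set N := LinearMap.toMatrix b.toBasis b.toBasis (B : Euc m →ₗ[ℝ] Euc m)
  have h : (fun i => (A ∘L B) (b i)) = fun i => ∑ k, N k i • A (b k) := by
    funext i
    have := b.toBasis.sum_repr (B (b i))
    rw [ContinuousLinearMap.comp_apply, ← this, _root_.map_sum]
    simp [N, LinearMap.toMatrix_apply]
  rw [jacobian, h, gram_sum_smul, Matrix.det_mul, Matrix.det_mul, Matrix.det_transpose,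
    LinearMap.det_toMatrix, mul_right_comm, ← sq, mul_comm, Real.sqrt_mul' _ (sq_nonneg _),
    Real.sqrt_sq_eq_abs, jacobian]

theorem jacobian_eq_abs_det (A : Euc m →L[ℝ] Euc m) :
    jacobian A = |LinearMap.det (A : Euc m →ₗ[ℝ] Euc m)| := by
  have h := jacobian_comp (ContinuousLinearMap.id ℝ (Euc m)) A
  have h1 : jacobian (ContinuousLinearMap.id ℝ (Euc m)) = 1 := by
    have : Matrix.gram ℝ (fun i => (ContinuousLinearMap.id ℝ (Euc m))
        (EuclideanSpace.basisFun (Fin m) ℝ i)) = 1 :=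
      Matrix.gram_eq_one_iff_orthonormal.2 (EuclideanSpace.basisFun (Fin m) ℝ).orthonormal
    rw [jacobian, this]
    simp
  simpa [h1] using h

theorem jacobian_pos_iff {A : Euc m →L[ℝ] F} : 0 < jacobian A ↔ Function.Injective A := by
  set b := EuclideanSpace.basisFun (Fin m) ℝ
  have h : 0 < jacobian A ↔ LinearIndependent ℝ (fun i => A (b i)) := by
    rw [jacobian, Real.sqrt_pos, ← Matrix.det_gram_ne_zero_iff_linearIndependent,
      lt_iff_le_and_ne, and_iff_right (Matrix.posSemidef_gram ℝ _).det_nonneg, ne_comm]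
  rw [h]
  constructor
  · intro hli
    refine (injective_iff_map_eq_zero A).2 fun x hx => ?_
    have hx' : ∑ i, x i • A (b i) = 0 := by
      rw [← hx]
      conv_rhs => rw [← b.sum_repr x, _root_.map_sum]
      simp [b]
    ext i
    exact Fintype.linearIndependent_iff.1 hli _ hx' i
  · intro hA
    have := b.toBasis.linearIndependent.map' (A : Euc m →ₗ[ℝ] F) (LinearMap.ker_eq_bot.2 hA)
    simpa [Function.comp_def] using this

theorem jacobian_eq_zero_iff {A : Euc m →L[ℝ] F} :
    jacobian A = 0 ↔ ¬ Function.Injective A := by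
  rw [← jacobian_pos_iff, not_lt]
  exact ⟨fun h => h.le, fun h => le_antisymm h (jacobian_nonneg A)⟩

/-- An `m`-dimensional inner product space is isometric to `ℝᵐ`. -/
theorem nonempty_linearIsometryEquiv_euc [FiniteDimensional ℝ F] (h : Module.finrank ℝ F = m) :
    Nonempty (F ≃ₗᵢ[ℝ] Euc m) :=
  ⟨((stdOrthonormalBasis ℝ F).reindex (finCongr h)).repr⟩

/-- An injective linear map on `ℝᵐ` factors through an automorphism of `ℝᵐ` and an isometry. -/
theorem exists_isometry_comp (A : Euc m →L[ℝ] F) (hA : Function.Injective A) :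
    ∃ (e : Euc m →ₗᵢ[ℝ] F) (M : Euc m ≃L[ℝ] Euc m),
      A = e.toContinuousLinearMap ∘L (M : Euc m →L[ℝ] Euc m) := by
  let R := LinearMap.range (A : Euc m →ₗ[ℝ] F)
  have hR : Module.finrank ℝ R = m := by
    rw [LinearMap.finrank_range_of_inj hA]
    simp
  obtain ⟨e⟩ := nonempty_linearIsometryEquiv_euc (m := m) hR
  let M₀ : Euc m ≃ₗ[ℝ] Euc m := (LinearEquiv.ofInjective (A : Euc m →ₗ[ℝ] F) hA).trans
    e.toLinearEquiv
  refine ⟨R.subtypeₗᵢ.comp e.symm.toLinearIsometry, M₀.toContinuousLinearEquiv, ?_⟩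
  ext x : 1
  simp [M₀, R]

/-- By factoring `A` into an isometry after an automorphism of `ℝᵐ`, only the scaling of Lebesgue
measure by the determinant remains. -/
theorem hausdorff_image_linear [MeasurableSpace F] [BorelSpace F] {A : Euc m →L[ℝ] F}
    (hA : Function.Injective A) (s : Set (Euc m)) :
    hausdorff m (A '' s) = ENNReal.ofReal (jacobian A) * hausdorff m s := by
  obtain ⟨e, M, rfl⟩ := exists_isometry_comp A hA
  rw [jacobian_isometry_comp, ContinuousLinearMap.coe_comp, image_comp,
    show (e.toContinuousLinearMap : Euc m → F) = e from rfl, e.isometry.hausdorff_image,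
    hausdorff_euclidean_apply, hausdorff_euclidean_apply, jacobian_eq_abs_det]
  have := addHaar_image_linearMap (volume : Measure (Euc m))
    ((M : Euc m →L[ℝ] Euc m) : Euc m →ₗ[ℝ] Euc m) s
  rw [ContinuousLinearMap.coe_coe] at this
  rw [this, mul_left_comm]

/-- The map `B ∘ A⁻¹` is `c`-Lipschitzian on the image of `A`; comparing the Hausdorff measures of
the two images of the unit ball gives the factor `cᵐ`. -/
theorem jacobian_le_of_norm_le {A : Euc m →L[ℝ] F} {B : Euc m →L[ℝ] G}
    (hA : Function.Injective A) {c : NNReal} (h : ∀ w, ‖B w‖ ≤ c * ‖A w‖) :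
    jacobian B ≤ c ^ m * jacobian A := by
  by_cases hB : Function.Injective B
  swap
  · rw [jacobian_eq_zero_iff.2 hB]
    have := jacobian_nonneg A
    positivity
  borelize F G
  set s := Metric.closedBall (0 : Euc m) 1
  have hlip : LipschitzOnWith c (B ∘ Function.invFun A) (A '' s) := by
    refine LipschitzOnWith.of_dist_le_mul ?_
    rintro _ ⟨x, -, rfl⟩ _ ⟨y, -, rfl⟩
    simp only [Function.comp_apply, Function.leftInverse_invFun hA _]
    rw [dist_eq_norm, dist_eq_norm, ← map_sub, ← map_sub]
    exact h _
  have himg : (B ∘ Function.invFun A) '' (A '' s) = B '' s := by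
    rw [← image_comp]
    refine image_congr fun x _ => ?_
    simp only [Function.comp_apply, Function.leftInverse_invFun hA _]
  have hle := hlip.hausdorff_image_le m
  rw [himg, hausdorff_image_linear hA, hausdorff_image_linear hB, ← mul_assoc] at hle
  have hs0 : hausdorff m s ≠ 0 := by
    rw [hausdorff_euclidean_apply]
    exact mul_ne_zero (hausdorffConst_ne_zero m) (unitBallVolume_ne_zero m)
  have hs1 : hausdorff m s ≠ ∞ := by
    rw [hausdorff_euclidean_apply]
    exact ENNReal.mul_ne_top (hausdorffConst_ne_top m) (unitBallVolume_ne_top m)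
  rw [ENNReal.mul_le_mul_iff_left hs0 hs1] at hle
  have hc : (c : ℝ≥0∞) ^ m = ENNReal.ofReal ((c : ℝ) ^ m) := by
    rw [ENNReal.ofReal_pow c.coe_nonneg, ENNReal.ofReal_coe_nnreal]
  rw [hc, ← ENNReal.ofReal_mul (by positivity)] at hle
  exact (ENNReal.ofReal_le_ofReal_iff (mul_nonneg (by positivity) (jacobian_nonneg A))).1 hle

/-- This links the norm used in the approximate Jacobian with the Gram determinant used in the area
formula. -/
theorem norm_exteriorPower_ιMulti [FiniteDimensional ℝ F] (v : Fin m → F) :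
    ‖exteriorPower.ιMulti ℝ m v‖ = √(Matrix.gram ℝ v).det := by
  rw [← exteriorPower.inner_ιMulti_self, real_inner_self_eq_norm_sq, Real.sqrt_sq (norm_nonneg _)]

/-- On `m`-dimensional spaces the norm of `⋀ₘ L` is a quotient of Jacobians. -/
theorem exteriorNorm_mul_jacobian [FiniteDimensional ℝ F] [FiniteDimensional ℝ G]
    (hF : Module.finrank ℝ F = m) (L : F →L[ℝ] G) (D : Euc m →L[ℝ] F) :
    exteriorNorm m (L : F →ₗ[ℝ] G) * jacobian D = jacobian (L ∘L D) := by
  obtain ⟨e⟩ := nonempty_linearIsometryEquiv_euc (m := m) hF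
  set ec : F →L[ℝ] Euc m := e.toLinearIsometry.toContinuousLinearMap
  set es : Euc m →L[ℝ] F := e.symm.toLinearIsometry.toContinuousLinearMap
  set b := EuclideanSpace.basisFun (Fin m) ℝ
  -- Through an isometry of `F` with `ℝᵐ`, the map `D` becomes an endomorphism of `ℝᵐ`, for which
  -- Jacobians multiply.
  have h1 : L ∘L D = (L ∘L es) ∘L (ec ∘L D) := by
    ext x : 1
    simp [ec, es]
  have h2 : jacobian D = |LinearMap.det ((ec ∘L D : Euc m →L[ℝ] Euc m) : Euc m →ₗ[ℝ] Euc m)| := by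
    rw [← jacobian_eq_abs_det, jacobian_isometry_comp]
  have h3 : exteriorNorm m (L : F →ₗ[ℝ] G) = jacobian (L ∘L es) := by
    -- The `m`-th exterior power of `F` is a line spanned by the unit vector `ω`, so the operator
    -- norm is attained at `ω`.
    set ω := exteriorPower.ιMulti ℝ m fun i => es (b i)
    have hω : ‖ω‖ = 1 := by
      rw [norm_exteriorPower_ιMulti]
      have : Orthonormal ℝ fun i => es (b i) :=
        b.orthonormal.comp_linearIsometry e.symm.toLinearIsometry
      rw [Matrix.gram_eq_one_iff_orthonormal.2 this]
      simp
    have hω0 : ω ≠ 0 := by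
      rw [← norm_ne_zero_iff, hω]
      exact one_ne_zero
    have hspan := (finrank_eq_one_iff_of_nonzero' ω hω0).1 (by
      rw [exteriorPower.finrank_eq, hF, Nat.choose_self])
    have hL : ‖exteriorPower.map m (L : F →ₗ[ℝ] G) ω‖ = jacobian (L ∘L es) := by
      rw [exteriorPower.map_apply_ιMulti, norm_exteriorPower_ιMulti]
      rfl
    refine le_antisymm (ContinuousLinearMap.opNorm_le_bound _ (jacobian_nonneg _) fun x => ?_) ?_
    · obtain ⟨c, rfl⟩ := hspan x
      simp only [map_smul, norm_smul, hω, mul_one]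
      rw [LinearMap.coe_toContinuousLinearMap', hL, mul_comm]
    · have := ContinuousLinearMap.le_opNorm (LinearMap.toContinuousLinearMap
        (exteriorPower.map m (L : F →ₗ[ℝ] G))) ω
      rwa [hω, mul_one, LinearMap.coe_toContinuousLinearMap', hL] at this
  rw [h1, jacobian_comp, h3, h2]

end Jacobian

/-- The sequence `1 + 1/(j+1)` replaces all factors above 1, so that only countably many null sets
have to be discarded when this is used pointwise. -/
theorem ennreal_le_of_forall_inv {a b : ℝ≥0∞} (k : ℕ)
    (h : ∀ j : ℕ, a ≤ ((1 + ((j : NNReal) + 1)⁻¹ : NNReal) : ℝ≥0∞) ^ k * b) : a ≤ b := by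
  have hlim : Tendsto (fun j : ℕ => ((1 + ((j : NNReal) + 1)⁻¹ : NNReal) : ℝ≥0∞) ^ k * b) atTop
      (𝓝 (((1 + 0 : NNReal) : ℝ≥0∞) ^ k * b)) := by
    refine ENNReal.Tendsto.mul_const ?_ (Or.inl (by simp))
    refine ((ENNReal.continuous_pow k).tendsto _).comp ?_
    rw [ENNReal.tendsto_coe]
    refine tendsto_const_nhds.add ?_
    simpa using tendsto_one_div_add_atTop_nhds_zero_nat (𝕜 := NNReal)
  simp only [add_zero, ENNReal.coe_one, one_pow, one_mul] at hlim
  exact ge_of_tendsto' hlim h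

theorem ennreal_le_of_forall_one_lt {a b : ℝ≥0∞} (k : ℕ)
    (h : ∀ c : NNReal, 1 < c → a ≤ (c : ℝ≥0∞) ^ k * b) : a ≤ b :=
  ennreal_le_of_forall_inv k fun j => h _ (by simp)

/-! ### Density points -/

/-- `u` is a Lebesgue density point of `s`. -/
def IsDensityPoint {m : ℕ} (s : Set (Euc m)) (u : Euc m) : Prop :=
  Tendsto (fun r => volume (s ∩ Metric.closedBall u r) / volume (Metric.closedBall u r))
    (𝓝[>] 0) (𝓝 1)

theorem ae_isDensityPoint {m : ℕ} (s : Set (Euc m)) :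
    ∀ᵐ u ∂(volume.restrict s), IsDensityPoint s u :=
  Besicovitch.ae_tendsto_measure_inter_div volume s

/-- Every direction is a limit of rescaled secants at a density point. -/
theorem IsDensityPoint.exists_seq {m : ℕ} {s : Set (Euc m)} {u : Euc m}
    (h : IsDensityPoint s u) (w : Euc m) :
    ∃ (c : ℕ → ℝ) (d : ℕ → Euc m), (∀ k, 0 < c k) ∧ (∀ k, u + d k ∈ s) ∧
      Tendsto d atTop (𝓝 0) ∧ Tendsto (fun k => c k • d k) atTop (𝓝 w) := by
  have key : ∀ k : ℕ, ∃ r : ℝ, ∃ e : Euc m, 0 < r ∧ r < 1 / ((k : ℝ) + 1) ∧ u + r • e ∈ s ∧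
      dist e w ≤ 1 / ((k : ℝ) + 1) := by
    intro k
    have hk : (0 : ℝ) < 1 / ((k : ℝ) + 1) := Nat.one_div_pos_of_nat
    -- At a density point, `s` meets `u + r B(w, 1/(k+1))` for all small `r`; a common point yields
    -- the secant `r e` with `e` close to `w`.
    have h1 := eventually_nonempty_inter_smul_of_density_one volume s u h
      (Metric.closedBall w (1 / ((k : ℝ) + 1))) Metric.isClosed_closedBall.measurableSet
      (Metric.measure_closedBall_pos _ _ hk).ne'
    obtain ⟨r, ⟨x, hxs, hx⟩, hr, hr'⟩ := (h1.and ((eventually_mem_nhdsWithin (a := (0 : ℝ))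
      (s := Ioi 0)).and (nhdsWithin_le_nhds (Iio_mem_nhds hk)))).exists
    obtain ⟨a, rfl, b, ⟨e, he, rfl⟩, rfl⟩ := hx
    exact ⟨r, e, hr, hr', hxs, he⟩
  choose r e hr hr' hs he using key
  have hlim := tendsto_one_div_add_atTop_nhds_zero_nat (𝕜 := ℝ)
  have he' : Tendsto e atTop (𝓝 w) :=
    tendsto_iff_dist_tendsto_zero.2 (squeeze_zero (fun _ => dist_nonneg) he hlim)
  have hr0 : Tendsto r atTop (𝓝 0) :=
    squeeze_zero (fun k => (hr k).le) (fun k => (hr' k).le) hlim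
  refine ⟨fun k => (r k)⁻¹, fun k => r k • e k, fun k => inv_pos.2 (hr k), hs, ?_, ?_⟩
  · simpa using hr0.smul he'
  · simpa only [smul_smul, inv_mul_cancel₀ (hr _).ne', one_smul] using he'

/-- A bound for difference quotients passes to the differentials at density points. -/
theorem IsDensityPoint.norm_fderiv_le {m : ℕ} {s : Set (Euc m)} {u : Euc m}
    (h : IsDensityPoint s u) {F G : Type*} [NormedAddCommGroup F] [NormedSpace ℝ F]
    [NormedAddCommGroup G] [NormedSpace ℝ G] {f : Euc m → F} {f' : Euc m →L[ℝ] F}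
    {g : Euc m → G} {g' : Euc m →L[ℝ] G}
    (hf : HasFDerivAt f f' u) (hg : HasFDerivAt g g' u) {C : ℝ}
    (hC : ∀ v ∈ s, ‖f v - f u‖ ≤ C * ‖g v - g u‖) (w : Euc m) :
    ‖f' w‖ ≤ C * ‖g' w‖ := by
  obtain ⟨c, d, hc, hd, hd0, hcd⟩ := h.exists_seq w
  have h1 := (hf.hasFDerivWithinAt (s := univ)).lim hd0 (by simp) hcd
  have h2 := (hg.hasFDerivWithinAt (s := univ)).lim hd0 (by simp) hcd
  refine le_of_tendsto_of_tendsto' h1.norm (h2.norm.const_mul C) fun k => ?_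
  rw [norm_smul, norm_smul, mul_left_comm]
  gcongr
  exact hC _ (hd k)

/-! ### The area formula -/

section Area

set_option linter.unusedSectionVars false

variable {m : ℕ} {F : Type*} [NormedAddCommGroup F] [InnerProductSpace ℝ F]

theorem exists_pos_mul_norm_le {A : Euc m →L[ℝ] F} (hA : Function.Injective A) :
    ∃ c : NNReal, 0 < c ∧ ∀ w, c * ‖w‖ ≤ ‖A w‖ := by
  obtain ⟨K, hK, hA⟩ := (A : Euc m →ₗ[ℝ] F).exists_antilipschitzWith (LinearMap.ker_eq_bot.2 hA)
  refine ⟨K⁻¹, by positivity, fun w => ?_⟩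
  have := hA.le_mul_dist w 0
  simp only [dist_zero_right, ContinuousLinearMap.coe_coe, map_zero] at this
  rw [NNReal.coe_inv, inv_mul_le_iff₀ (by exact_mod_cast hK)]
  exact this

/-- `s` is mapped by `ψ` in the same way as by the injective linear map `A` up to the factor
`c`. -/
structure IsCloseToLinear (c : NNReal) (ψ : Euc m → F) (A : Euc m →L[ℝ] F) (s : Set (Euc m)) :
    Prop where
  injective : Function.Injective A
  le : ∀ u ∈ s, ∀ v ∈ s, ‖ψ v - ψ u‖ ≤ c * ‖A v - A u‖
  ge : ∀ u ∈ s, ∀ v ∈ s, ‖A v - A u‖ ≤ c * ‖ψ v - ψ u‖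

variable [FiniteDimensional ℝ F]

/-- Countable decomposition of the domain of a map with injective differentials. -/
theorem exists_partition_isCloseToLinear {ψ : Euc m → F} {s : Set (Euc m)}
    (hd : ∀ u ∈ s, DifferentiableAt ℝ ψ u)
    (hinj : ∀ u ∈ s, Function.Injective (fderiv ℝ ψ u)) {c : NNReal} (hc : 1 < c) :
    ∃ (t : ℕ → Set (Euc m)) (A : ℕ → Euc m →L[ℝ] F), Pairwise (Function.onFun Disjoint t) ∧
      (∀ k, MeasurableSet (t k)) ∧ s ⊆ ⋃ k, t k ∧
      (∀ k, s.Nonempty → IsCloseToLinear c ψ (A k) (s ∩ t k)) := by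
  classical
  -- With this tolerance the error of the linear approximation is at most `(1 - 1/c) ‖A v - A u‖`,
  -- which gives both comparison inequalities with factor `c`.
  let r : (Euc m →L[ℝ] F) → NNReal := fun A =>
    if h : Function.Injective A then (1 - c⁻¹) * (exists_pos_mul_norm_le h).choose else 1
  have hc1 : c⁻¹ < 1 := inv_lt_one_of_one_lt₀ hc
  have hr : ∀ A, r A ≠ 0 := by
    intro A
    by_cases h : Function.Injective A
    · simp only [r, h, dif_pos]
      exact mul_ne_zero (tsub_pos_of_lt hc1).ne' (exists_pos_mul_norm_le h).choose_spec.1.ne'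
    · simp [r, h]
  obtain ⟨t, A, htd, htm, hst, happ, hA⟩ := exists_partition_approximatesLinearOn_of_hasFDerivWithinAt
    ψ s (fderiv ℝ ψ) (fun u hu => (hd u hu).hasFDerivAt.hasFDerivWithinAt) r hr
  refine ⟨t, A, htd, htm, hst, fun k hs => ?_⟩
  have hAk : Function.Injective (A k) := by
    obtain ⟨y, hy, hAy⟩ := hA hs k
    rw [hAy]
    exact hinj y hy
  have hcR : (1 : ℝ) < c := by exact_mod_cast hc
  have hcpos : (0 : ℝ) < c := by linarith
  have hbound : ∀ u ∈ s ∩ t k, ∀ v ∈ s ∩ t k,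
      ‖ψ v - ψ u - (A k v - A k u)‖ ≤ (1 - (c : ℝ)⁻¹) * ‖A k v - A k u‖ := by
    intro u hu v hv
    have h1 := happ k v hv u hu
    simp only [r, hAk, dif_pos] at h1
    have h2 := (exists_pos_mul_norm_le hAk).choose_spec.2 (v - u)
    rw [map_sub] at h1 h2
    rw [NNReal.coe_mul, NNReal.coe_sub hc1.le, NNReal.coe_one, NNReal.coe_inv, mul_assoc] at h1
    refine h1.trans ?_
    have : 0 ≤ 1 - (c : ℝ)⁻¹ := by
      have : (c : ℝ)⁻¹ < 1 := by exact_mod_cast hc1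
      linarith
    gcongr
  refine ⟨hAk, fun u hu v hv => ?_, fun u hu v hv => ?_⟩
  · have h := hbound u hu v hv
    have h3 := norm_le_norm_add_norm_sub' (ψ v - ψ u) (A k v - A k u)
    -- The triangle inequality yields the factor `1 + (1 - 1/c)`; it is at most `c` because `c + 1/c
    -- ≥ 2`.
    have h4 : 2 - (c : ℝ)⁻¹ ≤ c := by
      have : (c : ℝ) * (c : ℝ)⁻¹ = 1 := mul_inv_cancel₀ hcpos.ne'
      have h5 : (0 : ℝ) < (c : ℝ)⁻¹ := inv_pos.2 hcpos
      nlinarith [sq_nonneg ((c : ℝ) - 1)]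
    have h5 : (2 - (c : ℝ)⁻¹) * ‖A k v - A k u‖ ≤ c * ‖A k v - A k u‖ := by gcongr
    linarith
  · have h := hbound u hu v hv
    have h3 := norm_sub_norm_le (A k v - A k u) (ψ v - ψ u)
    rw [norm_sub_rev (A k v - A k u) (ψ v - ψ u)] at h3
    have h4 : (c : ℝ)⁻¹ * ‖A k v - A k u‖ ≤ ‖ψ v - ψ u‖ := by linarith
    rwa [inv_mul_le_iff₀ hcpos] at h4

variable [MeasurableSpace F] [BorelSpace F]

/-- The map `ψ ∘ A⁻¹` is `c`-Lipschitzian on the image of `s'` under `A`. The reverse estimate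
`le_hausdorff` uses `A ∘ ψ⁻¹`. -/
theorem IsCloseToLinear.hausdorff_le {c : NNReal} {ψ : Euc m → F} {A : Euc m →L[ℝ] F}
    {s : Set (Euc m)} (h : IsCloseToLinear c ψ A s) {s' : Set (Euc m)} (hs : s' ⊆ s) :
    hausdorff m (ψ '' s') ≤ (c : ℝ≥0∞) ^ m * hausdorff m (A '' s') := by
  have hlip : LipschitzOnWith c (ψ ∘ Function.invFun A) (A '' s') := by
    refine LipschitzOnWith.of_dist_le_mul ?_
    rintro _ ⟨x, hx, rfl⟩ _ ⟨y, hy, rfl⟩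
    simp only [Function.comp_apply, Function.leftInverse_invFun h.injective _]
    rw [dist_eq_norm, dist_eq_norm]
    exact h.le _ (hs hy) _ (hs hx)
  have himg : (ψ ∘ Function.invFun A) '' (A '' s') = ψ '' s' := by
    rw [← image_comp]
    refine image_congr fun x _ => ?_
    simp only [Function.comp_apply, Function.leftInverse_invFun h.injective _]
  have h' := hlip.hausdorff_image_le m
  rwa [himg] at h'

theorem IsCloseToLinear.injOn {c : NNReal} {ψ : Euc m → F} {A : Euc m →L[ℝ] F}
    {s : Set (Euc m)} (h : IsCloseToLinear c ψ A s) : InjOn ψ s := by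
  intro x hx y hy hxy
  have := h.ge x hx y hy
  rw [hxy, sub_self, norm_zero, mul_zero] at this
  exact h.injective (sub_eq_zero.1 (norm_le_zero_iff.1 this)).symm

theorem IsCloseToLinear.le_hausdorff {c : NNReal} {ψ : Euc m → F} {A : Euc m →L[ℝ] F}
    {s : Set (Euc m)} (h : IsCloseToLinear c ψ A s) {s' : Set (Euc m)} (hs : s' ⊆ s) :
    hausdorff m (A '' s') ≤ (c : ℝ≥0∞) ^ m * hausdorff m (ψ '' s') := by
  have hinv := (h.injOn.mono hs).leftInvOn_invFunOn
  have hlip : LipschitzOnWith c (A ∘ Function.invFunOn ψ s') (ψ '' s') := by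
    refine LipschitzOnWith.of_dist_le_mul ?_
    rintro _ ⟨x, hx, rfl⟩ _ ⟨y, hy, rfl⟩
    simp only [Function.comp_apply, hinv hx, hinv hy]
    rw [dist_eq_norm, dist_eq_norm]
    exact h.ge _ (hs hy) _ (hs hx)
  have himg : (A ∘ Function.invFunOn ψ s') '' (ψ '' s') = A '' s' := by
    rw [← image_comp]
    refine image_congr fun x hx => ?_
    simp only [Function.comp_apply, hinv hx]
  have h' := hlip.hausdorff_image_le m
  rwa [himg] at h'

theorem ae_restrict_hausdorff {s : Set (Euc m)} {p : Euc m → Prop}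
    (h : ∀ᵐ u ∂(volume.restrict s), p u) :
    ∀ᵐ u ∂((hausdorff m : Measure (Euc m)).restrict s), p u := by
  rw [hausdorff_euclidean, Measure.restrict_smul]
  exact Measure.ae_smul_measure h _

theorem measurable_jacobian_fderiv (ψ : Euc m → F) :
    Measurable fun u => ENNReal.ofReal (jacobian (fderiv ℝ ψ u)) := by
  have := FiniteDimensional.complete ℝ F
  exact (continuous_jacobian.measurable.comp (measurable_fderiv ℝ ψ)).ennreal_ofReal

/-- One factor `cᵐ` comes from comparing the images of `s` under `ψ` and `A`, the other from
comparing the Jacobians of `Dψ` and `A`, which is possible at density points of `s`. -/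
theorem IsCloseToLinear.lintegral_jacobian {c : NNReal} {ψ : Euc m → F} {A : Euc m →L[ℝ] F}
    {s : Set (Euc m)} (h : IsCloseToLinear c ψ A s) (hs : MeasurableSet s)
    (hd : ∀ u ∈ s, DifferentiableAt ℝ ψ u)
    (hinj : ∀ u ∈ s, Function.Injective (fderiv ℝ ψ u)) :
    hausdorff m (ψ '' s) ≤ (c : ℝ≥0∞) ^ (2 * m) *
        ∫⁻ u in s, ENNReal.ofReal (jacobian (fderiv ℝ ψ u)) ∂hausdorff m ∧
      ∫⁻ u in s, ENNReal.ofReal (jacobian (fderiv ℝ ψ u)) ∂hausdorff m ≤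
        (c : ℝ≥0∞) ^ (2 * m) * hausdorff m (ψ '' s) := by
  have hofReal : ∀ x : ℝ, ENNReal.ofReal ((c : ℝ) ^ m * x) =
      (c : ℝ≥0∞) ^ m * ENNReal.ofReal x := by
    intro x
    rw [ENNReal.ofReal_mul (by positivity), ENNReal.ofReal_pow c.coe_nonneg,
      ENNReal.ofReal_coe_nnreal]
  have hae : ∀ᵐ u ∂((hausdorff m : Measure (Euc m)).restrict s),
      ENNReal.ofReal (jacobian A) ≤
          (c : ℝ≥0∞) ^ m * ENNReal.ofReal (jacobian (fderiv ℝ ψ u)) ∧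
        ENNReal.ofReal (jacobian (fderiv ℝ ψ u)) ≤
          (c : ℝ≥0∞) ^ m * ENNReal.ofReal (jacobian A) := by
    refine ae_restrict_hausdorff ?_
    filter_upwards [ae_isDensityPoint s, ae_restrict_mem hs] with u hu hus
    have h1 := hu.norm_fderiv_le (hd u hus).hasFDerivAt A.hasFDerivAt
      (fun v hv => h.le u hus v hv)
    have h2 := hu.norm_fderiv_le A.hasFDerivAt (hd u hus).hasFDerivAt
      (fun v hv => h.ge u hus v hv)
    rw [← hofReal, ← hofReal]
    exact ⟨ENNReal.ofReal_le_ofReal (jacobian_le_of_norm_le (hinj u hus) h2),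
      ENNReal.ofReal_le_ofReal (jacobian_le_of_norm_le h.injective h1)⟩
  have hlin : hausdorff m (A '' s) = ∫⁻ _ in s, ENNReal.ofReal (jacobian A) ∂hausdorff m := by
    rw [hausdorff_image_linear h.injective, setLIntegral_const]
  have hmeas := measurable_jacobian_fderiv ψ
  constructor
  · refine (h.hausdorff_le subset_rfl).trans ?_
    rw [two_mul, pow_add, mul_assoc, ← lintegral_const_mul _ hmeas, hlin]
    refine mul_le_mul_right (lintegral_mono_ae (hae.mono fun u hu => hu.1)) _
  · refine (lintegral_mono_ae (hae.mono fun u hu => hu.2)).trans ?_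
    rw [lintegral_const_mul _ measurable_const, ← hlin, two_mul, pow_add, mul_assoc]
    gcongr
    exact h.le_hausdorff subset_rfl

/-- This half of the area formula needs only countable subadditivity, hence no injectivity of `ψ`;
Sard's lemma depends on that. -/
theorem hausdorff_image_le_lintegral_jacobian {ψ : Euc m → F} {s : Set (Euc m)}
    (hs : MeasurableSet s) (hd : ∀ u ∈ s, DifferentiableAt ℝ ψ u)
    (hinj : ∀ u ∈ s, Function.Injective (fderiv ℝ ψ u)) :
    hausdorff m (ψ '' s) ≤ ∫⁻ u in s, ENNReal.ofReal (jacobian (fderiv ℝ ψ u)) ∂hausdorff m := by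
  rcases s.eq_empty_or_nonempty with rfl | hne
  · simp
  refine ennreal_le_of_forall_one_lt (2 * m) fun c hc => ?_
  obtain ⟨t, A, htd, htm, hst, hclose⟩ := exists_partition_isCloseToLinear hd hinj hc
  have hs' : s = ⋃ k, s ∩ t k := by rw [← inter_iUnion, inter_eq_left.2 hst]
  conv_lhs => rw [hs', image_iUnion]
  conv_rhs => rw [hs']
  rw [lintegral_iUnion (fun k => hs.inter (htm k))
    (fun i j hij => (htd hij).mono inter_subset_right inter_subset_right), ← ENNReal.tsum_mul_left]
  refine (measure_iUnion_le _).trans (ENNReal.tsum_le_tsum fun k => ?_)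
  exact ((hclose k hne).lintegral_jacobian (hs.inter (htm k)) (fun u hu => hd u hu.1)
    (fun u hu => hinj u hu.1)).1

/-- The area formula for injective maps with injective differentials. -/
theorem hausdorff_image_eq_lintegral_jacobian {ψ : Euc m → F} {s : Set (Euc m)}
    (hs : MeasurableSet s) (hd : ∀ u ∈ s, DifferentiableAt ℝ ψ u)
    (hinj : ∀ u ∈ s, Function.Injective (fderiv ℝ ψ u)) (hψ : InjOn ψ s) :
    hausdorff m (ψ '' s) = ∫⁻ u in s, ENNReal.ofReal (jacobian (fderiv ℝ ψ u)) ∂hausdorff m := by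
  refine le_antisymm (hausdorff_image_le_lintegral_jacobian hs hd hinj) ?_
  rcases s.eq_empty_or_nonempty with rfl | hne
  · simp
  refine ennreal_le_of_forall_one_lt (2 * m) fun c hc => ?_
  obtain ⟨t, A, htd, htm, hst, hclose⟩ := exists_partition_isCloseToLinear hd hinj hc
  have hs' : s = ⋃ k, s ∩ t k := by rw [← inter_iUnion, inter_eq_left.2 hst]
  conv_lhs => rw [hs']
  conv_rhs => rw [hs', image_iUnion]
  rw [lintegral_iUnion (fun k => hs.inter (htm k))
    (fun i j hij => (htd hij).mono inter_subset_right inter_subset_right), measure_iUnion,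
    ← ENNReal.tsum_mul_left]
  · exact ENNReal.tsum_le_tsum fun k => ((hclose k hne).lintegral_jacobian (hs.inter (htm k))
      (fun u hu => hd u hu.1) (fun u hu => hinj u hu.1)).2
  · intro i j hij
    refine disjoint_image_image fun x hx y hy hxy => ?_
    obtain rfl := hψ hx.1 hy.1 hxy
    exact (htd hij).ne_of_mem hx.2 hy.2 rfl
  -- The images are Borel by the Lusin–Souslin theorem.
  · intro k
    exact (hs.inter (htm k)).image_of_continuousOn_injOn
      (fun u hu => (hd u hu.1).continuousAt.continuousWithinAt) (hψ.mono inter_subset_left)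

/-- Sard's lemma for Lipschitzian maps on `ℝᵐ`. -/
theorem LipschitzWith.hausdorff_image_not_injective {ψ : Euc m → F} {K : NNReal}
    (hψ : LipschitzWith K ψ) :
    hausdorff m (ψ '' {u | DifferentiableAt ℝ ψ u ∧ ¬ Function.Injective (fderiv ℝ ψ u)}) = 0 := by
  have := FiniteDimensional.complete ℝ F
  set S := {u | DifferentiableAt ℝ ψ u ∧ ¬ Function.Injective (fderiv ℝ ψ u)} with hS
  have hSm : MeasurableSet S := by
    refine (measurableSet_of_differentiableAt ℝ ψ).inter ?_
    have h : {u | ¬ Function.Injective (fderiv ℝ ψ u)} =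
        (fun u => jacobian (fderiv ℝ ψ u)) ⁻¹' {0} := by
      ext u
      exact jacobian_eq_zero_iff.symm
    refine (congrArg MeasurableSet h).mpr ?_
    exact (continuous_jacobian.measurable.comp (measurable_fderiv ℝ ψ))
      (measurableSet_singleton 0)
  -- Bounded pieces have finite measure, as dominated convergence requires.
  have hcover : S = ⋃ k : ℕ, S ∩ Metric.closedBall 0 k := by
    rw [← inter_iUnion, Metric.iUnion_closedBall_nat, inter_univ]
  rw [hcover, image_iUnion, measure_iUnion_null_iff]
  intro k
  set s := S ∩ Metric.closedBall (0 : Euc m) k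
  have hsm : MeasurableSet s := hSm.inter Metric.isClosed_closedBall.measurableSet
  let P := WithLp.prodContinuousLinearEquiv 2 ℝ F (Euc m)
  let J₁ : F →L[ℝ] WithLp 2 (F × Euc m) :=
    (P.symm : F × Euc m →L[ℝ] WithLp 2 (F × Euc m)) ∘L ContinuousLinearMap.inl ℝ F (Euc m)
  let J₂ : Euc m →L[ℝ] WithLp 2 (F × Euc m) :=
    (P.symm : F × Euc m →L[ℝ] WithLp 2 (F × Euc m)) ∘L ContinuousLinearMap.inr ℝ F (Euc m)
  have hJ : ∀ (ε : ℝ) (x : F) (w : Euc m),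
      (J₁ x + ε • J₂ w).fst = x ∧ (J₁ x + ε • J₂ w).snd = ε • w := by
    intro ε x w
    constructor <;> simp [J₁, J₂, P]
  -- The maps `u ↦ (ψ(u), u/(j+1))` have injective differentials even where `Dψ` degenerates. They
  -- project onto `ψ` by a 1-Lipschitzian map, and their Jacobians tend boundedly to that of `(Dψ,
  -- 0)`, which vanishes on `S`.
  let Φ : ℕ → Euc m → WithLp 2 (F × Euc m) := fun j u => J₁ (ψ u) + (1 / ((j : ℝ) + 1)) • J₂ u
  let D : ℝ → Euc m → Euc m →L[ℝ] WithLp 2 (F × Euc m) := fun ε u =>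
    J₁ ∘L fderiv ℝ ψ u + ε • J₂
  borelize (WithLp 2 (F × Euc m))
  have hΦ : ∀ j, ∀ u ∈ s, HasFDerivAt (Φ j) (D (1 / ((j : ℝ) + 1)) u) u := by
    intro j u hu
    exact (J₁.hasFDerivAt.comp u hu.1.1.hasFDerivAt).add
      ((1 / ((j : ℝ) + 1)) • J₂).hasFDerivAt
  have hnorm : ∀ ε u w, ‖D ε u w‖ ^ 2 = ‖fderiv ℝ ψ u w‖ ^ 2 + ‖ε • w‖ ^ 2 := by
    intro ε u w
    have h := hJ ε (fderiv ℝ ψ u w) w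
    rw [show D ε u w = J₁ (fderiv ℝ ψ u w) + ε • J₂ w from rfl, WithLp.prod_norm_sq_eq_of_L2,
      h.1, h.2]
  have hDinj : ∀ j : ℕ, ∀ u, Function.Injective (D (1 / ((j : ℝ) + 1)) u) := by
    intro j u
    refine (injective_iff_map_eq_zero _).2 fun w hw => ?_
    have h := hnorm (1 / ((j : ℝ) + 1)) u w
    rw [hw, norm_zero] at h
    have h2 : ‖(1 / ((j : ℝ) + 1)) • w‖ ^ 2 = 0 := by
      nlinarith [sq_nonneg ‖fderiv ℝ ψ u w‖, sq_nonneg ‖(1 / ((j : ℝ) + 1)) • w‖]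
    have h3 := norm_eq_zero.1 (pow_eq_zero_iff two_ne_zero |>.1 h2)
    exact (smul_eq_zero.1 h3).resolve_left (Nat.one_div_pos_of_nat).ne'
  have hle : ∀ j : ℕ, hausdorff m (ψ '' s) ≤
      ∫⁻ u in s, ENNReal.ofReal (jacobian (D (1 / ((j : ℝ) + 1)) u)) ∂hausdorff m := by
    intro j
    have h1 : LipschitzWith 1 fun z : WithLp 2 (F × Euc m) => z.fst := by
      refine LipschitzWith.of_dist_le_mul fun x y => ?_
      rw [NNReal.coe_one, one_mul, dist_eq_norm, dist_eq_norm]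
      refine le_of_sq_le_sq ?_ (norm_nonneg _)
      rw [WithLp.prod_norm_sq_eq_of_L2]
      simp only [WithLp.sub_fst, WithLp.sub_snd]
      nlinarith [sq_nonneg ‖x.snd - y.snd‖]
    have h2 : ψ '' s = (fun z : WithLp 2 (F × Euc m) => z.fst) '' (Φ j '' s) := by
      rw [← image_comp]
      exact image_congr fun u _ => (hJ _ _ _).1.symm
    rw [h2]
    refine (h1.lipschitzOnWith.hausdorff_image_le m).trans ?_
    rw [ENNReal.coe_one, one_pow, one_mul]
    refine (hausdorff_image_le_lintegral_jacobian hsm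
      (fun u hu => (hΦ j u hu).differentiableAt) fun u hu => ?_).trans ?_
    · rw [(hΦ j u hu).fderiv]
      exact hDinj j u
    · refine (setLIntegral_congr_fun hsm fun u hu => ?_).le
      simp only [(hΦ j u hu).fderiv]
  have hDcont : ∀ u, Continuous fun ε => D ε u := by
    intro u
    fun_prop
  have hDmeas : ∀ ε, Measurable fun u => ENNReal.ofReal (jacobian (D ε u)) := by
    intro ε
    refine (continuous_jacobian.measurable.comp ?_).ennreal_ofReal
    have hcont : Continuous fun L : Euc m →L[ℝ] F => J₁ ∘L L + ε • J₂ := by fun_prop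
    exact hcont.measurable.comp (measurable_fderiv ℝ ψ)
  have hD0 : ∀ u ∈ s, jacobian (D 0 u) = 0 := by
    intro u hu
    rw [jacobian_eq_zero_iff]
    intro hinj
    refine hu.1.2 ((injective_iff_map_eq_zero _).2 fun w hw => ?_)
    refine (injective_iff_map_eq_zero _).1 hinj w ?_
    have := hnorm 0 u w
    rw [hw] at this
    simpa using this
  -- The squared norm is at most `(K² + 1) ‖w‖²`, hence at most `((K + 1) ‖w‖)²`, uniformly in `j`.
  have hbd : ∀ j : ℕ, ∀ u, jacobian (D (1 / ((j : ℝ) + 1)) u) ≤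
      ((K + 1 : NNReal) : ℝ) ^ m * jacobian (ContinuousLinearMap.id ℝ (Euc m)) := by
    intro j u
    refine jacobian_le_of_norm_le (fun _ _ h => h) fun w => ?_
    refine le_of_sq_le_sq ?_ (by positivity)
    rw [hnorm]
    have h1 : ‖fderiv ℝ ψ u w‖ ≤ K * ‖w‖ :=
      (ContinuousLinearMap.le_opNorm _ _).trans (by
        gcongr
        exact norm_fderiv_le_of_lipschitz ℝ hψ)
    have h2 : ‖(1 / ((j : ℝ) + 1)) • w‖ ≤ ‖w‖ := by
      rw [norm_smul, Real.norm_of_nonneg (Nat.one_div_pos_of_nat).le]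
      refine mul_le_of_le_one_left (norm_nonneg _) ?_
      rw [div_le_one (by positivity)]
      linarith [(Nat.cast_nonneg j : (0 : ℝ) ≤ j)]
    rw [NNReal.coe_add, NNReal.coe_one, ContinuousLinearMap.id_apply]
    have h3 : 0 ≤ (K : ℝ) * ‖w‖ := by positivity
    nlinarith [norm_nonneg w, norm_nonneg (fderiv ℝ ψ u w), norm_nonneg ((1 / ((j : ℝ) + 1)) • w)]
  have hlim : Tendsto (fun j : ℕ => ∫⁻ u in s, ENNReal.ofReal (jacobian (D (1 / ((j : ℝ) + 1)) u))
      ∂hausdorff m) atTop (𝓝 (∫⁻ u in s, 0 ∂hausdorff m)) := by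
    refine tendsto_lintegral_filter_of_dominated_convergence (fun _ => ENNReal.ofReal
      (((K + 1 : NNReal) : ℝ) ^ m * jacobian (ContinuousLinearMap.id ℝ (Euc m))))
      (Eventually.of_forall fun j => hDmeas _) (Eventually.of_forall fun j =>
        Eventually.of_forall fun u => ENNReal.ofReal_le_ofReal (hbd j u)) ?_ ?_
    · rw [setLIntegral_const]
      refine ENNReal.mul_ne_top ENNReal.ofReal_ne_top ?_
      rw [hausdorff_euclidean_apply]
      refine ENNReal.mul_ne_top (hausdorffConst_ne_top m) ?_
      exact ((measure_mono inter_subset_right).trans_lt measure_closedBall_lt_top).ne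
    · filter_upwards [ae_restrict_mem hsm] with u hu
      have h1 : Tendsto (fun ε => ENNReal.ofReal (jacobian (D ε u))) (𝓝 0)
          (𝓝 (ENNReal.ofReal (jacobian (D 0 u)))) :=
        (ENNReal.continuous_ofReal.comp (continuous_jacobian.comp (hDcont u))).tendsto 0
      rw [hD0 u hu, ENNReal.ofReal_zero] at h1
      exact h1.comp (tendsto_one_div_add_atTop_nhds_zero_nat (𝕜 := ℝ))
  rw [lintegral_zero] at hlim
  exact le_antisymm (ge_of_tendsto' hlim hle) zero_le

end Area

/-! ### Charts -/

theorem measurableSet_differentiableAt_injective {m : ℕ} {F : Type*} [NormedAddCommGroup F]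
    [InnerProductSpace ℝ F] [FiniteDimensional ℝ F] (ψ : Euc m → F) :
    MeasurableSet {u | DifferentiableAt ℝ ψ u ∧ Function.Injective (fderiv ℝ ψ u)} := by
  have := FiniteDimensional.complete ℝ F
  borelize F
  have h : {u | DifferentiableAt ℝ ψ u ∧ Function.Injective (fderiv ℝ ψ u)} =
      {u | DifferentiableAt ℝ ψ u} ∩ (fun u => jacobian (fderiv ℝ ψ u)) ⁻¹' Ioi 0 := by
    ext u
    exact and_congr_right fun _ => jacobian_pos_iff.symm
  rw [h]
  exact (measurableSet_of_differentiableAt ℝ ψ).inter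
    ((continuous_jacobian.measurable.comp (measurable_fderiv ℝ ψ)) measurableSet_Ioi)

/-- `P` is the bi-Lipschitzian image of the bounded measurable subset `t` of `ℝᵐ` under `ψ`, with
inverse `ρ`. -/
structure IsChart {m n : ℕ} {X : Set (Euc n)} (P : Set X) (t : Set (Euc m))
    (ψ : Euc m → Euc n) (ρ : Euc n → Euc m) : Prop where
  image_eq : Subtype.val '' P = ψ '' t
  measurableSet_dom : MeasurableSet t
  isBounded_dom : Bornology.IsBounded t
  lipschitz : ∃ K, LipschitzWith K ψ
  lipschitz_inv : ∃ K, LipschitzWith K ρ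
  left_inv : ∀ u ∈ t, ρ (ψ u) = u

namespace IsChart

variable {m n : ℕ} {X : Set (Euc n)} {P : Set X} {t : Set (Euc m)}
  {ψ : Euc m → Euc n} {ρ : Euc n → Euc m}

theorem exists_mem (h : IsChart P t ψ ρ) {u : Euc m} (hu : u ∈ t) :
    ∃ x ∈ P, (x : Euc n) = ψ u := by
  have : ψ u ∈ Subtype.val '' P := h.image_eq ▸ mem_image_of_mem ψ hu
  exact this

theorem inv_mem (h : IsChart P t ψ ρ) {x : X} (hx : x ∈ P) : ρ x ∈ t ∧ ψ (ρ x) = x := by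
  have : (x : Euc n) ∈ ψ '' t := h.image_eq ▸ mem_image_of_mem _ hx
  obtain ⟨u, hu, hux⟩ := this
  rw [← hux, h.left_inv u hu]
  exact ⟨hu, rfl⟩

theorem injOn (h : IsChart P t ψ ρ) : InjOn ψ t := fun u hu v hv huv => by
  rw [← h.left_inv u hu, huv, h.left_inv v hv]

theorem continuous (h : IsChart P t ψ ρ) : Continuous ψ := by
  obtain ⟨K, hK⟩ := h.lipschitz
  exact hK.continuous

theorem continuous_inv (h : IsChart P t ψ ρ) : Continuous ρ := by
  obtain ⟨K, hK⟩ := h.lipschitz_inv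
  exact hK.continuous

theorem measurable_inv_coe (h : IsChart P t ψ ρ) : Measurable fun x : X => ρ x :=
  (h.continuous_inv.comp continuous_subtype_val).measurable

theorem eq_preimage (h : IsChart P t ψ ρ) : P = Subtype.val ⁻¹' (ψ '' t) := by
  rw [← h.image_eq, preimage_image_eq _ Subtype.val_injective]

theorem measurableSet (h : IsChart P t ψ ρ) : MeasurableSet P := by
  rw [h.eq_preimage]
  exact measurable_subtype_coe (h.measurableSet_dom.image_of_continuousOn_injOn
    h.continuous.continuousOn h.injOn)

/-- Restriction of a chart to a measurable subset of its domain. -/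
theorem restrict (h : IsChart P t ψ ρ) {s : Set (Euc m)} (hs : MeasurableSet s) :
    IsChart {x ∈ P | ρ x ∈ s} (t ∩ s) ψ ρ where
  image_eq := by
    ext y
    constructor
    · rintro ⟨x, ⟨hx, hxs⟩, rfl⟩
      exact ⟨ρ x, ⟨(h.inv_mem hx).1, hxs⟩, (h.inv_mem hx).2⟩
    · rintro ⟨u, ⟨hu, hus⟩, rfl⟩
      obtain ⟨x, hx, hxu⟩ := h.exists_mem hu
      refine ⟨x, ⟨hx, ?_⟩, hxu⟩
      rwa [hxu, h.left_inv u hu]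
  measurableSet_dom := h.measurableSet_dom.inter hs
  isBounded_dom := h.isBounded_dom.subset inter_subset_left
  lipschitz := h.lipschitz
  lipschitz_inv := h.lipschitz_inv
  left_inv := fun u hu => h.left_inv u hu.1

theorem hausdorff_eq (h : IsChart P t ψ ρ) (s : Set (Euc m)) :
    hausdorff m {x ∈ P | ρ x ∈ s} = hausdorff m (ψ '' (t ∩ s)) := by
  rw [← hausdorff_image_val]
  congr 1
  ext y
  constructor
  · rintro ⟨x, ⟨hx, hxs⟩, rfl⟩
    exact ⟨ρ x, ⟨(h.inv_mem hx).1, hxs⟩, (h.inv_mem hx).2⟩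
  · rintro ⟨u, ⟨hu, hus⟩, rfl⟩
    obtain ⟨x, hx, hxu⟩ := h.exists_mem hu
    refine ⟨x, ⟨hx, ?_⟩, hxu⟩
    rwa [hxu, h.left_inv u hu]

theorem hausdorff_lt_top (h : IsChart P t ψ ρ) : hausdorff m P < ∞ := by
  obtain ⟨K, hK⟩ := h.lipschitz
  rw [← hausdorff_image_val, h.image_eq]
  refine (hK.lipschitzOnWith.hausdorff_image_le m).trans_lt ?_
  rw [hausdorff_euclidean_apply]
  exact ENNReal.mul_lt_top (by finiteness) (ENNReal.mul_lt_top (hausdorffConst_ne_top m).lt_top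
    h.isBounded_dom.measure_lt_top)

theorem isFiniteMeasure (h : IsChart P t ψ ρ) :
    IsFiniteMeasure ((hausdorff m : Measure X).restrict P) :=
  ⟨by simpa using h.hausdorff_lt_top⟩

/-- Lipschitzian `ψ` sends Lebesgue null sets to `Hᵐ` null sets. This transfers Rademacher's theorem
and density points from parameters to charts. -/
theorem ae_of_ae_dom (h : IsChart P t ψ ρ) {p : Euc m → Prop}
    (hp : ∀ᵐ u ∂(volume.restrict t), p u) :
    ∀ᵐ x : X ∂((hausdorff m : Measure X).restrict P), p (ρ x) := by
  rw [ae_restrict_iff' h.measurableSet, ae_iff]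
  rw [ae_restrict_iff' h.measurableSet_dom, ae_iff] at hp
  obtain ⟨K, hK⟩ := h.lipschitz
  refine measure_mono_null (t := {x ∈ P | ρ x ∈ {u | ¬ p u}}) ?_ ?_
  · intro x hx
    simpa using hx
  · rw [h.hausdorff_eq]
    refine hK.hausdorff_image_null_of_volume (measure_mono_null ?_ hp)
    intro u hu
    simpa using hu

/-- Rademacher's theorem gives differentiability. Injectivity follows at density points, where the
Lipschitz bound of `ρ` passes to the limit as `‖w‖ ≤ C ‖Dψ(u) w‖`. -/
theorem ae_differentiableAt (h : IsChart P t ψ ρ) :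
    ∀ᵐ u ∂(volume.restrict t), u ∈ t ∧ IsDensityPoint t u ∧ DifferentiableAt ℝ ψ u ∧
      Function.Injective (fderiv ℝ ψ u) := by
  obtain ⟨K, hK⟩ := h.lipschitz
  obtain ⟨C, hC⟩ := h.lipschitz_inv
  filter_upwards [ae_restrict_mem h.measurableSet_dom, ae_isDensityPoint t,
    ae_restrict_of_ae hK.ae_differentiableAt] with u hut hu hd
  refine ⟨hut, hu, hd, (injective_iff_map_eq_zero _).2 fun w hw => ?_⟩
  have := hu.norm_fderiv_le (C := C) (hasFDerivAt_id u) hd.hasFDerivAt (fun v hv => by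
    have := hC.dist_le_mul (ψ v) (ψ u)
    rwa [h.left_inv v hv, h.left_inv u hut, dist_eq_norm, dist_eq_norm] at this) w
  rw [hw, norm_zero, mul_zero] at this
  simpa using this

theorem hausdorff_image_eq (h : IsChart P t ψ ρ) {s : Set (Euc m)} (hs : MeasurableSet s) :
    hausdorff m (ψ '' (t ∩ s)) =
      ∫⁻ u in t ∩ s, ENNReal.ofReal (jacobian (fderiv ℝ ψ u)) ∂hausdorff m := by
  obtain ⟨K, hK⟩ := h.lipschitz
  have hts := h.measurableSet_dom.inter hs
  set g := {u | DifferentiableAt ℝ ψ u ∧ Function.Injective (fderiv ℝ ψ u)} with hg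
  have hgm : MeasurableSet g := measurableSet_differentiableAt_injective ψ
  have h0 : volume ((t ∩ s) \ g) = 0 := by
    have h1 := h.ae_differentiableAt
    rw [ae_restrict_iff' h.measurableSet_dom, ae_iff] at h1
    refine measure_mono_null ?_ h1
    rintro u ⟨⟨hut, -⟩, hug⟩ hh
    exact hug (hh hut).2.2
  have h2 : hausdorff m (ψ '' (t ∩ s)) = hausdorff m (ψ '' (t ∩ s ∩ g)) := by
    refine le_antisymm ?_ (measure_mono (image_mono inter_subset_left))
    rw [← inter_union_sdiff (t ∩ s) g, image_union, inter_union_sdiff]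
    refine (measure_union_le _ _).trans ?_
    rw [hK.hausdorff_image_null_of_volume h0, add_zero]
  have h3 : (t ∩ s ∩ g : Set (Euc m)) =ᵐ[hausdorff m] (t ∩ s : Set (Euc m)) := by
    refine ae_eq_set.2 ⟨?_, ?_⟩
    · rw [sdiff_eq_empty.2 inter_subset_left, measure_empty]
    · rw [sdiff_self_inter, hausdorff_euclidean_apply, h0, mul_zero]
  rw [h2, ← setLIntegral_congr h3]
  exact hausdorff_image_eq_lintegral_jacobian (hts.inter hgm) (fun u hu => hu.2.1)
    (fun u hu => hu.2.2) (h.injOn.mono (inter_subset_left.trans inter_subset_left))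

/-- The area formula is recast as an identity of measures on `ℝᵐ`, so that it extends from sets to
integrands. -/
theorem map_inv_restrict (h : IsChart P t ψ ρ) :
    ((hausdorff m : Measure X).restrict P).map (fun x : X => ρ x) =
      ((hausdorff m).restrict t).withDensity
        fun u => ENNReal.ofReal (jacobian (fderiv ℝ ψ u)) := by
  ext s hs
  rw [Measure.map_apply h.measurable_inv_coe hs, withDensity_apply _ hs,
    Measure.restrict_apply (h.measurable_inv_coe hs), Measure.restrict_restrict hs, inter_comm s,
    ← h.hausdorff_image_eq hs, ← h.hausdorff_eq, inter_comm]
  rfl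

/-- The area formula in a chart. -/
theorem lintegral_comp_inv (h : IsChart P t ψ ρ) {g : Euc m → ℝ≥0∞} (hg : Measurable g) :
    ∫⁻ x : X in P, g (ρ x) ∂hausdorff m =
      ∫⁻ u in t, ENNReal.ofReal (jacobian (fderiv ℝ ψ u)) * g u ∂hausdorff m := by
  rw [← lintegral_map hg h.measurable_inv_coe, h.map_inv_restrict,
    lintegral_withDensity_eq_lintegral_mul _ (measurable_jacobian_fderiv ψ) hg]
  rfl

end IsChart

/-! ### Densities in charts -/

theorem densityRatio_restrict_image {m n : ℕ} {X : Set (Euc n)} {Q : Set X} {s : Set (Euc m)}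
    {ψ : Euc m → Euc n} (hQ : Subtype.val '' Q = ψ '' s) (x : X) (r : ℝ) :
    ((hausdorff m : Measure X).restrict Q) (Metric.closedBall x r) =
      hausdorff m (ψ '' {v ∈ s | dist (ψ v) x ≤ r}) := by
  rw [Measure.restrict_apply Metric.isClosed_closedBall.measurableSet, ← hausdorff_image_val]
  congr 1
  ext y
  constructor
  · rintro ⟨z, ⟨hz, hzQ⟩, rfl⟩
    have : (z : Euc n) ∈ ψ '' s := hQ ▸ mem_image_of_mem _ hzQ
    obtain ⟨v, hv, hvz⟩ := this
    refine ⟨v, ⟨hv, ?_⟩, hvz⟩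
    rw [hvz]
    exact hz
  · rintro ⟨v, ⟨hv, hvx⟩, rfl⟩
    have : ψ v ∈ Subtype.val '' Q := hQ ▸ mem_image_of_mem _ hv
    obtain ⟨z, hz, hzv⟩ := this
    refine ⟨z, ⟨?_, hz⟩, hzv⟩
    rw [Metric.mem_closedBall, Subtype.dist_eq, hzv]
    exact hvx

theorem densityRatio_denom_ne_zero (m : ℕ) {r : ℝ} (hr : 0 < r) :
    unitBallVolume m * ENNReal.ofReal (r ^ m) ≠ 0 :=
  mul_ne_zero (unitBallVolume_ne_zero m) (by simpa using pow_pos hr m)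

theorem densityRatio_denom_ne_top (m : ℕ) (r : ℝ) :
    unitBallVolume m * ENNReal.ofReal (r ^ m) ≠ ∞ :=
  ENNReal.mul_ne_top (unitBallVolume_ne_top m) ENNReal.ofReal_ne_top

/-- Densities of images under maps that are close to isometries. -/
theorem densityRatio_bounds_of_close {m n : ℕ} {X : Set (Euc n)} {Q : Set X} {s : Set (Euc m)}
    {ψ : Euc m → Euc n} (hQ : Subtype.val '' Q = ψ '' s) {c : NNReal} (hc : 0 < c)
    (hle : ∀ u ∈ s, ∀ v ∈ s, ‖ψ v - ψ u‖ ≤ c * ‖v - u‖)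
    (hge : ∀ u ∈ s, ∀ v ∈ s, ‖v - u‖ ≤ c * ‖ψ v - ψ u‖)
    {u : Euc m} (hus : u ∈ s) (hu : IsDensityPoint s u) {x : X} (hx : (x : Euc n) = ψ u) :
    (∀ᶠ r in 𝓝[>] (0 : ℝ), densityRatio ((hausdorff m : Measure X).restrict Q) m x r ≤
      (c : ℝ≥0∞) ^ (2 * m) * hausdorffConst m) ∧
    hausdorffConst m ≤ (c : ℝ≥0∞) ^ (2 * m) *
      liminf (densityRatio ((hausdorff m : Measure X).restrict Q) m x) (𝓝[>] 0) := by
  have hcR : (0 : ℝ) < c := hc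
  have hlip : LipschitzOnWith c ψ s := LipschitzOnWith.of_dist_le_mul fun v hv w hw => by
    rw [dist_eq_norm, dist_eq_norm]
    exact hle w hw v hv
  constructor
  · filter_upwards [self_mem_nhdsWithin] with r (hr : 0 < r)
    rw [densityRatio, densityRatio_restrict_image hQ]
    refine ENNReal.div_le_of_le_mul ?_
    -- One factor `cᵐ` arises from the enlarged radius `c r`, the other from the Lipschitz constant
    -- of `ψ`.
    have hsub : {v ∈ s | dist (ψ v) x ≤ r} ⊆ Metric.closedBall u (c * r) := by
      rintro v ⟨hv, hvx⟩
      rw [hx, dist_eq_norm] at hvx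
      rw [Metric.mem_closedBall, dist_eq_norm]
      exact (hge u hus v hv).trans (by gcongr)
    calc hausdorff m (ψ '' {v ∈ s | dist (ψ v) x ≤ r})
        ≤ (c : ℝ≥0∞) ^ m * hausdorff m {v ∈ s | dist (ψ v) x ≤ r} :=
          (hlip.mono fun v hv => hv.1).hausdorff_image_le m
      _ ≤ (c : ℝ≥0∞) ^ m * hausdorff m (Metric.closedBall u (c * r)) := by gcongr
      _ = (c : ℝ≥0∞) ^ (2 * m) * hausdorffConst m *
          (unitBallVolume m * ENNReal.ofReal (r ^ m)) := by
          rw [hausdorff_euclidean_apply, volume_closedBall_euc _ _ (by positivity), mul_pow,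
            ENNReal.ofReal_mul (by positivity), ENNReal.ofReal_pow c.coe_nonneg,
            ENNReal.ofReal_coe_nnreal, two_mul, pow_add]
          ring
  · have hlow : ∀ᶠ r in 𝓝[>] (0 : ℝ), hausdorffConst m *
        (volume (s ∩ Metric.closedBall u (r / c)) / volume (Metric.closedBall u (r / c))) ≤
        (c : ℝ≥0∞) ^ (2 * m) * densityRatio ((hausdorff m : Measure X).restrict Q) m x r := by
      filter_upwards [self_mem_nhdsWithin] with r (hr : 0 < r)
      have hrc : 0 < r / c := by positivity
      set s' := {v ∈ s | dist (ψ v) x ≤ r}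
      have hs' : s' ⊆ s := fun v hv => hv.1
      -- Points of `s` in the shrunken ball are mapped into `B(x,r)`; the inverse of `ψ`, again
      -- `c`-Lipschitzian, recovers their measure.
      have hsub : s ∩ Metric.closedBall u (r / c) ⊆ s' := by
        rintro v ⟨hv, hvu⟩
        refine ⟨hv, ?_⟩
        rw [Metric.mem_closedBall, dist_eq_norm, le_div_iff₀' hcR] at hvu
        rw [hx, dist_eq_norm]
        exact (hle u hus v hv).trans hvu
      have hinj : InjOn ψ s' := fun v hv w hw hvw => by
        have := hge w (hs' hw) v (hs' hv)
        rw [hvw, sub_self, norm_zero, mul_zero] at this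
        exact sub_eq_zero.1 (norm_le_zero_iff.1 this)
      have hinv := hinj.leftInvOn_invFunOn
      have hlip' : LipschitzOnWith c (Function.invFunOn ψ s') (ψ '' s') := by
        refine LipschitzOnWith.of_dist_le_mul ?_
        rintro _ ⟨v, hv, rfl⟩ _ ⟨w, hw, rfl⟩
        rw [hinv hv, hinv hw, dist_eq_norm, dist_eq_norm]
        exact hge w (hs' hw) v (hs' hv)
      have h1 := hlip'.hausdorff_image_le m
      rw [hinv.image_image] at h1
      rw [densityRatio, densityRatio_restrict_image hQ, ← mul_div_assoc, ← mul_div_assoc,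
        volume_closedBall_euc _ _ hrc.le, div_pow, ENNReal.ofReal_div_of_pos (by positivity),
        ENNReal.ofReal_pow c.coe_nonneg, ENNReal.ofReal_coe_nnreal]
      have hcm : (c : ℝ≥0∞) ^ m ≠ 0 := by simpa using fun h => absurd h hc.ne'
      have hcm' : (c : ℝ≥0∞) ^ m ≠ ∞ := by finiteness
      rw [← mul_div_assoc]
      refine ENNReal.div_le_of_le_mul ?_
      calc hausdorffConst m * volume (s ∩ Metric.closedBall u (r / c))
          ≤ (c : ℝ≥0∞) ^ m * hausdorff m (ψ '' s') := by
            rw [← hausdorff_euclidean_apply]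
            exact (measure_mono hsub).trans h1
        _ = (c : ℝ≥0∞) ^ m * hausdorff m (ψ '' s') *
            (((unitBallVolume m * ENNReal.ofReal (r ^ m)) /
              (unitBallVolume m * ENNReal.ofReal (r ^ m))) * ((c : ℝ≥0∞) ^ m / (c : ℝ≥0∞) ^ m)) := by
            rw [ENNReal.div_self (densityRatio_denom_ne_zero m hr) (densityRatio_denom_ne_top m r),
              ENNReal.div_self hcm hcm', mul_one, mul_one]
        _ = _ := by
            simp only [div_eq_mul_inv, two_mul, pow_add]
            ring
    have hlim : Tendsto (fun r : ℝ => hausdorffConst m *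
        (volume (s ∩ Metric.closedBall u (r / c)) / volume (Metric.closedBall u (r / c))))
        (𝓝[>] 0) (𝓝 (hausdorffConst m * 1)) := by
      refine ENNReal.Tendsto.const_mul ?_ (Or.inl one_ne_zero)
      refine Tendsto.comp hu ?_
      refine tendsto_nhdsWithin_iff.2 ⟨?_, ?_⟩
      · have : Tendsto (fun r : ℝ => r / c) (𝓝 0) (𝓝 (0 / c)) :=
          (continuous_id.div_const _).tendsto 0
        rw [zero_div] at this
        exact this.mono_left nhdsWithin_le_nhds
      · filter_upwards [self_mem_nhdsWithin] with r (hr : 0 < r)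
        exact div_pos hr hcR
    rw [mul_one] at hlim
    rw [← hlim.liminf_eq, ← ENNReal.liminf_const_mul_of_ne_top (by finiteness)]
    exact liminf_le_liminf hlow

theorem densityRatio_add {Z : Type*} [MetricSpace Z] [MeasurableSpace Z]
    (φ₁ φ₂ : Measure Z) (m : ℕ) (a : Z) (r : ℝ) :
    densityRatio (φ₁ + φ₂) m a r = densityRatio φ₁ m a r + densityRatio φ₂ m a r := by
  simp [densityRatio, ENNReal.add_div]

theorem densityRatio_mono {Z : Type*} [MetricSpace Z] [MeasurableSpace Z]
    {φ₁ φ₂ : Measure Z} (h : φ₁ ≤ φ₂) (m : ℕ) (a : Z) (r : ℝ) :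
    densityRatio φ₁ m a r ≤ densityRatio φ₂ m a r :=
  ENNReal.div_le_div_right (h _) _

namespace IsChart

variable {m n : ℕ} {X : Set (Euc n)} {P : Set X} {t : Set (Euc m)}
  {ψ : Euc m → Euc n} {ρ : Euc n → Euc m}

/-- If `ψ` is close to `A = e ∘ M` with `e` an isometry, then `ψ ∘ M⁻¹` is close to `e`, so the
density bounds for nearly isometric maps become applicable. -/
theorem reparametrize (h : IsChart P t ψ ρ) (M : Euc m ≃L[ℝ] Euc m) :
    IsChart P (M.symm ⁻¹' t) (ψ ∘ M.symm) (M ∘ ρ) where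
  image_eq := by
    rw [image_comp, image_preimage_eq _ M.symm.surjective, h.image_eq]
  measurableSet_dom := M.symm.continuous.measurable h.measurableSet_dom
  isBounded_dom := by
    rw [← ContinuousLinearEquiv.image_eq_preimage_symm]
    exact M.toContinuousLinearMap.lipschitz.isBounded_image h.isBounded_dom
  lipschitz := by
    obtain ⟨K, hK⟩ := h.lipschitz
    exact ⟨_, hK.comp (M.symm : Euc m →L[ℝ] Euc m).lipschitz⟩
  lipschitz_inv := by
    obtain ⟨K, hK⟩ := h.lipschitz_inv
    exact ⟨_, (M : Euc m →L[ℝ] Euc m).lipschitz.comp hK⟩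
  left_inv := fun u hu => by
    simp only [Function.comp_apply]
    rw [h.left_inv _ hu, M.apply_symm_apply]

theorem ae_mem_of_iUnion {μ : Measure X} {Q : ℕ → Set X} (hQ : ∀ k, MeasurableSet (Q k))
    {p : X → Prop} (hp : ∀ k, ∀ᵐ x ∂μ.restrict (Q k), p x) :
    ∀ᵐ x ∂μ, x ∈ ⋃ k, Q k → p x := by
  have h := fun k => (ae_restrict_iff' (hQ k)).1 (hp k)
  filter_upwards [ae_all_iff.2 h] with x hx hxQ
  obtain ⟨k, hk⟩ := mem_iUnion.1 hxQ
  exact hx k hk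

/-- The chart splits into countably many pieces on which `ψ` is `c`-close to a linear map. At almost
every point of a piece the rest of `P` has zero density, so the bounds for the piece hold for `P`.
-/
theorem ae_densityRatio_bounds (h : IsChart P t ψ ρ) {c : NNReal} (hc : 1 < c) :
    ∀ᵐ x : X ∂((hausdorff m : Measure X).restrict P),
      limsup (densityRatio ((hausdorff m : Measure X).restrict P) m x) (𝓝[>] 0) ≤
        (c : ℝ≥0∞) ^ (2 * m) * hausdorffConst m ∧
      hausdorffConst m ≤ (c : ℝ≥0∞) ^ (2 * m) *
        liminf (densityRatio ((hausdorff m : Measure X).restrict P) m x) (𝓝[>] 0) := by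
  have := h.isFiniteMeasure
  set g := {u | DifferentiableAt ℝ ψ u ∧ Function.Injective (fderiv ℝ ψ u)} with hg
  have hgm : MeasurableSet g := measurableSet_differentiableAt_injective ψ
  -- If `g` is empty, then `P` is null; the linear models of the decomposition are injective only
  -- for nonempty `g`.
  rcases g.eq_empty_or_nonempty with hge | hgne
  · have h1 := h.ae_of_ae_dom h.ae_differentiableAt
    filter_upwards [h1] with x hx
    exact absurd (show ρ x ∈ g from hx.2.2) (by simp [hge])
  obtain ⟨T, A, -, hTm, hgT, hclose⟩ := exists_partition_isCloseToLinear (ψ := ψ) (s := g)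
    (fun u hu => hu.1) (fun u hu => hu.2) hc
  set Q : ℕ → Set X := fun k => {x ∈ P | ρ x ∈ g ∩ T k}
  have hchart : ∀ k, IsChart (Q k) (t ∩ (g ∩ T k)) ψ ρ := fun k => h.restrict (hgm.inter (hTm k))
  have hQm := fun k => (hchart k).measurableSet
  have hcov : ∀ᵐ x : X ∂((hausdorff m : Measure X).restrict P), x ∈ ⋃ k, Q k := by
    filter_upwards [h.ae_of_ae_dom h.ae_differentiableAt, ae_restrict_mem h.measurableSet]
      with x hx hxP
    have hxg : ρ x ∈ g := hx.2.2
    obtain ⟨k, hk⟩ := mem_iUnion.1 (hgT hxg)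
    exact mem_iUnion.2 ⟨k, hxP, hxg, hk⟩
  have key := ae_mem_of_iUnion (μ := (hausdorff m : Measure X).restrict P) hQm
    (p := fun x => limsup (densityRatio ((hausdorff m : Measure X).restrict P) m x) (𝓝[>] 0) ≤
        (c : ℝ≥0∞) ^ (2 * m) * hausdorffConst m ∧
      hausdorffConst m ≤ (c : ℝ≥0∞) ^ (2 * m) *
        liminf (densityRatio ((hausdorff m : Measure X).restrict P) m x) (𝓝[>] 0)) ?_
  · filter_upwards [hcov, key] with x hx hx' using hx' hx
  intro k
  have hQP : Q k ⊆ P := fun x hx => hx.1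
  rw [Measure.restrict_restrict (hQm k), inter_eq_left.2 hQP]
  obtain ⟨e, M, hAM⟩ := exists_isometry_comp (A k) (hclose k hgne).injective
  have hA : ∀ u, A k u = e (M u) := fun u => by rw [hAM]; rfl
  have hch := (hchart k).reparametrize M
  have hdens : ∀ᵐ x : X ∂((hausdorff m : Measure X).restrict (Q k)),
      HasDensity (((hausdorff m : Measure X).restrict P).restrict (Q k)ᶜ) m x 0 := by
    rw [ae_restrict_iff' (hQm k), ae_iff]
    refine measure_mono_null ?_ (ae_hasDensity_zero
      (((hausdorff m : Measure X).restrict P).restrict (Q k)ᶜ) m (A := Q k) ?_)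
    · intro x hx
      simpa using hx
    · rw [Measure.restrict_apply (hQm k), inter_compl_self, measure_empty]
  filter_upwards [ae_restrict_mem (hQm k), hdens, hch.ae_of_ae_dom
    ((ae_restrict_mem hch.measurableSet_dom).and (ae_isDensityPoint _))] with x hxQ hx0 ⟨hxt, hxd⟩
  have hb := densityRatio_bounds_of_close hch.image_eq (zero_lt_one.trans hc)
    (fun u hu v hv => by
      have := (hclose k hgne).le _ hu.2 _ hv.2
      rwa [hA, hA, M.apply_symm_apply, M.apply_symm_apply, ← map_sub, e.norm_map] at this)
    (fun u hu v hv => by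
      have := (hclose k hgne).ge _ hu.2 _ hv.2
      rwa [hA, hA, M.apply_symm_apply, M.apply_symm_apply, ← map_sub, e.norm_map] at this)
    hxt hxd (x := x) (hch.inv_mem hxQ).2.symm
  have hsplit : (hausdorff m : Measure X).restrict P = (hausdorff m : Measure X).restrict (Q k) +
      ((hausdorff m : Measure X).restrict P).restrict (Q k)ᶜ := by
    conv_lhs => rw [← Measure.restrict_add_restrict_compl (μ := (hausdorff m).restrict P) (hQm k)]
    rw [Measure.restrict_restrict (hQm k), inter_eq_left.2 hQP]
  constructor
  · have hlim : Tendsto (fun r => (c : ℝ≥0∞) ^ (2 * m) * hausdorffConst m +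
        densityRatio (((hausdorff m : Measure X).restrict P).restrict (Q k)ᶜ) m x r) (𝓝[>] 0)
        (𝓝 ((c : ℝ≥0∞) ^ (2 * m) * hausdorffConst m + 0)) := tendsto_const_nhds.add hx0
    rw [add_zero] at hlim
    rw [← hlim.limsup_eq]
    refine limsup_le_limsup ?_
    filter_upwards [hb.1] with r hr
    conv_lhs => rw [hsplit, densityRatio_add]
    gcongr
  · refine hb.2.trans ?_
    gcongr
    exact liminf_le_liminf (Eventually.of_forall fun r =>
      densityRatio_mono (Measure.restrict_mono hQP le_rfl) m x r)

/-- The Hausdorff measure of a chart has constant density on the chart and zero density outside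
of it. -/
theorem ae_hasDensity (h : IsChart P t ψ ρ) :
    ∀ᵐ x ∂(hausdorff m : Measure X), HasDensity ((hausdorff m : Measure X).restrict P) m x
      (P.indicator (fun _ => hausdorffConst m) x) := by
  have := h.isFiniteMeasure
  have h1 : ∀ᵐ x : X ∂((hausdorff m : Measure X).restrict P), ∀ j : ℕ,
      limsup (densityRatio ((hausdorff m : Measure X).restrict P) m x) (𝓝[>] 0) ≤
        ((1 + ((j : NNReal) + 1)⁻¹ : NNReal) : ℝ≥0∞) ^ (2 * m) * hausdorffConst m ∧
      hausdorffConst m ≤ ((1 + ((j : NNReal) + 1)⁻¹ : NNReal) : ℝ≥0∞) ^ (2 * m) *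
        liminf (densityRatio ((hausdorff m : Measure X).restrict P) m x) (𝓝[>] 0) :=
    ae_all_iff.2 fun j => h.ae_densityRatio_bounds (by simp)
  rw [ae_restrict_iff' h.measurableSet] at h1
  have h2 := ae_hasDensity_zero ((hausdorff m : Measure X).restrict P) m (A := Pᶜ) (by
    rw [Measure.restrict_apply h.measurableSet.compl, compl_inter_self, measure_empty])
  have h3 : ∀ᵐ x ∂(hausdorff m : Measure X), x ∉ {x ∈ Pᶜ | ¬ HasDensity
      ((hausdorff m : Measure X).restrict P) m x 0} := by
    rw [ae_iff]
    simpa using h2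
  filter_upwards [h1, h3] with x hx1 hx3
  by_cases hxP : x ∈ P
  · rw [indicator_of_mem hxP]
    refine tendsto_of_le_liminf_of_limsup_le ?_ ?_
    · exact ennreal_le_of_forall_inv (2 * m) fun j => (hx1 hxP j).2
    · exact ennreal_le_of_forall_inv (2 * m) fun j => (hx1 hxP j).1
  · rw [indicator_of_notMem hxP]
    by_contra hcon
    exact hx3 ⟨hxP, hcon⟩

end IsChart

/-! ### Tangent cones and approximate differentials -/

/-- Sequences of rescaled secants are the form in which differentials can be evaluated along the
cone. -/
theorem mem_tangentCone_iff {n : ℕ} {S : Set (Euc n)} {a v : Euc n} :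
    v ∈ tangentCone S a ↔ ∃ (c : ℕ → ℝ) (d : ℕ → Euc n), (∀ k, 0 < c k) ∧ (∀ k, a + d k ∈ S) ∧
      Tendsto d atTop (𝓝 0) ∧ Tendsto (fun k => c k • d k) atTop (𝓝 v) := by
  constructor
  · intro h
    have h' := fun k : ℕ => h (1 / ((k : ℝ) + 1)) Nat.one_div_pos_of_nat
    choose x hx c hc hxa hv using h'
    have hlim := tendsto_one_div_add_atTop_nhds_zero_nat (𝕜 := ℝ)
    refine ⟨c, fun k => x k - a, hc, fun k => by simpa using hx k, ?_, ?_⟩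
    · exact squeeze_zero_norm (fun k => (hxa k).le) hlim
    · rw [tendsto_iff_norm_sub_tendsto_zero]
      exact squeeze_zero (fun _ => norm_nonneg _) (fun k => (hv k).le) hlim
  · rintro ⟨c, d, hc, hd, hd0, hcd⟩ ε hε
    obtain ⟨k, h1, h2⟩ := ((hd0.eventually (Metric.ball_mem_nhds _ hε)).and
      (hcd.eventually (Metric.ball_mem_nhds _ hε))).exists
    refine ⟨a + d k, hd k, c k, hc k, ?_, ?_⟩
    · simpa using h1
    · simpa [dist_eq_norm] using h2

theorem HasDensity.zero_mono {Z : Type*} [MetricSpace Z] [MeasurableSpace Z]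
    {φ₁ φ₂ : Measure Z} {m : ℕ} {a : Z} (h : HasDensity φ₂ m a 0) (hle : φ₁ ≤ φ₂) :
    HasDensity φ₁ m a 0 :=
  tendsto_of_tendsto_of_tendsto_of_le_of_le tendsto_const_nhds h (fun _ => zero_le)
    (fun r => densityRatio_mono hle m a r)

theorem HasDensity.add {Z : Type*} [MetricSpace Z] [MeasurableSpace Z]
    {φ₁ φ₂ : Measure Z} {m : ℕ} {a : Z} {θ₁ θ₂ : ℝ≥0∞} (h₁ : HasDensity φ₁ m a θ₁)
    (h₂ : HasDensity φ₂ m a θ₂) : HasDensity (φ₁ + φ₂) m a (θ₁ + θ₂) := by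
  have := Tendsto.add h₁ h₂
  simpa only [HasDensity, ← densityRatio_add] using this

theorem HasDensity.density_eq {Z : Type*} [MetricSpace Z] [MeasurableSpace Z]
    {φ : Measure Z} {m : ℕ} {a : Z} {θ : ℝ≥0∞} (h : HasDensity φ m a θ) : density φ m a = θ :=
  Tendsto.limUnder_eq h

section ApDeriv

variable {n q m : ℕ} {X : Set (Euc n)} {φ : Measure X} {f : X → Euc q} {a : X}
  {L L' : Euc n →L[ℝ] Euc q}

/-- The two differentiable maps coincide on a set whose complement has zero density. Each
approximate tangent vector is a limit of rescaled secants of that set, along which both difference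
quotients agree. Hence the choice in `apDeriv` is immaterial. -/
theorem HasApDerivAt.eqOn (h : HasApDerivAt φ m f a L) (h' : HasApDerivAt φ m f a L') :
    EqOn L L' (apTan φ m a) := by
  intro v hv
  obtain ⟨g, hg, hgd⟩ := h
  obtain ⟨g', hg', hgd'⟩ := h'
  have hS : HasDensity (φ.restrict ({x : X | f x ≠ g x}ᶜ ∩ {x : X | f x ≠ g' x}ᶜ)ᶜ) m a 0 := by
    rw [compl_inter, compl_compl, compl_compl]
    have := hgd.add hgd'
    rw [add_zero] at this
    exact this.zero_mono (Measure.restrict_union_le _ _)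
  obtain ⟨c, d, -, hd, hd0, hcd⟩ := mem_tangentCone_iff.1 (hv _ hS)
  have heq : ∀ k, g (a + d k) = g' (a + d k) := by
    intro k
    obtain ⟨x, ⟨hx, hx'⟩, hxd⟩ := hd k
    simp only [mem_compl_iff, mem_ofPred_eq, not_not] at hx hx'
    rw [← hxd, ← hx, hx']
  have hlim : Tendsto (fun k => (a : Euc n) + d k) atTop (𝓝 a) := by
    simpa using tendsto_const_nhds.add hd0
  -- The point `a` itself may lie outside the set of coincidence, so the values there are compared
  -- by continuity.
  have ha : g a = g' a := by
    refine tendsto_nhds_unique (hg.continuousAt.tendsto.comp hlim) ?_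
    refine (hg'.continuousAt.tendsto.comp hlim).congr fun k => (heq k).symm
  have h1 := (hg.hasFDerivWithinAt (s := univ)).lim hd0 (by simp) hcd
  have h2 := (hg'.hasFDerivWithinAt (s := univ)).lim hd0 (by simp) hcd
  refine tendsto_nhds_unique h1 (h2.congr fun k => ?_)
  rw [heq, ha]

theorem HasApDerivAt.apDeriv_apply (h : HasApDerivAt φ m f a L) (v : apTanSpan φ m a) :
    apDeriv φ m f a v = L v := by
  have hd : ApDifferentiableAt φ m f a := ⟨L, h⟩
  rw [apDeriv, dif_pos hd]
  have h1 := hd.choose_spec.eqOn h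
  exact LinearMap.eqOn_span (f := (hd.choose : Euc n →ₗ[ℝ] Euc q)) (g := (L : Euc n →ₗ[ℝ] Euc q))
    h1 v.2

end ApDeriv

/-! ### Tangential regularity in charts -/

/-- The chart is regular at `x`, and `φ` has zero density at `x` outside of the chart. -/
structure IsRegularPoint {m n : ℕ} {X : Set (Euc n)} (φ : Measure X) (P : Set X) (t : Set (Euc m))
    (ψ : Euc m → Euc n) (ρ : Euc n → Euc m) (x : X) : Prop where
  mem : x ∈ P
  isDensityPoint : IsDensityPoint t (ρ x)
  differentiableAt : DifferentiableAt ℝ ψ (ρ x)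
  injective : Function.Injective (fderiv ℝ ψ (ρ x))
  hasDensity : HasDensity (φ.restrict Pᶜ) m x 0

section Regular

variable {m n : ℕ} {X : Set (Euc n)} {φ : Measure X} {P : Set X} {t : Set (Euc m)}
  {ψ : Euc m → Euc n} {ρ : Euc n → Euc m} {x : X}

/-- The restriction of `φ` to the complement of `P` vanishes on `P`, hence has zero density at
almost every point of `P`. -/
theorem IsChart.ae_isRegularPoint (h : IsChart P t ψ ρ) (φ : Measure X)
    (hφ : (φ.restrict Pᶜ).OuterRegular) :
    ∀ᵐ x ∂((hausdorff m : Measure X).restrict P), IsRegularPoint φ P t ψ ρ x := by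
  have h0 : ∀ᵐ x ∂((hausdorff m : Measure X).restrict P), HasDensity (φ.restrict Pᶜ) m x 0 := by
    rw [ae_restrict_iff' h.measurableSet, ae_iff]
    refine measure_mono_null ?_ (ae_hasDensity_zero (φ.restrict Pᶜ) m (A := P) ?_)
    · intro x hx
      simpa using hx
    · rw [Measure.restrict_apply h.measurableSet, inter_compl_self, measure_empty]
  filter_upwards [ae_restrict_mem h.measurableSet, h0, h.ae_of_ae_dom h.ae_differentiableAt]
    with x h1 h2 h3
  exact ⟨h1, h3.2.1, h3.2.2.1, h3.2.2.2, h2⟩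

/-- The chart itself is an admissible test set. Its secants `d k` come from parameter secants `e k =
O(d k)`, so `c k • d k` differs from `D (c k • e k)` by a null sequence, and the range of `D` is
closed. -/
theorem IsRegularPoint.apTan_subset (hx : IsRegularPoint φ P t ψ ρ x) (h : IsChart P t ψ ρ) :
    apTan φ m x ⊆ LinearMap.range (fderiv ℝ ψ (ρ x) : Euc m →ₗ[ℝ] Euc n) := by
  intro v hv
  obtain ⟨c, d, hc, hd, hd0, hcd⟩ := mem_tangentCone_iff.1 (hv P hx.hasDensity)
  obtain ⟨K, hK⟩ := h.lipschitz_inv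
  set D := fderiv ℝ ψ (ρ x)
  set e : ℕ → Euc m := fun k => ρ (x + d k) - ρ x
  have hψ : ∀ k, ψ (ρ x + e k) - ψ (ρ x) = d k := by
    intro k
    obtain ⟨y, hy, hyd⟩ := hd k
    simp only [e, add_sub_cancel]
    rw [← hyd, (h.inv_mem hy).2, (h.inv_mem hx.mem).2, hyd, add_sub_cancel_left]
  have hle : ∀ k, ‖e k‖ ≤ K * ‖d k‖ := by
    intro k
    have := hK.dist_le_mul (x + d k) x
    simpa [dist_eq_norm] using this
  have he0 : Tendsto e atTop (𝓝 0) := by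
    refine squeeze_zero_norm hle ?_
    simpa using hd0.norm.const_mul (K : ℝ)
  have ho : (fun k => c k • d k - D (c k • e k)) =o[atTop] fun _ => (1 : ℝ) := by
    have h1 : (fun k => d k - D (e k)) =o[atTop] e := by
      have := hx.differentiableAt.hasFDerivAt.isLittleO.comp_tendsto
        (show Tendsto (fun k => ρ x + e k) atTop (𝓝 (ρ x)) by
          simpa using tendsto_const_nhds.add he0)
      simpa [Function.comp_def, hψ] using this
    have h2 : (fun k => c k • (d k - D (e k))) =o[atTop] fun k => c k • e k :=
      (Asymptotics.isBigO_refl c atTop).smul_isLittleO h1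
    have h3 : (fun k => c k • e k) =O[atTop] fun _ => (1 : ℝ) := by
      have h4 : (fun k => c k • d k) =O[atTop] fun _ => (1 : ℝ) := hcd.isBigO_one ℝ
      refine (Asymptotics.IsBigO.of_bound K (Eventually.of_forall fun k => ?_)).trans h4
      rw [norm_smul, norm_smul, mul_left_comm]
      gcongr
      exact hle k
    simpa only [smul_sub, ← map_smul] using h2.trans_isBigO h3
  rw [Asymptotics.isLittleO_one_iff] at ho
  have hlim : Tendsto (fun k => D (c k • e k)) atTop (𝓝 v) := by
    simpa using hcd.sub ho
  have hclosed : IsClosed (LinearMap.range (D : Euc m →ₗ[ℝ] Euc n) : Set (Euc n)) :=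
    Submodule.closed_of_finiteDimensional _
  exact hclosed.mem_of_tendsto hlim (Eventually.of_forall fun k => ⟨_, rfl⟩)

-- If `S` missed the image of `t ∩ (u + r B(w,η))` for a suitable small `r`, that image would lie in
-- the complement of `S`. As `t` has density one at `u`, its measure is comparable to `rᵐ`, against
-- the zero density of the complement.
open scoped Pointwise in
theorem IsRegularPoint.range_subset (hx : IsRegularPoint φ P t ψ ρ x) (h : IsChart P t ψ ρ)
    {c : ℝ≥0∞} (hc : c ≠ 0) (hφ : c • (hausdorff m : Measure X).restrict P ≤ φ) :
    (LinearMap.range (fderiv ℝ ψ (ρ x) : Euc m →ₗ[ℝ] Euc n) : Set (Euc n)) ⊆ apTan φ m x := by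
  rintro _ ⟨w, rfl⟩ S hS
  set u := ρ x
  have hux : ψ u = x := (h.inv_mem hx.mem).2
  obtain ⟨Kψ, hKψ⟩ := h.lipschitz
  obtain ⟨K, hK⟩ := h.lipschitz_inv
  have key : ∀ k : ℕ, ∃ r : ℝ, ∃ e : Euc m, 0 < r ∧ r < 1 / ((k : ℝ) + 1) ∧
      ψ (u + r • e) ∈ Subtype.val '' S ∧ dist e w ≤ 1 / ((k : ℝ) + 1) := by
    intro k
    set η := 1 / ((k : ℝ) + 1)
    have hη : (0 : ℝ) < η := Nat.one_div_pos_of_nat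
    have h1 := tendsto_addHaar_inter_smul_one_of_density_one volume t u hx.isDensityPoint
      (Metric.closedBall w η) Metric.isClosed_closedBall.measurableSet
      (Metric.measure_closedBall_pos _ _ hη).ne' measure_closedBall_lt_top.ne
    have h2 := h1.eventually (lt_mem_nhds (show (2 : ℝ≥0∞)⁻¹ < 1 by simp))
    -- The image of `u + r B(w,η)` lies in `B(x, R r)`; the summand 1 keeps `R` positive.
    set R : ℝ := Kψ * (‖w‖ + η) + 1
    have hR : 0 < R := by positivity
    -- The density ratio at radius `R r` that the missed image would force: at least half of the
    -- ball lies in `t`, and `(K+1)ᵐ` is the loss under `ρ`, with `K+1` instead of `K` to keep the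
    -- divisor nonzero.
    set ε : ℝ≥0∞ := c * hausdorffConst m * 2⁻¹ * volume (Metric.closedBall w η) /
      (((K : ℝ≥0∞) + 1) ^ m * (unitBallVolume m * ENNReal.ofReal (R ^ m)))
    have hε : ε ≠ 0 := by
      refine (ENNReal.div_pos ?_ ?_).ne'
      · refine mul_ne_zero (mul_ne_zero (mul_ne_zero hc (hausdorffConst_ne_zero m)) (by simp)) ?_
        exact (Metric.measure_closedBall_pos _ _ hη).ne'
      · exact ENNReal.mul_ne_top (by finiteness) (densityRatio_denom_ne_top m R)
    have h3 : ∀ᶠ r in 𝓝[>] (0 : ℝ), densityRatio (φ.restrict Sᶜ) m x (R * r) < ε := by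
      have hlim : Tendsto (fun r : ℝ => R * r) (𝓝[>] 0) (𝓝[>] 0) := by
        refine tendsto_nhdsWithin_iff.2 ⟨?_, ?_⟩
        · have : Tendsto (fun r : ℝ => R * r) (𝓝 0) (𝓝 (R * 0)) :=
            (continuous_const.mul continuous_id).tendsto 0
          rw [mul_zero] at this
          exact this.mono_left nhdsWithin_le_nhds
        · filter_upwards [self_mem_nhdsWithin] with r (hr : 0 < r)
          exact mul_pos hR hr
      exact (hS.comp hlim).eventually (gt_mem_nhds (pos_iff_ne_zero.2 hε))
    obtain ⟨r, h2r, h3r, hr, hrη⟩ := (h2.and (h3.and ((eventually_mem_nhdsWithin (a := (0 : ℝ))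
      (s := Ioi 0)).and (nhdsWithin_le_nhds (Iio_mem_nhds hη))))).exists
    replace hr : 0 < r := hr
    by_contra hcon
    push Not at hcon
    set T := t ∩ ({u} + r • Metric.closedBall w η)
    set Y := {y ∈ P | ρ y ∈ {u} + r • Metric.closedBall w η}
    have hYS : Y ⊆ Metric.closedBall x (R * r) ∩ Sᶜ := by
      rintro y ⟨hyP, a, rfl, b, ⟨e, he, rfl⟩, hy⟩
      have hy' : (y : Euc n) = ψ (u + r • e) := by
        rw [show u + r • e = ρ y from hy, (h.inv_mem hyP).2]
      constructor
      · rw [Metric.mem_closedBall, Subtype.dist_eq, hy', ← hux]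
        refine (hKψ.dist_le_mul _ _).trans ?_
        rw [dist_eq_norm, add_sub_cancel_left, norm_smul, Real.norm_of_nonneg hr.le]
        have h5 : ‖e‖ ≤ ‖w‖ + η := by
          rw [Metric.mem_closedBall, dist_eq_norm] at he
          linarith [norm_le_norm_add_norm_sub' e w]
        have h6 : (Kψ : ℝ) * (r * ‖e‖) ≤ Kψ * (r * (‖w‖ + η)) := by gcongr
        have h7 : R * r = Kψ * (r * (‖w‖ + η)) + r := by
          simp only [R]
          ring
        linarith
      · intro hyS
        have := hcon r e hr hrη ⟨y, hyS, hy'⟩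
        exact absurd he (not_le.2 this)
    have hT : hausdorffConst m * volume T ≤ ((K : ℝ≥0∞) + 1) ^ m * hausdorff m Y := by
      have hTY : T ⊆ ρ '' (Subtype.val '' Y) := by
        rintro v ⟨hvt, hv⟩
        obtain ⟨y, hyP, hyv⟩ := h.exists_mem hvt
        have hρ : ρ y = v := by rw [hyv, h.left_inv v hvt]
        exact ⟨y, ⟨y, ⟨hyP, hρ ▸ hv⟩, rfl⟩, hρ⟩
      rw [← hausdorff_euclidean_apply, ← hausdorff_image_val]
      refine (measure_mono hTY).trans ((hK.lipschitzOnWith.hausdorff_image_le m).trans ?_)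
      gcongr
      simp
    have hvol : 2⁻¹ * (ENNReal.ofReal (r ^ m) * volume (Metric.closedBall w η)) ≤ volume T := by
      have hball : volume ({u} + r • Metric.closedBall w η) =
          ENNReal.ofReal (r ^ m) * volume (Metric.closedBall w η) := by
        rw [singleton_add, image_add_left, measure_preimage_add, addHaar_smul, finrank_euclideanSpace,
          Fintype.card_fin, abs_of_pos (pow_pos hr m)]
      rw [← hball]
      exact ENNReal.mul_le_of_le_div h2r.le
    have hcY : c * hausdorff m Y ≤ φ (Metric.closedBall x (R * r) ∩ Sᶜ) := by
      have h8 := Measure.le_iff'.1 hφ Y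
      rw [Measure.smul_apply, smul_eq_mul, Measure.restrict_eq_self _ (fun y hy => hy.1)] at h8
      exact h8.trans (measure_mono hYS)
    refine absurd h3r (not_lt.2 ?_)
    rw [densityRatio, Measure.restrict_apply Metric.isClosed_closedBall.measurableSet]
    set N := c * hausdorffConst m * 2⁻¹ * volume (Metric.closedBall w η)
    set d := unitBallVolume m * ENNReal.ofReal (R ^ m)
    have hd0 : d ≠ 0 := densityRatio_denom_ne_zero m hR
    have hd1 : d ≠ ∞ := densityRatio_denom_ne_top m R
    rw [mul_pow, ENNReal.ofReal_mul (by positivity), ← mul_assoc,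
      ENNReal.le_div_iff_mul_le (Or.inl (mul_ne_zero hd0 (by simpa using pow_pos hr m)))
        (Or.inl (by finiteness))]
    calc N / (((K : ℝ≥0∞) + 1) ^ m * d) * (d * ENNReal.ofReal (r ^ m))
        = N * ENNReal.ofReal (r ^ m) / ((K : ℝ≥0∞) + 1) ^ m * (d / d) := by
          rw [div_eq_mul_inv, ENNReal.mul_inv (Or.inl (by positivity)) (Or.inl (by finiteness))]
          simp only [div_eq_mul_inv]
          ring
      _ = N * ENNReal.ofReal (r ^ m) / ((K : ℝ≥0∞) + 1) ^ m := by
          rw [ENNReal.div_self hd0 hd1, mul_one]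
      _ ≤ φ (Metric.closedBall x (R * r) ∩ Sᶜ) := by
          refine ENNReal.div_le_of_le_mul' ?_
          calc N * ENNReal.ofReal (r ^ m)
              = c * (hausdorffConst m *
                (2⁻¹ * (ENNReal.ofReal (r ^ m) * volume (Metric.closedBall w η)))) := by
                simp only [N]
                ring
            _ ≤ c * (((K : ℝ≥0∞) + 1) ^ m * hausdorff m Y) := by
                refine mul_le_mul_right ?_ c
                exact (mul_le_mul_right hvol _).trans hT
            _ = ((K : ℝ≥0∞) + 1) ^ m * (c * hausdorff m Y) := by ring
            _ ≤ _ := by gcongr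
  choose r e hr hr' hs he using key
  have hlim := tendsto_one_div_add_atTop_nhds_zero_nat (𝕜 := ℝ)
  have he' : Tendsto e atTop (𝓝 w) :=
    tendsto_iff_dist_tendsto_zero.2 (squeeze_zero (fun _ => dist_nonneg) he hlim)
  have hr0 : Tendsto r atTop (𝓝 0) :=
    squeeze_zero (fun k => (hr k).le) (fun k => (hr' k).le) hlim
  have hd0 : Tendsto (fun k => r k • e k) atTop (𝓝 0) := by simpa using hr0.smul he'
  have hcd : Tendsto (fun k => (r k)⁻¹ • (r k • e k)) atTop (𝓝 w) := by
    simpa only [smul_smul, inv_mul_cancel₀ (hr _).ne', one_smul] using he'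
  refine mem_tangentCone_iff.2 ⟨fun k => (r k)⁻¹, fun k => ψ (u + r k • e k) - ψ u,
    fun k => inv_pos.2 (hr k), fun k => ?_, ?_, ?_⟩
  · rw [← hux, add_sub_cancel]
    exact hs k
  · have h1 : Tendsto (fun k => u + r k • e k) atTop (𝓝 u) := by
      simpa using tendsto_const_nhds.add hd0
    have := ((hKψ.continuous.tendsto u).comp h1).sub_const (ψ u)
    simpa using this
  · exact (hx.differentiableAt.hasFDerivAt.hasFDerivWithinAt (s := univ)).lim hd0 (by simp) hcd

theorem IsRegularPoint.apTan_eq (hx : IsRegularPoint φ P t ψ ρ x) (h : IsChart P t ψ ρ)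
    {c : ℝ≥0∞} (hc : c ≠ 0) (hφ : c • (hausdorff m : Measure X).restrict P ≤ φ) :
    apTan φ m x = LinearMap.range (fderiv ℝ ψ (ρ x) : Euc m →ₗ[ℝ] Euc n) :=
  (hx.apTan_subset h).antisymm (hx.range_subset h hc hφ)

theorem IsRegularPoint.finrank_range (hx : IsRegularPoint φ P t ψ ρ x) :
    Module.finrank ℝ (LinearMap.range (fderiv ℝ ψ (ρ x) : Euc m →ₗ[ℝ] Euc n)) = m := by
  rw [LinearMap.finrank_range_of_inj hx.injective]
  simp

/-- A map that is differentiable in a chart is approximately differentiable. -/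
theorem IsRegularPoint.exists_hasApDerivAt (hx : IsRegularPoint φ P t ψ ρ x)
    (h : IsChart P t ψ ρ) {q : ℕ} {g : X → Euc q} {G : Euc m → Euc q}
    (hg : ∀ y ∈ P, g y = G (ρ y)) (hG : DifferentiableAt ℝ G (ρ x)) :
    ∃ L : Euc n →L[ℝ] Euc q, HasApDerivAt φ m g x L ∧
      L ∘L fderiv ℝ ψ (ρ x) = fderiv ℝ G (ρ x) := by
  classical
  set u := ρ x
  have hux : ψ u = x := (h.inv_mem hx.mem).2
  obtain ⟨K, hK⟩ := h.lipschitz_inv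
  obtain ⟨I, hI⟩ := (fderiv ℝ ψ u : Euc m →ₗ[ℝ] Euc n).exists_leftInverse_of_injective
    (LinearMap.ker_eq_bot.2 hx.injective)
  -- A left inverse of `Dψ(u)` extends the prescribed differential from the tangent plane to `ℝⁿ`.
  set L : Euc n →L[ℝ] Euc q := fderiv ℝ G u ∘L LinearMap.toContinuousLinearMap I
  have hL : L ∘L fderiv ℝ ψ u = fderiv ℝ G u := by
    ext w : 1
    have : I (fderiv ℝ ψ u w) = w := LinearMap.congr_fun hI w
    simp [L, this]
  set R : Euc m → Euc q := fun v => G v - G u - L (ψ v - ψ u)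
  have hR : HasFDerivAt R (0 : Euc m →L[ℝ] Euc q) u := by
    have h1 : HasFDerivAt R (fderiv ℝ G u - L ∘L fderiv ℝ ψ u) u :=
      (hG.hasFDerivAt.sub_const (G u)).sub
        (L.hasFDerivAt.comp u (hx.differentiableAt.hasFDerivAt.sub_const (ψ u)))
    rwa [hL, sub_self] at h1
  have hRu : R u = 0 := by simp [R]
  -- The affine map with differential `L` need not equal `g` on `P`. The remainder, transported by
  -- `ρ`, restores equality on `P`, and it has zero differential because `ρ` is Lipschitzian.
  set k : Euc n → Euc q := fun y => if y ∈ Subtype.val '' P then R (ρ y) else 0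
  have hk : HasFDerivAt k (0 : Euc n →L[ℝ] Euc q) (x : Euc n) := by
    have hkx : k x = 0 := by
      by_cases hxP : (x : Euc n) ∈ Subtype.val '' P
      · exact (if_pos hxP).trans hRu
      · exact if_neg hxP
    rw [hasFDerivAt_iff_isLittleO] at hR ⊢
    simp only [hRu, hkx, sub_zero, zero_apply] at hR ⊢
    have h1 : (fun y : Euc n => R (ρ y)) =o[𝓝 (x : Euc n)] fun y => ρ y - u :=
      hR.comp_tendsto (h.continuous_inv.tendsto _)
    have h2 : (fun y : Euc n => ρ y - u) =O[𝓝 (x : Euc n)] fun y => y - (x : Euc n) := by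
      refine Asymptotics.IsBigO.of_bound K (Eventually.of_forall fun y => ?_)
      simpa [dist_eq_norm] using hK.dist_le_mul y x
    have h3 : k =O[𝓝 (x : Euc n)] fun y : Euc n => R (ρ y) := by
      refine Asymptotics.IsBigO.of_bound 1 (Eventually.of_forall fun y => ?_)
      simp only [k]
      split_ifs <;> simp
    exact h3.trans_isLittleO (h1.trans_isBigO h2)
  refine ⟨L, ⟨fun y => g x + L (y - x) + k y, ?_, ?_⟩, hL⟩
  · have h1 : HasFDerivAt (fun y : Euc n => g x + L (y - x)) L (x : Euc n) :=
      (L.hasFDerivAt.comp (x : Euc n) ((hasFDerivAt_id (x : Euc n)).sub_const (x : Euc n))).const_add (g x)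
    have h2 := h1.add hk
    rw [add_zero] at h2
    exact h2
  · refine hx.hasDensity.zero_mono (Measure.restrict_mono ?_ le_rfl)
    intro y hy hyP
    refine hy ?_
    have hyP' : (y : Euc n) ∈ Subtype.val '' P := mem_image_of_mem _ hyP
    simp only [k, if_pos hyP', R]
    rw [(h.inv_mem hyP).2, hux, hg y hyP, hg x hx.mem]
    abel

theorem IsRegularPoint.apDifferentiableAt (hx : IsRegularPoint φ P t ψ ρ x)
    (h : IsChart P t ψ ρ) {q : ℕ} {g : X → Euc q} {G : Euc m → Euc q}
    (hg : ∀ y ∈ P, g y = G (ρ y)) (hG : DifferentiableAt ℝ G (ρ x)) :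
    ApDifferentiableAt φ m g x := by
  obtain ⟨L, hL, -⟩ := hx.exists_hasApDerivAt h hg hG
  exact ⟨L, hL⟩

theorem IsRegularPoint.apTanSpan_eq (hx : IsRegularPoint φ P t ψ ρ x) (h : IsChart P t ψ ρ)
    {c : ℝ≥0∞} (hc : c ≠ 0)
    (hφ : c • (hausdorff m : Measure X).restrict P ≤ φ) :
    apTanSpan φ m x = LinearMap.range (fderiv ℝ ψ (ρ x) : Euc m →ₗ[ℝ] Euc n) := by
  rw [apTanSpan, hx.apTan_eq h hc hφ, Submodule.span_eq]

theorem IsRegularPoint.fderiv_mem (hx : IsRegularPoint φ P t ψ ρ x) (h : IsChart P t ψ ρ)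
    {c : ℝ≥0∞} (hc : c ≠ 0)
    (hφ : c • (hausdorff m : Measure X).restrict P ≤ φ) (w : Euc m) : fderiv ℝ ψ (ρ x) w ∈ apTanSpan φ m x := by
  rw [hx.apTanSpan_eq h hc hφ]
  exact ⟨w, rfl⟩

theorem IsRegularPoint.apDeriv_apply (hx : IsRegularPoint φ P t ψ ρ x) (h : IsChart P t ψ ρ)
    {q : ℕ} {g : X → Euc q} {G : Euc m → Euc q}
    (hg : ∀ y ∈ P, g y = G (ρ y)) (hG : DifferentiableAt ℝ G (ρ x)) (w : Euc m) (hw : fderiv ℝ ψ (ρ x) w ∈ apTanSpan φ m x) :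
    apDeriv φ m g x ⟨fderiv ℝ ψ (ρ x) w, hw⟩ = fderiv ℝ G (ρ x) w := by
  obtain ⟨L, hL, hLD⟩ := hx.exists_hasApDerivAt h hg hG
  rw [hL.apDeriv_apply, ← hLD]
  rfl

theorem IsRegularPoint.apImage_eq (hx : IsRegularPoint φ P t ψ ρ x) (h : IsChart P t ψ ρ)
    {c : ℝ≥0∞} (hc : c ≠ 0)
    (hφ : c • (hausdorff m : Measure X).restrict P ≤ φ)
    {q : ℕ} {g : X → Euc q} {G : Euc m → Euc q}
    (hg : ∀ y ∈ P, g y = G (ρ y)) (hG : DifferentiableAt ℝ G (ρ x)) :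
    apImage φ m g x = LinearMap.range (fderiv ℝ G (ρ x) : Euc m →ₗ[ℝ] Euc q) := by
  ext z
  constructor
  · rintro ⟨⟨v, hv⟩, rfl⟩
    obtain ⟨w, rfl⟩ : v ∈ LinearMap.range (fderiv ℝ ψ (ρ x) : Euc m →ₗ[ℝ] Euc n) :=
      hx.apTanSpan_eq h hc hφ ▸ hv
    exact ⟨w, (hx.apDeriv_apply h hg hG w hv).symm⟩
  · rintro ⟨w, rfl⟩
    exact ⟨⟨_, hx.fderiv_mem h hc hφ w⟩, hx.apDeriv_apply h hg hG w _⟩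

/-- The identity is `DG = ap Dg ∘ Dψ`, where `Dψ` is regarded as a map into the `m`-dimensional
approximate tangent plane. -/
theorem IsRegularPoint.apJacobian_eq (hx : IsRegularPoint φ P t ψ ρ x) (h : IsChart P t ψ ρ)
    {c : ℝ≥0∞} (hc : c ≠ 0)
    (hφ : c • (hausdorff m : Measure X).restrict P ≤ φ)
    {q : ℕ} {g : X → Euc q} {G : Euc m → Euc q}
    (hg : ∀ y ∈ P, g y = G (ρ y)) (hG : DifferentiableAt ℝ G (ρ x)) :
    apJacobian φ m g x * jacobian (fderiv ℝ ψ (ρ x)) = jacobian (fderiv ℝ G (ρ x)) := by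
  set D : Euc m →L[ℝ] apTanSpan φ m x :=
    (fderiv ℝ ψ (ρ x)).codRestrict (apTanSpan φ m x) (hx.fderiv_mem h hc hφ)
  have h1 : jacobian (fderiv ℝ ψ (ρ x)) = jacobian D := by
    rw [← jacobian_isometry_comp (apTanSpan φ m x).subtypeₗᵢ D]
    rfl
  have h2 : fderiv ℝ G (ρ x) = apDeriv φ m g x ∘L D := by
    ext w : 1
    exact (hx.apDeriv_apply h hg hG w _).symm
  rw [h1, h2]
  refine exteriorNorm_mul_jacobian ?_ _ _
  rw [hx.apTanSpan_eq h hc hφ]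
  exact hx.finrank_range

end Regular

/-! ### Almost covering by charts -/

/-- `Hᵐ` almost all of `E` is covered by countably many sets with the property `C`. -/
def IsAlmostCovered {Z : Type*} [EMetricSpace Z] [MeasurableSpace Z] [BorelSpace Z] (m : ℕ)
    (C : Set Z → Prop) (E : Set Z) : Prop :=
  ∃ 𝒞 : Set (Set Z), 𝒞.Countable ∧ (∀ P ∈ 𝒞, C P) ∧ hausdorff m (E \ ⋃₀ 𝒞) = 0

theorem IsAlmostCovered.trans {Z : Type*} [EMetricSpace Z] [MeasurableSpace Z] [BorelSpace Z]
    {m : ℕ} {C C' : Set Z → Prop} {E : Set Z} (h : IsAlmostCovered m C E)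
    (hC : ∀ P, C P → IsAlmostCovered m C' P) : IsAlmostCovered m C' E := by
  classical
  obtain ⟨𝒞, h𝒞, hP, h0⟩ := h
  choose 𝒟 h𝒟 hD hD0 using hC
  have := h𝒞.to_subtype
  refine ⟨⋃ P : 𝒞, 𝒟 P (hP P P.2), countable_iUnion fun P => h𝒟 _ _, ?_, ?_⟩
  · intro Q hQ
    obtain ⟨P, hQP⟩ := mem_iUnion.1 hQ
    exact hD _ _ Q hQP
  · refine measure_mono_null (t := (E \ ⋃₀ 𝒞) ∪ ⋃ P : 𝒞, ((P : Set Z) \ ⋃₀ 𝒟 P (hP P P.2))) ?_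
      (measure_union_null h0 (measure_iUnion_null fun P => hD0 _ _))
    rintro x ⟨hxE, hx⟩
    by_cases hxC : x ∈ ⋃₀ 𝒞
    · obtain ⟨P, hPC, hxP⟩ := hxC
      refine Or.inr (mem_iUnion.2 ⟨⟨P, hPC⟩, hxP, fun hxD => hx ?_⟩)
      obtain ⟨Q, hQ, hxQ⟩ := hxD
      exact ⟨Q, mem_iUnion.2 ⟨⟨P, hPC⟩, hQ⟩, hxQ⟩
    · exact Or.inl ⟨hxE, hxC⟩

theorem isAlmostCovered_of_iUnion {Z : Type*} [EMetricSpace Z] [MeasurableSpace Z] [BorelSpace Z]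
    {m : ℕ} {C : Set Z → Prop} {E : Set Z} {ι : Type*} [Countable ι] (P : ι → Set Z)
    (hP : ∀ i, C (P i)) (h0 : hausdorff m (E \ ⋃ i, P i) = 0) : IsAlmostCovered m C E :=
  ⟨range P, countable_range P, by rintro _ ⟨i, rfl⟩; exact hP i, by rwa [sUnion_range]⟩

/-- Lipschitzian left inverses on countably many pieces. -/
theorem exists_lipschitz_leftInverse {m : ℕ} {F : Type*} [NormedAddCommGroup F]
    [InnerProductSpace ℝ F] [FiniteDimensional ℝ F] (ψ : Euc m → F) :
    ∃ (T : ℕ → Set (Euc m)) (ρ : ℕ → F → Euc m), (∀ k, MeasurableSet (T k)) ∧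
      (∀ k, ∃ K, LipschitzWith K (ρ k)) ∧
      {u | DifferentiableAt ℝ ψ u ∧ Function.Injective (fderiv ℝ ψ u)} ⊆ ⋃ k, T k ∧
      ∀ k, ∀ u ∈ T k, ρ k (ψ u) = u := by
  borelize F
  set g := {u | DifferentiableAt ℝ ψ u ∧ Function.Injective (fderiv ℝ ψ u)} with hg
  have hgm : MeasurableSet g := measurableSet_differentiableAt_injective ψ
  rcases g.eq_empty_or_nonempty with hge | hgne
  · exact ⟨fun _ => ∅, fun _ _ => 0, fun _ => MeasurableSet.empty,
      fun _ => ⟨0, LipschitzWith.const 0⟩, by simp [hge], by simp⟩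
  obtain ⟨T, A, -, hTm, hgT, hclose⟩ := exists_partition_isCloseToLinear (ψ := ψ) (s := g)
    (fun u hu => hu.1) (fun u hu => hu.2) (c := 2) (by norm_num)
  have key : ∀ k, ∃ ρ : F → Euc m, (∃ K, LipschitzWith K ρ) ∧ ∀ u ∈ g ∩ T k, ρ (ψ u) = u := by
    intro k
    have hk := hclose k hgne
    have hinv := hk.injOn.leftInvOn_invFunOn
    obtain ⟨a, ha, hA⟩ := exists_pos_mul_norm_le hk.injective
    -- The constant combines `a ‖v - w‖ ≤ ‖A v - A w‖` with closeness to `A` up to the factor 2; any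
    -- factor above 1 would serve.
    have hlip : LipschitzOnWith (a⁻¹ * 2) (Function.invFunOn ψ (g ∩ T k)) (ψ '' (g ∩ T k)) := by
      refine LipschitzOnWith.of_dist_le_mul ?_
      rintro _ ⟨v, hv, rfl⟩ _ ⟨w, hw, rfl⟩
      rw [hinv hv, hinv hw, dist_eq_norm, dist_eq_norm, NNReal.coe_mul, NNReal.coe_inv, mul_assoc,
        ← div_eq_inv_mul, le_div_iff₀' (by exact_mod_cast ha)]
      have h1 := hA (v - w)
      have h2 := hk.ge w hw v hv
      rw [map_sub] at h1
      exact h1.trans h2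
    obtain ⟨ρ, hρ, hρeq⟩ := hlip.extend_finite_dimension
    refine ⟨ρ, ⟨_, hρ⟩, fun u hu => ?_⟩
    rw [← hρeq (mem_image_of_mem ψ hu), hinv hu]
  choose ρ hρ hρ' using key
  refine ⟨fun k => g ∩ T k, ρ, fun k => hgm.inter (hTm k), hρ, ?_, hρ'⟩
  rw [← inter_iUnion, inter_eq_left.2 hgT]

section Cover

variable {m n : ℕ} {X : Set (Euc n)}

/-- Lipschitzian images of `ℝᵐ` are almost covered by charts. -/
theorem isAlmostCovered_isChart (hX : IsOpen X) {K : NNReal} {ψ : Euc m → Euc n}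
    (hψ : LipschitzWith K ψ) :
    IsAlmostCovered m (fun P : Set X => ∃ (t : Set (Euc m)) (ψ : Euc m → Euc n)
      (ρ : Euc n → Euc m), IsChart P t ψ ρ) (Subtype.val ⁻¹' range ψ) := by
  obtain ⟨T, ρ, hTm, hρ, hT, hinv⟩ := exists_lipschitz_leftInverse ψ
  -- The balls make the domains bounded, and the preimage of `X` keeps the images inside `X`.
  set s : ℕ × ℕ → Set (Euc m) := fun k => T k.1 ∩ Metric.closedBall 0 k.2 ∩ ψ ⁻¹' X
  refine isAlmostCovered_of_iUnion (fun k => Subtype.val ⁻¹' (ψ '' s k)) (fun k => ?_) ?_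
  · refine ⟨s k, ψ, ρ k.1, ?_, ?_, ?_, ⟨K, hψ⟩, hρ k.1, fun u hu => hinv k.1 u hu.1.1⟩
    · rw [image_preimage_eq_inter_range, Subtype.range_coe, inter_eq_left]
      rintro _ ⟨u, hu, rfl⟩
      exact hu.2
    · exact ((hTm _).inter Metric.isClosed_closedBall.measurableSet).inter
        (hψ.continuous.measurable hX.measurableSet)
    · exact Metric.isBounded_closedBall.subset (inter_subset_left.trans inter_subset_right)
  · rw [← hausdorff_image_val]
    -- What remains comes from points of nondifferentiability, treated by Rademacher's theorem, and
    -- from critical points, treated by Sard's lemma.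
    refine measure_mono_null (t := ψ '' {u | ¬ DifferentiableAt ℝ ψ u} ∪
      ψ '' {u | DifferentiableAt ℝ ψ u ∧ ¬ Function.Injective (fderiv ℝ ψ u)}) ?_
      (measure_union_null (hψ.hausdorff_image_null_of_volume (ae_iff.1 hψ.ae_differentiableAt))
        hψ.hausdorff_image_not_injective)
    rintro _ ⟨x, ⟨⟨u, hu⟩, hx⟩, rfl⟩
    by_cases hd : DifferentiableAt ℝ ψ u
    · by_cases hi : Function.Injective (fderiv ℝ ψ u)
      · refine absurd ?_ hx
        obtain ⟨k, hk⟩ := mem_iUnion.1 (hT ⟨hd, hi⟩)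
        obtain ⟨j, hj⟩ := exists_nat_ge ‖u‖
        exact mem_iUnion.2 ⟨(k, j), u, ⟨⟨hk, by simpa using hj⟩, by rw [mem_preimage, hu]; exact x.2⟩, hu⟩
      · exact Or.inr ⟨u, ⟨hd, hi⟩, hu⟩
    · exact Or.inl ⟨u, hd, hu⟩

/-- A chart in which `f` is Lipschitzian, and is either degenerate or bi-Lipschitzian. -/
structure IsAdaptedChart {p : ℕ} (f : X → Euc p) (P : Set X) (t : Set (Euc m))
    (ψ : Euc m → Euc n) (ρ : Euc n → Euc m) (F : Euc m → Euc p) : Prop where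
  isChart : IsChart P t ψ ρ
  lipschitz_map : ∃ K, LipschitzWith K F
  eq_map : ∀ x ∈ P, f x = F (ρ x)
  dichotomy : (∀ u ∈ t, DifferentiableAt ℝ F u ∧ ¬ Function.Injective (fderiv ℝ F u)) ∨
    ∃ σ : Euc p → Euc m, (∃ K, LipschitzWith K σ) ∧ ∀ u ∈ t, σ (F u) = u

/-- A locally Lipschitzian map is, on countably many parts of a chart, the restriction of a
Lipschitzian map of the parameters. -/
theorem IsChart.exists_lipschitz_pieces {P : Set X} {t : Set (Euc m)} {ψ : Euc m → Euc n}
    {ρ : Euc n → Euc m} (h : IsChart P t ψ ρ) {p : ℕ} {f : X → Euc p} (hf : LocallyLipschitz f)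
    (hX : IsOpen X) :
    ∃ (ι : Type) (_ : Countable ι) (s : ι → Set (Euc m)) (F : ι → Euc m → Euc p),
      (∀ z, MeasurableSet (s z)) ∧ (∀ z, ∃ K, LipschitzWith K (F z)) ∧
      (∀ z, ∀ x ∈ P, ρ x ∈ s z → f x = F z (ρ x)) ∧ ∀ x ∈ P, ∃ z, ρ x ∈ s z := by
  choose K U hU hK using hf
  -- Interiors are used so that the resulting parameter sets are measurable.
  obtain ⟨c, hc, hcU⟩ := TopologicalSpace.countable_cover_nhds
    (fun x => interior_mem_nhds.2 (hU x))
  have := hc.to_subtype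
  have hm : ∀ z : c, MeasurableSet (ψ ⁻¹' (Subtype.val '' interior (U z))) := fun z =>
    h.continuous.measurable ((hX.isOpenMap_subtype_val _ isOpen_interior).measurableSet)
  have key : ∀ z : c, ∃ F : Euc m → Euc p, (∃ K, LipschitzWith K F) ∧
      ∀ x ∈ P, ρ x ∈ ψ ⁻¹' (Subtype.val '' interior (U z)) → f x = F (ρ x) := by
    intro z
    set s := t ∩ ψ ⁻¹' (Subtype.val '' interior (U z))
    have hch := h.restrict (hm z)
    obtain ⟨Kψ, hKψ⟩ := h.lipschitz
    set Q := {x ∈ P | ρ x ∈ ψ ⁻¹' (Subtype.val '' interior (U z))}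
    have hQU : Q ⊆ U z := by
      rintro x ⟨hxP, y, hy, hyx⟩
      rw [(h.inv_mem hxP).2] at hyx
      exact interior_subset (Subtype.ext hyx ▸ hy)
    have hG : ∀ u : s, ∃ x ∈ Q, (x : Euc n) = ψ u := fun u => hch.exists_mem u.2
    choose x hxQ hx using hG
    have hlip : LipschitzWith (K z * Kψ) fun u : s => f (x u) := by
      refine LipschitzWith.of_dist_le_mul fun u v => ?_
      refine ((hK z).dist_le_mul _ (hQU (hxQ u)) _ (hQU (hxQ v))).trans ?_
      rw [Subtype.dist_eq, hx, hx, NNReal.coe_mul, mul_assoc]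
      gcongr
      exact hKψ.dist_le_mul u v
    classical
    have hlip' : LipschitzOnWith (K z * Kψ)
        (fun u => if hu : u ∈ s then f (x ⟨u, hu⟩) else 0) s := by
      rw [lipschitzOnWith_iff_restrict]
      convert hlip using 1
      funext u
      simp
    obtain ⟨F, hF, hFeq⟩ := hlip'.extend_finite_dimension
    refine ⟨F, ⟨_, hF⟩, fun y hyP hyU => ?_⟩
    have hy' := hch.inv_mem (x := y) ⟨hyP, hyU⟩
    refine Eq.trans ?_ (hFeq hy'.1)
    have hys : ρ y ∈ s := hy'.1
    simp only [dif_pos hys]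
    exact congrArg f (Subtype.ext ((hx ⟨ρ y, hy'.1⟩).trans hy'.2)).symm
  choose F hF hfF using key
  refine ⟨c, inferInstance, fun z => ψ ⁻¹' (Subtype.val '' interior (U z)), F, hm, hF, hfF,
    fun x hx => ?_⟩
  obtain ⟨z, hz, hxz⟩ := mem_iUnion₂.1 (hcU.ge (mem_univ x))
  exact ⟨⟨z, hz⟩, x, hxz, (h.inv_mem hx).2.symm⟩

/-- Charts are almost covered by adapted charts. -/
theorem IsChart.isAlmostCovered {P : Set X} {t : Set (Euc m)} {ψ : Euc m → Euc n}
    {ρ : Euc n → Euc m} (h : IsChart P t ψ ρ) {p : ℕ} {f : X → Euc p} (hf : LocallyLipschitz f)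
    (hX : IsOpen X) :
    IsAlmostCovered m (fun Q : Set X => ∃ (t : Set (Euc m)) (ψ : Euc m → Euc n)
      (ρ : Euc n → Euc m) (F : Euc m → Euc p), IsAdaptedChart f Q t ψ ρ F) P := by
  have h1 : IsAlmostCovered m (fun Q : Set X => ∃ (t : Set (Euc m)) (ψ : Euc m → Euc n)
      (ρ : Euc n → Euc m) (F : Euc m → Euc p), IsChart Q t ψ ρ ∧ (∃ K, LipschitzWith K F) ∧
        ∀ x ∈ Q, f x = F (ρ x)) P := by
    obtain ⟨ι, _, s, F, hs, hF, hfF, hcov⟩ := h.exists_lipschitz_pieces hf hX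
    refine isAlmostCovered_of_iUnion (ι := ι) (fun z => {x ∈ P | ρ x ∈ s z}) (fun z => ?_) ?_
    · exact ⟨_, ψ, ρ, F z, h.restrict (hs z), hF z, fun x hx => hfF z x hx.1 hx.2⟩
    · refine measure_mono_null ?_ measure_empty
      rintro x ⟨hxP, hx⟩
      obtain ⟨z, hz⟩ := hcov x hxP
      exact hx (mem_iUnion.2 ⟨z, hxP, hz⟩)
  refine h1.trans ?_
  rintro Q ⟨t, ψ, ρ, F, hch, ⟨K, hF⟩, hfF⟩
  obtain ⟨T, σ, hTm, hσ, hT, hinv⟩ := exists_lipschitz_leftInverse F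
  set g := {u | DifferentiableAt ℝ F u ∧ Function.Injective (fderiv ℝ F u)} with hg
  have hgm : MeasurableSet g := measurableSet_differentiableAt_injective F
  set g' := {u | DifferentiableAt ℝ F u} \ g
  have hgm' : MeasurableSet g' := (measurableSet_of_differentiableAt ℝ F).diff hgm
  -- The index `none` stands for the degenerate part; `some k` stands for the `k`-th piece on which
  -- `F` has a Lipschitzian left inverse.
  refine isAlmostCovered_of_iUnion (ι := Option ℕ) (fun k => {x ∈ Q | ρ x ∈ k.elim g' T})
    (fun k => ?_) ?_
  · have hm : MeasurableSet (k.elim g' T) := by cases k <;> simp [hgm', hTm]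
    refine ⟨_, ψ, ρ, F, hch.restrict hm, ⟨K, hF⟩, fun x hx => hfF x hx.1, ?_⟩
    cases k with
    | none => exact Or.inl fun u hu => ⟨hu.2.1, fun hi => hu.2.2 ⟨hu.2.1, hi⟩⟩
    | some k => exact Or.inr ⟨σ k, hσ k, fun u hu => hinv k u hu.2⟩
  · have hd : ∀ᵐ x : X ∂((hausdorff m : Measure X).restrict Q), DifferentiableAt ℝ F (ρ x) :=
      hch.ae_of_ae_dom (ae_restrict_of_ae hF.ae_differentiableAt)
    rw [ae_restrict_iff' hch.measurableSet, ae_iff] at hd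
    refine measure_mono_null ?_ hd
    rintro x ⟨hxQ, hx⟩ hxd
    refine hx ?_
    have hxd' := hxd hxQ
    by_cases hi : Function.Injective (fderiv ℝ F (ρ x))
    · obtain ⟨k, hk⟩ := mem_iUnion.1 (hT ⟨hxd', hi⟩)
      exact mem_iUnion.2 ⟨some k, hxQ, hk⟩
    · exact mem_iUnion.2 ⟨none, hxQ, hxd', fun h => hi h.2⟩

/-- Adapted charts restrict to measurable subsets. -/
theorem IsAdaptedChart.subset (hX : IsOpen X) {p : ℕ} {f : X → Euc p} {P Q : Set X}
    {t : Set (Euc m)} {ψ : Euc m → Euc n} {ρ : Euc n → Euc m} {F : Euc m → Euc p}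
    (h : IsAdaptedChart f P t ψ ρ F) (hQ : MeasurableSet Q) :
    IsAdaptedChart f (P ∩ Q) (t ∩ ψ ⁻¹' (Subtype.val '' Q)) ψ ρ F := by
  have hm : MeasurableSet (ψ ⁻¹' (Subtype.val '' Q)) :=
    h.isChart.continuous.measurable
      ((MeasurableEmbedding.subtype_coe hX.measurableSet).measurableSet_image.2 hQ)
  have hPQ : P ∩ Q = {x ∈ P | ρ x ∈ ψ ⁻¹' (Subtype.val '' Q)} := by
    ext x
    refine and_congr_right fun hxP => ?_
    rw [mem_preimage, (h.isChart.inv_mem hxP).2, Subtype.val_injective.mem_set_image]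
  refine ⟨hPQ ▸ h.isChart.restrict hm, h.lipschitz_map, fun x hx => h.eq_map x hx.1, ?_⟩
  rcases h.dichotomy with h1 | ⟨σ, hσ, h1⟩
  · exact Or.inl fun u hu => h1 u hu.1
  · exact Or.inr ⟨σ, hσ, fun u hu => h1 u hu.1⟩

theorem isAdaptedChart_empty {p : ℕ} (f : X → Euc p) :
    IsAdaptedChart f ∅ (∅ : Set (Euc m)) 0 0 0 where
  isChart := ⟨by simp, MeasurableSet.empty, Bornology.isBounded_empty, ⟨0, LipschitzWith.const 0⟩,
    ⟨0, LipschitzWith.const 0⟩, by simp⟩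
  lipschitz_map := ⟨0, LipschitzWith.const 0⟩
  eq_map := by simp
  dichotomy := Or.inl (by simp)

/-- A rectifiable set is, up to a null set, a disjoint union of adapted charts. -/
theorem exists_disjoint_adaptedChart (hX : IsOpen X) {p : ℕ} {f : X → Euc p}
    (hf : LocallyLipschitz f) {E : Set X} (hE : NullMeasurableSet E (hausdorff m))
    (hrect : ∀ K : Set X, IsCompact K → IsHausdorffRectifiable m (Subtype.val '' (E ∩ K))) :
    ∃ (P : ℕ → Set X) (t : ℕ → Set (Euc m)) (ψ : ℕ → Euc m → Euc n) (ρ : ℕ → Euc n → Euc m)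
      (F : ℕ → Euc m → Euc p), (∀ j, IsAdaptedChart f (P j) (t j) (ψ j) (ρ j) (F j)) ∧
      (∀ j, P j ⊆ E) ∧ Pairwise (Function.onFun Disjoint P) ∧
      hausdorff m (E \ ⋃ j, P j) = 0 := by
  have := hX.locallyCompactSpace
  have h1 : IsAlmostCovered m (fun P : Set X => ∃ (ψ : Euc m → Euc n) (K : NNReal),
      LipschitzWith K ψ ∧ P = Subtype.val ⁻¹' range ψ) E := by
    have h2 : ∀ j : ℕ, ∃ g : ℕ → Euc m → Euc n, (∀ i, ∃ K, LipschitzWith K (g i)) ∧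
        hausdorff m ((E ∩ compactCovering X j) \ ⋃ i, Subtype.val ⁻¹' range (g i)) = 0 := by
      intro j
      obtain ⟨-, R, ⟨A, f, hAf, rfl⟩, h0⟩ := hrect _ (isCompact_compactCovering X j)
      have h3 : ∀ i, ∃ g : Euc m → Euc n, (∃ K, LipschitzWith K g) ∧ f i '' A i ⊆ range g := by
        intro i
        obtain ⟨K, hK⟩ := (hAf i).2
        obtain ⟨g, hg, hgeq⟩ := hK.extend_finite_dimension
        refine ⟨g, ⟨_, hg⟩, ?_⟩
        rintro _ ⟨u, hu, rfl⟩
        exact ⟨u, (hgeq hu).symm⟩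
      choose g hg hgA using h3
      refine ⟨g, hg, ?_⟩
      rw [← hausdorff_image_val]
      refine measure_mono_null ?_ h0
      rintro _ ⟨x, ⟨hx, hxg⟩, rfl⟩
      refine ⟨mem_image_of_mem _ hx, fun hxA => hxg ?_⟩
      obtain ⟨i, hi⟩ := mem_iUnion.1 hxA
      exact mem_iUnion.2 ⟨i, hgA i hi⟩
    choose g hg hg0 using h2
    refine isAlmostCovered_of_iUnion (ι := ℕ × ℕ) (fun k => Subtype.val ⁻¹' range (g k.1 k.2))
      (fun k => ?_) ?_
    · obtain ⟨K, hK⟩ := hg k.1 k.2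
      exact ⟨_, K, hK, rfl⟩
    · refine measure_mono_null (t := ⋃ j, ((E ∩ compactCovering X j) \
        ⋃ i, Subtype.val ⁻¹' range (g j i))) ?_ (measure_iUnion_null hg0)
      rintro x ⟨hxE, hx⟩
      have hxu : x ∈ ⋃ j, compactCovering X j := (iUnion_compactCovering X).ge (mem_univ x)
      obtain ⟨j, hj⟩ := mem_iUnion.1 hxu
      refine mem_iUnion.2 ⟨j, ⟨hxE, hj⟩, fun hxi => hx ?_⟩
      obtain ⟨i, hi⟩ := mem_iUnion.1 hxi
      exact mem_iUnion.2 ⟨(j, i), hi⟩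
  have h2 : IsAlmostCovered m (fun Q : Set X => ∃ (t : Set (Euc m)) (ψ : Euc m → Euc n)
      (ρ : Euc n → Euc m) (F : Euc m → Euc p), IsAdaptedChart f Q t ψ ρ F) E := by
    have h2 : IsAlmostCovered m (fun Q : Set X => ∃ (t : Set (Euc m)) (ψ : Euc m → Euc n)
        (ρ : Euc n → Euc m), IsChart Q t ψ ρ) E := by
      refine h1.trans ?_
      rintro P ⟨ψ, K, hψ, rfl⟩
      exact isAlmostCovered_isChart hX hψ
    refine h2.trans ?_
    rintro P ⟨t, ψ, ρ, h⟩
    exact h.isAlmostCovered hf hX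
  obtain ⟨𝒞, h𝒞, hC, h0⟩ := h2
  -- Adjoining the empty chart makes the family nonempty, hence enumerable by `ℕ`.
  obtain ⟨Q, hQ⟩ := (h𝒞.insert ∅).exists_eq_range (insert_nonempty _ _)
  have hQad : ∀ j, ∃ (t : Set (Euc m)) (ψ : Euc m → Euc n) (ρ : Euc n → Euc m)
      (F : Euc m → Euc p), IsAdaptedChart f (Q j) t ψ ρ F := by
    intro j
    have : Q j ∈ insert ∅ 𝒞 := hQ ▸ mem_range_self j
    rcases this with h | h
    · rw [h]
      exact ⟨_, _, _, _, isAdaptedChart_empty f⟩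
    · exact hC _ h
  choose t ψ ρ F hQad using hQad
  -- Charts are Borel sets, so `E` is first replaced by a Borel subset of full measure.
  obtain ⟨E', hE'E, hE'm, hE'⟩ := hE.exists_measurable_subset_ae_eq
  have hQm : ∀ j, MeasurableSet (Q j) := fun j => (hQad j).isChart.measurableSet
  have hPeq : ∀ j, disjointed Q j ∩ E' = Q j ∩ (disjointed Q j ∩ E') := fun j =>
    (inter_eq_right.2 (inter_subset_left.trans (disjointed_subset Q j))).symm
  refine ⟨fun j => disjointed Q j ∩ E',
    fun j => t j ∩ ψ j ⁻¹' (Subtype.val '' (disjointed Q j ∩ E')), ψ, ρ, F, fun j => ?_, fun j =>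
    inter_subset_right.trans hE'E, ?_, ?_⟩
  · simp only
    have := (hQad j).subset hX ((MeasurableSet.disjointed hQm j).inter hE'm)
    rwa [← hPeq j] at this
  · intro i j hij
    exact (disjoint_disjointed Q hij).mono inter_subset_left inter_subset_left
  · have hE0 : hausdorff m (E \ E') = 0 := (ae_eq_set.1 hE').2
    refine measure_mono_null ?_ (measure_union_null hE0 h0)
    rintro x ⟨hxE, hx⟩
    by_cases hxE' : x ∈ E'
    · refine Or.inr ⟨hxE, fun hxC => hx ?_⟩
      rw [← iUnion_inter, iUnion_disjointed]
      refine ⟨?_, hxE'⟩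
      obtain ⟨P, hP, hxP⟩ := hxC
      have : P ∈ range Q := hQ ▸ mem_insert_of_mem _ hP
      obtain ⟨j, rfl⟩ := this
      exact mem_iUnion.2 ⟨j, hxP⟩
    · exact Or.inl ⟨hxE, hxE'⟩

end Cover

/-! ### The Grassmannian -/

section Grassmannian

variable {n m : ℕ}

theorem Grassmannian.proj_injective :
    Function.Injective (Grassmannian.proj : Grassmannian n m → Euc n →L[ℝ] Euc n) :=
  fun _ _ h => Subtype.ext (Submodule.starProjection_inj.1 h)

theorem Grassmannian.isInducing_proj :
    IsInducing (Grassmannian.proj : Grassmannian n m → Euc n →L[ℝ] Euc n) := ⟨rfl⟩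

/-- The trace of an orthogonal projection is its rank. The Grassmannian is thereby cut out by closed
conditions in a bounded set of operators, hence compact. -/
theorem Grassmannian.range_proj :
    range (Grassmannian.proj : Grassmannian n m → Euc n →L[ℝ] Euc n) =
      {P : Euc n →L[ℝ] Euc n | P * P = P ∧ star P = P ∧
        LinearMap.trace ℝ (Euc n) (P : Euc n →ₗ[ℝ] Euc n) = m} := by
  have htr : ∀ T : Submodule ℝ (Euc n), LinearMap.trace ℝ (Euc n)
      (T.starProjection : Euc n →ₗ[ℝ] Euc n) = Module.finrank ℝ T := by
    intro T
    refine LinearMap.IsProj.trace ⟨fun x => T.starProjection_apply_mem x, fun x hx => ?_⟩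
    exact Submodule.starProjection_eq_self_iff.2 hx
  ext P
  constructor
  · rintro ⟨T, rfl⟩
    refine ⟨T.1.isIdempotentElem_starProjection, isSelfAdjoint_starProjection T.1, ?_⟩
    rw [Grassmannian.proj, htr, T.2]
  · rintro ⟨h1, h2, h3⟩
    obtain ⟨T, hT, rfl⟩ := isStarProjection_iff_eq_starProjection.1 (⟨h1, h2⟩ : IsStarProjection P)
    refine ⟨⟨T, ?_⟩, rfl⟩
    rw [htr] at h3
    exact_mod_cast h3

instance : T2Space (Grassmannian n m) :=
  (IsEmbedding.mk Grassmannian.isInducing_proj Grassmannian.proj_injective).t2Space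

instance : CompactSpace (Grassmannian n m) := by
  rw [← isCompact_univ_iff, Grassmannian.isInducing_proj.isCompact_iff, image_univ]
  refine Metric.isCompact_of_isClosed_isBounded ?_ ?_
  · rw [Grassmannian.range_proj]
    have htr : Continuous fun P : Euc n →L[ℝ] Euc n =>
        LinearMap.trace ℝ (Euc n) (P : Euc n →ₗ[ℝ] Euc n) :=
      ((LinearMap.trace ℝ (Euc n)).comp
        (ContinuousLinearMap.coeLM ℝ : (Euc n →L[ℝ] Euc n) →ₗ[ℝ] _)).continuous_of_finiteDimensional
    exact (isClosed_eq (continuous_id.mul continuous_id) continuous_id).inter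
      ((isClosed_eq (ContinuousLinearMap.adjoint (𝕜 := ℝ) (E := Euc n) (F := Euc n)).continuous
      continuous_id).inter (isClosed_eq htr continuous_const))
  · refine (Metric.isBounded_closedBall (x := (0 : Euc n →L[ℝ] Euc n)) (r := 1)).subset ?_
    rintro _ ⟨T, rfl⟩
    rw [mem_closedBall_zero_iff]
    exact T.1.starProjection_norm_le

theorem Grassmannian.measurable_iff {α : Type*} [MeasurableSpace α] {f : α → Grassmannian n m} :
    Measurable f ↔ Measurable fun a => (f a).proj := by
  refine ⟨fun hf => Grassmannian.isInducing_proj.continuous.measurable.comp hf, fun hf => ?_⟩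
  refine measurable_of_isOpen fun s hs => ?_
  obtain ⟨U, hU, rfl⟩ := isOpen_induced_iff.1 hs
  exact hf hU.measurableSet

theorem isUnit_adjoint_comp_self {A : Euc m →L[ℝ] Euc n} (hA : Function.Injective A) :
    IsUnit (A.adjoint ∘L A) := by
  rw [ContinuousLinearMap.isUnit_iff_bijective]
  have hinj : Function.Injective (A.adjoint ∘L A) := by
    refine (injective_iff_map_eq_zero _).2 fun w hw => hA ?_
    rw [map_zero, ← inner_self_eq_zero (𝕜 := ℝ), ← ContinuousLinearMap.adjoint_inner_left]
    have : A.adjoint (A w) = 0 := hw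
    rw [this, inner_zero_left]
  exact ⟨hinj, (LinearMap.injective_iff_surjective
    (f := ((A.adjoint ∘L A : Euc m →L[ℝ] Euc m) : Euc m →ₗ[ℝ] Euc m))).1 hinj⟩

/-- The orthogonal projection onto the range of an injective linear map. -/
theorem starProjection_range_eq {A : Euc m →L[ℝ] Euc n} (hA : Function.Injective A) :
    (LinearMap.range (A : Euc m →ₗ[ℝ] Euc n)).starProjection =
      A ∘L (Ring.inverse (A.adjoint ∘L A) ∘L A.adjoint) := by
  set S := Ring.inverse (A.adjoint ∘L A)
  have hS : (A.adjoint ∘L A) * S = 1 := Ring.mul_inverse_cancel _ (isUnit_adjoint_comp_self hA)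
  ext1 v
  refine Submodule.eq_starProjection_of_mem_of_inner_eq_zero
    (K := LinearMap.range (A : Euc m →ₗ[ℝ] Euc n)) (u := v) (v := A (S (A.adjoint v))) ?_ ?_
  · exact ⟨S (A.adjoint v), rfl⟩
  · rintro _ ⟨w, rfl⟩
    have h1 : A.adjoint (A (S (A.adjoint v))) = A.adjoint v :=
      congrArg (fun B : Euc m →L[ℝ] Euc m => B (A.adjoint v)) hS
    change inner ℝ (v - A (S (A.adjoint v))) (A w) = 0
    rw [← ContinuousLinearMap.adjoint_inner_left, map_sub, h1, sub_self, inner_zero_left]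

/-- The formula `A (A*A)⁻¹ A*` involves only continuous operations as long as `A*A` is invertible.
-/
theorem continuousOn_starProjection_range :
    ContinuousOn (fun A : Euc m →L[ℝ] Euc n =>
      (LinearMap.range (A : Euc m →ₗ[ℝ] Euc n)).starProjection) {A | Function.Injective A} := by
  have h : ContinuousOn (fun A : Euc m →L[ℝ] Euc n =>
      A ∘L (Ring.inverse (A.adjoint ∘L A) ∘L A.adjoint)) {A | Function.Injective A} := by
    intro A hA
    obtain ⟨u, hu⟩ := isUnit_adjoint_comp_self hA
    have h0 : Continuous fun A : Euc m →L[ℝ] Euc n => A.adjoint :=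
      ContinuousLinearMap.adjoint.continuous
    have h1 : ContinuousAt (fun A : Euc m →L[ℝ] Euc n => Ring.inverse (A.adjoint ∘L A)) A := by
      have h2 : ContinuousAt (fun A : Euc m →L[ℝ] Euc n => A.adjoint ∘L A) A :=
        (h0.clm_comp continuous_id).continuousAt
      refine ContinuousAt.comp' (g := Ring.inverse) ?_ h2
      rw [← hu]
      exact NormedRing.inverse_continuousAt u
    exact (continuousAt_id.clm_comp (h1.clm_comp h0.continuousAt)).continuousWithinAt
  exact h.congr fun A hA => starProjection_range_eq hA

theorem measurableSet_injective :
    MeasurableSet {A : Euc m →L[ℝ] Euc n | Function.Injective A} := by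
  have : {A : Euc m →L[ℝ] Euc n | Function.Injective A} = jacobian ⁻¹' Ioi 0 := by
    ext A
    exact jacobian_pos_iff.symm
  rw [this]
  exact continuous_jacobian.measurable measurableSet_Ioi

open Classical in
/-- The range of an injective linear map, as an element of the Grassmannian; `T₀` is returned
where the map is not injective. -/
noncomputable def rangePlane (T₀ : Grassmannian n m) (A : Euc m →L[ℝ] Euc n) : Grassmannian n m :=
  if h : Function.Injective A then
    ⟨LinearMap.range (A : Euc m →ₗ[ℝ] Euc n), by
      rw [LinearMap.finrank_range_of_inj h]
      simp⟩
  else T₀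

theorem rangePlane_val (T₀ : Grassmannian n m) {A : Euc m →L[ℝ] Euc n}
    (hA : Function.Injective A) :
    (rangePlane T₀ A).1 = LinearMap.range (A : Euc m →ₗ[ℝ] Euc n) := by
  simp [rangePlane, hA]

theorem rangePlane_of_not_injective (T₀ : Grassmannian n m) {A : Euc m →L[ℝ] Euc n}
    (hA : ¬ Function.Injective A) : rangePlane T₀ A = T₀ :=
  dif_neg hA

theorem measurable_rangePlane (T₀ : Grassmannian n m) : Measurable (rangePlane T₀) := by
  classical
  rw [Grassmannian.measurable_iff]
  have h : (fun A : Euc m →L[ℝ] Euc n => (rangePlane T₀ A).proj) =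
      piecewise {A : Euc m →L[ℝ] Euc n | Function.Injective A}
        (fun A : Euc m →L[ℝ] Euc n =>
          (LinearMap.range (A : Euc m →ₗ[ℝ] Euc n)).starProjection)
        (fun _ => T₀.proj) := by
    funext A
    by_cases hA : Function.Injective A
    · rw [piecewise_eq_of_mem _ _ _ hA]
      exact Submodule.starProjection_inj.2 (rangePlane_val T₀ hA)
    · rw [piecewise_eq_of_notMem _ _ _ hA, rangePlane_of_not_injective T₀ hA]
  rw [h]
  exact continuousOn_starProjection_range.measurable_piecewise continuousOn_const
    measurableSet_injective

theorem nonempty_grassmannian (h : m ≤ n) : Nonempty (Grassmannian n m) := by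
  have h1 := (EuclideanSpace.basisFun (Fin n) ℝ).toBasis.linearIndependent.comp _
    (Fin.castLE_injective h)
  exact ⟨⟨_, (finrank_span_eq_card h1).trans (Fintype.card_fin m)⟩⟩

/-- Radon measures are determined by the integrals of continuous functions with compact
support. -/
theorem eq_of_integral_eq {Z : Type*} [TopologicalSpace Z] [T2Space Z] [LocallyCompactSpace Z]
    [SecondCountableTopology Z] [MeasurableSpace Z] [BorelSpace Z] {μ ν : Measure Z}
    [IsFiniteMeasureOnCompacts μ] [IsFiniteMeasureOnCompacts ν]
    (h : ∀ k : Z → ℝ, Continuous k → HasCompactSupport k → ∫ z, k z ∂μ = ∫ z, k z ∂ν) : μ = ν := by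
  have := TopologicalSpace.metrizableSpace_of_t3_secondCountable Z
  exact Measure.ext_of_integral_eq_on_compactlySupported fun k => h k k.continuous k.hasCompactSupport

end Grassmannian

/-! ### Measures that are sums over charts -/

/-- `μ` is the sum of the Hausdorff measures on the images of the charts, with multiplicities. -/
structure IsChartSum {m n : ℕ} {X : Set (Euc n)} (μ : Measure X) (c : ℕ → ℝ) (P : ℕ → Set X)
    (t : ℕ → Set (Euc m)) (ψ : ℕ → Euc m → Euc n) (ρ : ℕ → Euc n → Euc m) : Prop where
  isChart : ∀ j, IsChart (P j) (t j) (ψ j) (ρ j)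
  pos : ∀ j, 0 < c j
  eq_sum : μ = Measure.sum fun j => ENNReal.ofReal (c j) • (hausdorff m : Measure X).restrict (P j)

namespace IsChartSum

variable {m n : ℕ} {X : Set (Euc n)} {μ : Measure X} {c : ℕ → ℝ} {P : ℕ → Set X}
  {t : ℕ → Set (Euc m)} {ψ : ℕ → Euc m → Euc n} {ρ : ℕ → Euc n → Euc m}

theorem coeff_ne_zero (h : IsChartSum μ c P t ψ ρ) (j : ℕ) : ENNReal.ofReal (c j) ≠ 0 := by
  simpa using h.pos j

theorem le (h : IsChartSum μ c P t ψ ρ) (j : ℕ) :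
    ENNReal.ofReal (c j) • (hausdorff m : Measure X).restrict (P j) ≤ μ := by
  rw [h.eq_sum]
  exact Measure.le_sum _ j

theorem ae_iff (h : IsChartSum μ c P t ψ ρ) {p : X → Prop} :
    (∀ᵐ x ∂μ, p x) ↔ ∀ j, ∀ᵐ x ∂((hausdorff m : Measure X).restrict (P j)), p x := by
  rw [h.eq_sum, ae_sum_iff]
  refine forall_congr' fun j => ?_
  rw [Measure.ae_ennreal_smul_measure_iff (h.coeff_ne_zero j)]

theorem lintegral_eq (h : IsChartSum μ c P t ψ ρ) (g : X → ℝ≥0∞) :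
    ∫⁻ x, g x ∂μ = ∑' j, ENNReal.ofReal (c j) * ∫⁻ x in P j, g x ∂hausdorff m := by
  rw [h.eq_sum, lintegral_sum_measure]
  simp only [lintegral_smul_measure, smul_eq_mul]

theorem ae_isRegularPoint (h : IsChartSum μ c P t ψ ρ) (hX : IsOpen X)
    [IsLocallyFiniteMeasure μ] :
    ∀ᵐ x ∂(hausdorff m : Measure X), ∀ j, x ∈ P j →
      IsRegularPoint μ (P j) (t j) (ψ j) (ρ j) x := by
  have := hX.locallyCompactSpace
  refine ae_all_iff.2 fun j => ?_
  rw [← ae_restrict_iff' (h.isChart j).measurableSet]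
  exact (h.isChart j).ae_isRegularPoint μ inferInstance

/-- The charts may overlap, and the multiplicities of all charts through `x` add up. -/
theorem ae_hasDensity (h : IsChartSum μ c P t ψ ρ) [IsLocallyFiniteMeasure μ] :
    ∀ᵐ x ∂(hausdorff m : Measure X), HasDensity μ m x
      (∑' j, ENNReal.ofReal (c j) * (P j).indicator (fun _ => hausdorffConst m) x) := by
  have hfin : IsLocallyFiniteMeasure (Measure.sum fun j =>
      ENNReal.ofReal (c j) • (hausdorff m : Measure X).restrict (P j)) := by
    rw [← h.eq_sum]
    infer_instance
  have := ae_hasDensity_sum (fun j => ENNReal.ofReal (c j) •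
    (hausdorff m : Measure X).restrict (P j)) m
    (fun j x => ENNReal.ofReal (c j) * (P j).indicator (fun _ => hausdorffConst m) x) ?_
  · rwa [← h.eq_sum] at this
  · intro j
    filter_upwards [(h.isChart j).ae_hasDensity] with x hx
    have := ENNReal.Tendsto.const_mul (a := ENNReal.ofReal (c j)) hx (Or.inr ENNReal.ofReal_ne_top)
    refine this.congr fun r => ?_
    rw [densityRatio, densityRatio, Measure.smul_apply, smul_eq_mul, mul_div_assoc]

end IsChartSum

section Weight

variable {m n : ℕ} {X : Set (Euc n)}

theorem weight_apply (V : Measure (X × Grassmannian n m)) {B : Set X} (hB : MeasurableSet B) :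
    weight V B = V (Prod.fst ⁻¹' B) := Measure.map_apply measurable_fst hB

theorem isFiniteMeasureOnCompacts_weight (V : Measure (X × Grassmannian n m))
    [IsFiniteMeasureOnCompacts V] : IsFiniteMeasureOnCompacts (weight V) where
  lt_top_of_isCompact K hK := by
    rw [weight_apply V hK.measurableSet, ← prod_univ]
    exact (hK.prod isCompact_univ).measure_lt_top

/-- A rectifiable set has an approximate tangent plane almost everywhere. -/
theorem ae_exists_apTan_eq (hX : IsOpen X) {E : Set X} (hE : NullMeasurableSet E (hausdorff m))
    (hrect : ∀ K : Set X, IsCompact K → IsHausdorffRectifiable m (Subtype.val '' (E ∩ K))) :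
    ∀ᵐ x ∂((hausdorff m : Measure X).restrict E), ∃ T : Grassmannian n m,
      apTan ((hausdorff m : Measure X).restrict E) m x = (T.1 : Set (Euc n)) := by
  have := hX.locallyCompactSpace
  have hfin : IsFiniteMeasureOnCompacts ((hausdorff m : Measure X).restrict E) := by
    refine ⟨fun K hK => ?_⟩
    rw [Measure.restrict_apply hK.measurableSet, inter_comm, ← hausdorff_image_val]
    exact (hrect K hK).1
  -- Only the charts matter here, so they are adapted to a trivial map into `ℝ⁰`.
  obtain ⟨P, t, ψ, ρ, F, hP, hPE, hdis, h0⟩ := exists_disjoint_adaptedChart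
    (f := fun _ : X => (0 : Euc 0)) hX (LipschitzWith.const 0).locallyLipschitz hE hrect
  have hle : (hausdorff m : Measure X).restrict E ≤
      Measure.sum fun j => (hausdorff m : Measure X).restrict (P j) := by
    rw [← restrict_iUnion hdis fun j => (hP j).isChart.measurableSet]
    refine Measure.restrict_mono_ae ?_
    rw [ae_le_set]
    exact h0
  refine (Measure.absolutelyContinuous_of_le hle).ae_le (ae_sum_iff.2 fun j => ?_)
  filter_upwards [(hP j).isChart.ae_isRegularPoint ((hausdorff m : Measure X).restrict E)
    inferInstance] with x hx
  refine ⟨⟨_, hx.finrank_range⟩, ?_⟩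
  refine hx.apTan_eq (hP j).isChart one_ne_zero ?_
  rw [one_smul]
  exact Measure.restrict_mono (hPE j) le_rfl

/-- Tangent planes exist almost everywhere, so the tangent slice over a cylinder `B × G(n,m)` is
almost all of `Eᵢ ∩ B`. -/
theorem weight_eq_sum (hX : IsOpen X) {V : Measure (X × Grassmannian n m)} {c : ℕ → ℝ}
    {E : ℕ → Set X} (hE : ∀ i, NullMeasurableSet (E i) (hausdorff m))
    (hrect : ∀ i, ∀ K : Set X, IsCompact K → IsHausdorffRectifiable m (Subtype.val '' (E i ∩ K)))
    (hV : ∀ B : Set (X × Grassmannian n m), MeasurableSet B →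
      V B = ∑' i, ENNReal.ofReal (c i) * hausdorff m (tangentSlice (E i) B)) :
    weight V =
      Measure.sum fun i => ENNReal.ofReal (c i) • (hausdorff m : Measure X).restrict (E i) := by
  ext B hB
  rw [weight_apply V hB, hV _ (measurable_fst hB), Measure.sum_apply _ hB]
  refine tsum_congr fun i => ?_
  rw [Measure.smul_apply, smul_eq_mul, Measure.restrict_apply hB]
  congr 1
  refine measure_congr ?_
  have h := ae_exists_apTan_eq hX (hE i) (hrect i)
  rw [ae_restrict_iff'₀ (hE i)] at h
  filter_upwards [h] with x hx
  refine propext ⟨?_, ?_⟩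
  · rintro ⟨hxE, T, -, hxB⟩
    exact ⟨hxB, hxE⟩
  · rintro ⟨hxB, hxE⟩
    obtain ⟨T, hT⟩ := hx hxE
    exact ⟨hxE, T, hT, hxB⟩

/-- The weight of a rectifiable varifold is a sum over adapted charts. -/
theorem IsRectifiableVarifold.exists_isChartSum (hX : IsOpen X)
    {V : Measure (X × Grassmannian n m)} (hV : IsRectifiableVarifold V) {p : ℕ} {f : X → Euc p}
    (hf : LocallyLipschitz f) :
    ∃ (c : ℕ → ℝ) (P : ℕ → Set X) (t : ℕ → Set (Euc m)) (ψ : ℕ → Euc m → Euc n)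
      (ρ : ℕ → Euc n → Euc m) (F : ℕ → Euc m → Euc p), IsChartSum (weight V) c P t ψ ρ ∧
        ∀ j, IsAdaptedChart f (P j) (t j) (ψ j) (ρ j) (F j) := by
  obtain ⟨c, E, hc, hE, hrect, hVE⟩ := hV.rectifiable
  have h := fun i => exists_disjoint_adaptedChart hX hf (hE i) (hrect i)
  choose P t ψ ρ F hP hPE hdis h0 using h
  -- The doubly indexed family of charts is enumerated by a pairing of `ℕ × ℕ` with `ℕ`.
  refine ⟨fun k => c k.unpair.1, fun k => P k.unpair.1 k.unpair.2, fun k => t k.unpair.1 k.unpair.2,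
    fun k => ψ k.unpair.1 k.unpair.2, fun k => ρ k.unpair.1 k.unpair.2,
    fun k => F k.unpair.1 k.unpair.2, ⟨fun k => (hP _ _).isChart, fun k => hc _, ?_⟩,
    fun k => hP _ _⟩
  have h1 : ∀ i, (hausdorff m : Measure X).restrict (E i) =
      Measure.sum fun j => (hausdorff m : Measure X).restrict (P i j) := by
    intro i
    rw [← restrict_iUnion (hdis i) fun j => (hP i j).isChart.measurableSet]
    refine Measure.restrict_congr_set (Filter.EventuallyLE.antisymm ?_ ?_)
    · rw [ae_le_set]
      exact h0 i
    · exact (iUnion_subset (hPE i)).eventuallyLE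
  rw [weight_eq_sum hX hE hrect hVE]
  ext B hB
  simp only [Measure.sum_apply _ hB, Measure.smul_apply, h1, smul_eq_mul, ← ENNReal.tsum_mul_left]
  rw [← ENNReal.tsum_prod]
  exact (Nat.pairEquiv.symm.tsum_eq (fun k : ℕ × ℕ => ENNReal.ofReal (c k.1) *
    (hausdorff m : Measure X).restrict (P k.1 k.2) B)).symm

end Weight

/-! ### The varifold of a sum over charts -/

section ChartVarifold

variable {m n : ℕ} {X : Set (Euc n)}

/-- The tangent plane given by a chart; `T₀` is returned where the chart is degenerate. -/
noncomputable def chartPlane (T₀ : Grassmannian n m) (ψ : Euc m → Euc n) (ρ : Euc n → Euc m)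
    (x : X) : Grassmannian n m :=
  rangePlane T₀ (fderiv ℝ ψ (ρ x))

theorem IsChart.measurable_chartPlane {P : Set X} {t : Set (Euc m)} {ψ : Euc m → Euc n}
    {ρ : Euc n → Euc m} (h : IsChart P t ψ ρ) (T₀ : Grassmannian n m) :
    Measurable (chartPlane T₀ ψ ρ : X → Grassmannian n m) :=
  (measurable_rangePlane T₀).comp ((measurable_fderiv ℝ ψ).comp h.measurable_inv_coe)

/-- The varifold with the given charts and multiplicities. -/
noncomputable def chartVarifold (T₀ : Grassmannian n m) (c : ℕ → ℝ) (P : ℕ → Set X)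
    (ψ : ℕ → Euc m → Euc n) (ρ : ℕ → Euc n → Euc m) : Measure (X × Grassmannian n m) :=
  Measure.sum fun j => ENNReal.ofReal (c j) •
    ((hausdorff m : Measure X).restrict (P j)).map fun x => (x, chartPlane T₀ (ψ j) (ρ j) x)

namespace IsChartSum

variable {μ : Measure X} {c : ℕ → ℝ} {P : ℕ → Set X}
  {t : ℕ → Set (Euc m)} {ψ : ℕ → Euc m → Euc n} {ρ : ℕ → Euc n → Euc m}

theorem measurable_graph (h : IsChartSum μ c P t ψ ρ) (T₀ : Grassmannian n m) (j : ℕ) :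
    Measurable fun x : X => (x, chartPlane T₀ (ψ j) (ρ j) x) :=
  measurable_id.prodMk ((h.isChart j).measurable_chartPlane T₀)

theorem chartVarifold_apply (h : IsChartSum μ c P t ψ ρ) (T₀ : Grassmannian n m)
    {B : Set (X × Grassmannian n m)} (hB : MeasurableSet B) :
    chartVarifold T₀ c P ψ ρ B = ∑' j, ENNReal.ofReal (c j) *
      hausdorff m {x ∈ P j | (x, chartPlane T₀ (ψ j) (ρ j) x) ∈ B} := by
  rw [chartVarifold, Measure.sum_apply _ hB]
  refine tsum_congr fun j => ?_
  rw [Measure.smul_apply, smul_eq_mul, Measure.map_apply (h.measurable_graph T₀ j) hB,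
    Measure.restrict_apply (h.measurable_graph T₀ j hB), inter_comm]
  rfl

theorem weight_chartVarifold (h : IsChartSum μ c P t ψ ρ) (T₀ : Grassmannian n m) :
    weight (chartVarifold T₀ c P ψ ρ) = μ := by
  ext B hB
  rw [weight_apply _ hB, h.chartVarifold_apply T₀ (measurable_fst hB), h.eq_sum,
    Measure.sum_apply _ hB]
  refine tsum_congr fun j => ?_
  rw [Measure.smul_apply, smul_eq_mul, Measure.restrict_apply hB, inter_comm]
  rfl

/-- At regular points the plane given by the chart is the approximate tangent plane of `Hᵐ ⌞ P j`,
so each summand is `c j` times the varifold of `P j`. Finiteness on compact sets is inherited from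
the weight. -/
theorem isRectifiableVarifold (h : IsChartSum μ c P t ψ ρ) [IsFiniteMeasureOnCompacts μ]
    (hX : IsOpen X) (T₀ : Grassmannian n m) :
    IsRectifiableVarifold (chartVarifold T₀ c P ψ ρ) where
  radon := by
    refine ⟨fun K hK => ?_⟩
    have hK' := hK.image continuous_fst
    refine (measure_mono (subset_preimage_image Prod.fst K)).trans_lt ?_
    rw [← weight_apply _ hK'.measurableSet, h.weight_chartVarifold]
    exact hK'.measure_lt_top
  rectifiable := by
    have := hX.locallyCompactSpace
    refine ⟨c, P, h.pos, fun j => (h.isChart j).measurableSet.nullMeasurableSet, ?_, ?_⟩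
    · intro j K _
      refine ⟨?_, ψ j '' t j, ⟨fun _ => t j, fun _ => ψ j, fun _ => ⟨(h.isChart j).isBounded_dom,
        ?_⟩, (iUnion_const _).symm⟩, ?_⟩
      · rw [hausdorff_image_val]
        exact (measure_mono inter_subset_left).trans_lt (h.isChart j).hausdorff_lt_top
      · obtain ⟨K, hK⟩ := (h.isChart j).lipschitz
        exact ⟨K, hK.lipschitzOnWith⟩
      · rw [← (h.isChart j).image_eq, sdiff_eq_empty.2 (image_mono inter_subset_left), measure_empty]
    · intro B hB
      rw [h.chartVarifold_apply T₀ hB]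
      refine tsum_congr fun j => ?_
      congr 1
      have hfin := (h.isChart j).isFiniteMeasure
      have hreg := (h.isChart j).ae_isRegularPoint ((hausdorff m : Measure X).restrict (P j))
        inferInstance
      rw [ae_restrict_iff' (h.isChart j).measurableSet] at hreg
      refine measure_congr ?_
      filter_upwards [hreg] with x hx
      have heq : ∀ hxP : x ∈ P j, apTan ((hausdorff m : Measure X).restrict (P j)) m x =
          ((chartPlane T₀ (ψ j) (ρ j) x).1 : Set (Euc n)) := by
        intro hxP
        rw [(hx hxP).apTan_eq (h.isChart j) one_ne_zero (by rw [one_smul]), chartPlane,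
          rangePlane_val T₀ (hx hxP).injective]
      refine propext ⟨?_, ?_⟩
      · rintro ⟨hxP, hxB⟩
        exact ⟨hxP, _, heq hxP, hxB⟩
      · rintro ⟨hxP, T, hT, hxB⟩
        refine ⟨hxP, ?_⟩
        have hT' : T = chartPlane T₀ (ψ j) (ρ j) x :=
          Subtype.ext (SetLike.coe_injective (hT.symm.trans (heq hxP)))
        rwa [← hT']

end IsChartSum

end ChartVarifold

/-! ### Push forward in charts -/

/-- A sum over charts in which `f` is given by Lipschitzian maps `F j` of the parameters; the
charts where `F j` is nondegenerate are carried to charts of the image. -/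
structure IsAdaptedSum {m n p : ℕ} {X : Set (Euc n)} {Y : Set (Euc p)} (f : X → Y) (μ : Measure X)
    (c : ℕ → ℝ) (P : ℕ → Set X) (t : ℕ → Set (Euc m)) (ψ : ℕ → Euc m → Euc n)
    (ρ : ℕ → Euc n → Euc m) (F : ℕ → Euc m → Euc p) (Q : ℕ → Set Y) (t' : ℕ → Set (Euc m))
    (σ : ℕ → Euc p → Euc m) : Prop where
  isChartSum : IsChartSum μ c P t ψ ρ
  isChart_image : ∀ j, IsChart (Q j) (t' j) (F j) (σ j)
  eq_map : ∀ j, ∀ x ∈ P j, (f x : Euc p) = F j (ρ j x)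
  dichotomy : ∀ j, (Q j = f '' P j ∧ t' j = t j) ∨
    (Q j = ∅ ∧ t' j = ∅ ∧ ∀ u ∈ t j, DifferentiableAt ℝ (F j) u ∧
      ¬ Function.Injective (fderiv ℝ (F j) u))

section AdaptedSum

variable {m n p : ℕ} {X : Set (Euc n)} {Y : Set (Euc p)} {f : X → Y} {μ : Measure X}

/-- A degenerate chart receives the empty image chart, so that one index set and one family of
multiplicities serve both varifolds. -/
theorem IsAdaptedChart.exists_image {P : Set X} {t : Set (Euc m)} {ψ : Euc m → Euc n}
    {ρ : Euc n → Euc m} {F : Euc m → Euc p} (h : IsAdaptedChart (ambient f) P t ψ ρ F) :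
    ∃ (Q : Set Y) (t' : Set (Euc m)) (σ : Euc p → Euc m), IsChart Q t' F σ ∧
      ((Q = f '' P ∧ t' = t) ∨ (Q = ∅ ∧ t' = ∅ ∧ ∀ u ∈ t, DifferentiableAt ℝ F u ∧
        ¬ Function.Injective (fderiv ℝ F u))) := by
  rcases h.dichotomy with h0 | ⟨σ, hσ, hinv⟩
  · exact ⟨∅, ∅, 0, ⟨by simp, MeasurableSet.empty, Bornology.isBounded_empty, h.lipschitz_map,
      ⟨0, LipschitzWith.const 0⟩, by simp⟩, Or.inr ⟨rfl, rfl, h0⟩⟩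
  · refine ⟨f '' P, t, σ, ⟨?_, h.isChart.measurableSet_dom, h.isChart.isBounded_dom,
      h.lipschitz_map, hσ, hinv⟩, Or.inl ⟨rfl, rfl⟩⟩
    ext y
    constructor
    · rintro ⟨_, ⟨x, hx, rfl⟩, rfl⟩
      exact ⟨ρ x, (h.isChart.inv_mem hx).1, (h.eq_map x hx).symm⟩
    · rintro ⟨u, hu, rfl⟩
      obtain ⟨x, hx, hxu⟩ := h.isChart.exists_mem hu
      refine ⟨f x, mem_image_of_mem f hx, ?_⟩
      have := h.eq_map x hx
      rwa [hxu, h.isChart.left_inv u hu] at this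

theorem IsRectifiableVarifold.exists_isAdaptedSum (hX : IsOpen X)
    {V : Measure (X × Grassmannian n m)} (hV : IsRectifiableVarifold V) (hf : LocallyLipschitz f) :
    ∃ (c : ℕ → ℝ) (P : ℕ → Set X) (t : ℕ → Set (Euc m)) (ψ : ℕ → Euc m → Euc n)
      (ρ : ℕ → Euc n → Euc m) (F : ℕ → Euc m → Euc p) (Q : ℕ → Set Y) (t' : ℕ → Set (Euc m))
      (σ : ℕ → Euc p → Euc m), IsAdaptedSum f (weight V) c P t ψ ρ F Q t' σ := by
  obtain ⟨c, P, t, ψ, ρ, F, h, hF⟩ := hV.exists_isChartSum hX (f := ambient f)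
    ((LipschitzWith.subtype_val Y).locallyLipschitz.comp hf)
  have h1 := fun j => (hF j).exists_image
  choose Q t' σ hQ halt using h1
  exact ⟨c, P, t, ψ, ρ, F, Q, t', σ, h, hQ, fun j => (hF j).eq_map, halt⟩

open Classical in
/-- The plane `im ap Df(x)`; `T₀` is returned where it is not of dimension `m`. -/
noncomputable def imagePlane (T₀ : Grassmannian p m) (μ : Measure X) (f : X → Y) (x : X) :
    Grassmannian p m :=
  if h : Module.finrank ℝ (apImage μ m (ambient f) x) = m then
    ⟨apImage μ m (ambient f) x, h⟩ else T₀

/-- By rank and nullity, both sides take the default value `T₀` in the same case. -/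
theorem imagePlane_eq_rangePlane (T₀ : Grassmannian p m) {x : X} {A : Euc m →L[ℝ] Euc p}
    (h : apImage μ m (ambient f) x = LinearMap.range (A : Euc m →ₗ[ℝ] Euc p)) :
    imagePlane T₀ μ f x = rangePlane T₀ A := by
  have hiff : Module.finrank ℝ (apImage μ m (ambient f) x) = m ↔ Function.Injective A := by
    rw [h]
    have h1 := LinearMap.finrank_range_add_finrank_ker (A : Euc m →ₗ[ℝ] Euc p)
    rw [finrank_euclideanSpace_fin] at h1
    constructor
    · intro h2
      have h3 : LinearMap.ker (A : Euc m →ₗ[ℝ] Euc p) = ⊥ := Submodule.finrank_eq_zero.1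
        (Nat.add_left_cancel (h1.trans (h2.symm.trans (add_zero _).symm)))
      exact LinearMap.ker_eq_bot.1 h3
    · intro h2
      rw [LinearMap.finrank_range_of_inj h2, finrank_euclideanSpace_fin]
  by_cases hA : Function.Injective A
  · refine Subtype.ext ?_
    rw [rangePlane_val T₀ hA, ← h]
    simp [imagePlane, hiff.2 hA]
  · rw [rangePlane_of_not_injective T₀ hA]
    exact dif_neg fun h2 => hA (hiff.1 h2)

theorem exteriorNorm_nonneg {E F : Type*} [NormedAddCommGroup E] [InnerProductSpace ℝ E]
    [FiniteDimensional ℝ E] [NormedAddCommGroup F] [InnerProductSpace ℝ F]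
    [FiniteDimensional ℝ F] (m : ℕ) (L : E →ₗ[ℝ] F) : 0 ≤ exteriorNorm m L :=
  norm_nonneg (LinearMap.toContinuousLinearMap (exteriorPower.map m L))

theorem apJacobian_nonneg (μ : Measure X) (f : X → Euc p) (x : X) : 0 ≤ apJacobian μ m f x :=
  exteriorNorm_nonneg _ _

namespace IsAdaptedSum

variable {c : ℕ → ℝ} {P : ℕ → Set X} {t : ℕ → Set (Euc m)} {ψ : ℕ → Euc m → Euc n}
  {ρ : ℕ → Euc n → Euc m} {F : ℕ → Euc m → Euc p} {Q : ℕ → Set Y} {t' : ℕ → Set (Euc m)}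
  {σ : ℕ → Euc p → Euc m}

theorem lipschitz_map (h : IsAdaptedSum f μ c P t ψ ρ F Q t' σ) (j : ℕ) :
    ∃ K, LipschitzWith K (F j) := (h.isChart_image j).lipschitz

theorem ae_regular (h : IsAdaptedSum f μ c P t ψ ρ F Q t' σ) (hX : IsOpen X)
    [IsLocallyFiniteMeasure μ] : ∀ᵐ x ∂(hausdorff m : Measure X), ∀ j, x ∈ P j →
      IsRegularPoint μ (P j) (t j) (ψ j) (ρ j) x ∧ DifferentiableAt ℝ (F j) (ρ j x) := by
  have h1 : ∀ᵐ x : X ∂(hausdorff m : Measure X), ∀ j, x ∈ P j →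
      DifferentiableAt ℝ (F j) (ρ j x) := by
    refine ae_all_iff.2 fun j => ?_
    rw [← ae_restrict_iff' (h.isChartSum.isChart j).measurableSet]
    obtain ⟨K, hK⟩ := h.lipschitz_map j
    exact (h.isChartSum.isChart j).ae_of_ae_dom (ae_restrict_of_ae hK.ae_differentiableAt)
  filter_upwards [h.isChartSum.ae_isRegularPoint hX, h1] with x hx hx1 j hj
  exact ⟨hx j hj, hx1 j hj⟩

theorem ae_apJacobian_eq (h : IsAdaptedSum f μ c P t ψ ρ F Q t' σ) (hX : IsOpen X)
    [IsLocallyFiniteMeasure μ] (j : ℕ) :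
    ∀ᵐ x : X ∂((hausdorff m : Measure X).restrict (P j)), apJacobian μ m (ambient f) x =
      jacobian (fderiv ℝ (F j) (ρ j x)) / jacobian (fderiv ℝ (ψ j) (ρ j x)) := by
  rw [ae_restrict_iff' (h.isChartSum.isChart j).measurableSet]
  filter_upwards [h.ae_regular hX] with x hx hxj
  obtain ⟨h1, h2⟩ := hx j hxj
  have h3 := h.isChartSum
  rw [eq_div_iff (jacobian_pos_iff.2 h1.injective).ne']
  exact h1.apJacobian_eq (h3.isChart j) (h3.coeff_ne_zero j) (h3.le j) (h.eq_map j) h2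

theorem ae_imagePlane_eq (h : IsAdaptedSum f μ c P t ψ ρ F Q t' σ) (hX : IsOpen X)
    [IsLocallyFiniteMeasure μ] (T₀ : Grassmannian p m) (j : ℕ) :
    ∀ᵐ x : X ∂((hausdorff m : Measure X).restrict (P j)),
      imagePlane T₀ μ f x = rangePlane T₀ (fderiv ℝ (F j) (ρ j x)) := by
  rw [ae_restrict_iff' (h.isChartSum.isChart j).measurableSet]
  filter_upwards [h.ae_regular hX] with x hx hxj
  obtain ⟨h1, h2⟩ := hx j hxj
  have h3 := h.isChartSum
  exact imagePlane_eq_rangePlane T₀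
    (h1.apImage_eq (h3.isChart j) (h3.coeff_ne_zero j) (h3.le j) (h.eq_map j) h2)

theorem aemeasurable_apJacobian (h : IsAdaptedSum f μ c P t ψ ρ F Q t' σ) (hX : IsOpen X)
    [IsLocallyFiniteMeasure μ] :
    AEMeasurable (apJacobian μ m (ambient f)) μ := by
  rw [h.isChartSum.eq_sum]
  refine aemeasurable_sum_measure_iff.2 fun j => AEMeasurable.smul_measure ?_ _
  refine ⟨fun x => jacobian (fderiv ℝ (F j) (ρ j x)) / jacobian (fderiv ℝ (ψ j) (ρ j x)), ?_, ?_⟩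
  · have h1 := (h.isChartSum.isChart j).measurable_inv_coe
    exact ((continuous_jacobian.measurable.comp (measurable_fderiv ℝ (F j))).comp h1).div
      ((continuous_jacobian.measurable.comp (measurable_fderiv ℝ (ψ j))).comp h1)
  · rw [← h.isChartSum.eq_sum]
    exact h.ae_apJacobian_eq hX j

theorem aemeasurable_imagePlane (h : IsAdaptedSum f μ c P t ψ ρ F Q t' σ) (hX : IsOpen X)
    [IsLocallyFiniteMeasure μ] (T₀ : Grassmannian p m) :
    AEMeasurable (imagePlane T₀ μ f) μ := by
  rw [h.isChartSum.eq_sum]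
  refine aemeasurable_sum_measure_iff.2 fun j => AEMeasurable.smul_measure ?_ _
  refine ⟨fun x => rangePlane T₀ (fderiv ℝ (F j) (ρ j x)), ?_, ?_⟩
  · exact ((measurable_rangePlane T₀).comp (measurable_fderiv ℝ (F j))).comp
      (h.isChartSum.isChart j).measurable_inv_coe
  · rw [← h.isChartSum.eq_sum]
    exact h.ae_imagePlane_eq hX T₀ j

/-- Change of variables in one chart. -/
theorem lintegral_apJacobian_mul (h : IsAdaptedSum f μ c P t ψ ρ F Q t' σ) (hX : IsOpen X)
    [IsLocallyFiniteMeasure μ] (j : ℕ) {g : Euc m → ℝ≥0∞}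
    (hg : Measurable g) :
    ∫⁻ x : X in P j, ENNReal.ofReal (apJacobian μ m (ambient f) x) * g (ρ j x) ∂hausdorff m =
      ∫⁻ y : Y in Q j, g (σ j y) ∂hausdorff m := by
  have hch := h.isChartSum.isChart j
  have hmF := measurable_jacobian_fderiv (F j)
  -- The area formula in `P j` contributes the Jacobian of `ψ j`, which cancels the denominator of
  -- the approximate Jacobian.
  have h1 : ∫⁻ x : X in P j, ENNReal.ofReal (apJacobian μ m (ambient f) x) * g (ρ j x)
      ∂hausdorff m = ∫⁻ u in t j, ENNReal.ofReal (jacobian (fderiv ℝ (F j) u)) * g u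
        ∂hausdorff m := by
    have hmψ : Measurable fun u => ENNReal.ofReal (jacobian (fderiv ℝ (F j) u) /
        jacobian (fderiv ℝ (ψ j) u)) :=
      ((continuous_jacobian.measurable.comp (measurable_fderiv ℝ (F j))).div
        (continuous_jacobian.measurable.comp (measurable_fderiv ℝ (ψ j)))).ennreal_ofReal
    rw [lintegral_congr_ae (g := fun x : X => ENNReal.ofReal (jacobian (fderiv ℝ (F j) (ρ j x)) /
        jacobian (fderiv ℝ (ψ j) (ρ j x))) * g (ρ j x)),
      hch.lintegral_comp_inv (g := fun u => ENNReal.ofReal (jacobian (fderiv ℝ (F j) u) /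
        jacobian (fderiv ℝ (ψ j) u)) * g u) (hmψ.mul hg)]
    · refine lintegral_congr_ae (ae_restrict_hausdorff ?_)
      filter_upwards [hch.ae_differentiableAt] with u hu
      have h2 := jacobian_pos_iff.2 hu.2.2.2
      rw [← mul_assoc, ← ENNReal.ofReal_mul h2.le, mul_div_cancel₀ _ h2.ne']
    · filter_upwards [h.ae_apJacobian_eq hX j] with x hx
      rw [hx]
  rw [h1]
  -- A nondegenerate chart is finished by the area formula in `Q j`; for a degenerate one both sides
  -- vanish.
  rcases h.dichotomy j with ⟨-, h2⟩ | ⟨hQ, -, h2⟩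
  · rw [(h.isChart_image j).lintegral_comp_inv hg, h2]
  · rw [hQ, Measure.restrict_empty, lintegral_zero_measure]
    refine (lintegral_eq_zero_iff (hmF.mul hg)).2 ?_
    rw [EventuallyEq, ae_restrict_iff' hch.measurableSet_dom]
    refine Eventually.of_forall fun u hu => ?_
    rw [Pi.mul_apply, jacobian_eq_zero_iff.2 (h2 u hu).2]
    simp

end IsAdaptedSum

end AdaptedSum

/-! ### The push forward as an image measure, and its finiteness. -/

section AdaptedSum

variable {m n p : ℕ} {X : Set (Euc n)} {Y : Set (Euc p)} {f : X → Y} {μ : Measure X}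

/-- The measure `μ ⌞ ap Jₘf`. -/
noncomputable def jacobianMeasure (m : ℕ) (μ : Measure X) (f : X → Y) : Measure X :=
  μ.withDensity fun x => ENNReal.ofReal (apJacobian μ m (ambient f) x)

theorem jacobianMeasure_absolutelyContinuous (m : ℕ) (μ : Measure X) (f : X → Y) :
    jacobianMeasure m μ f ≪ μ := withDensity_absolutelyContinuous _ _

namespace IsAdaptedSum

variable {c : ℕ → ℝ} {P : ℕ → Set X} {t : ℕ → Set (Euc m)} {ψ : ℕ → Euc m → Euc n}
  {ρ : ℕ → Euc n → Euc m} {F : ℕ → Euc m → Euc p} {Q : ℕ → Set Y} {t' : ℕ → Set (Euc m)}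
  {σ : ℕ → Euc p → Euc m}

/-- The map `x ↦ (f(x), im ap Df(x))`. -/
theorem aemeasurable_prodMk (h : IsAdaptedSum f μ c P t ψ ρ F Q t' σ) (hX : IsOpen X)
    [IsLocallyFiniteMeasure μ] (hf : Continuous f) (T₀ : Grassmannian p m) :
    AEMeasurable (fun x => (f x, imagePlane T₀ μ f x)) μ :=
  hf.measurable.aemeasurable.prodMk (h.aemeasurable_imagePlane hX T₀)

/-- Both measures of `B` are sums over `j`; in each chart the change of variables is applied to the
indicator of `B` expressed in parameters, the plane being the range of `D(F j)` on both sides. -/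
theorem chartVarifold_eq_map (h : IsAdaptedSum f μ c P t ψ ρ F Q t' σ) (hX : IsOpen X)
    (hY : IsOpen Y) [IsLocallyFiniteMeasure μ] (hf : Continuous f) (T₀ : Grassmannian p m) :
    chartVarifold T₀ c Q F σ =
      (jacobianMeasure m μ f).map fun x => (f x, imagePlane T₀ μ f x) := by
  classical
  have := hX.locallyCompactSpace
  have hΦ := h.aemeasurable_prodMk hX hf T₀
  ext B hB
  have hι : MeasurableEmbedding fun z : Y × Grassmannian p m => ((z.1 : Euc p), z.2) :=
    (MeasurableEmbedding.subtype_coe hY.measurableSet).prodMap MeasurableEmbedding.id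
  -- Outside the parameter set `t' j`, the map `F j` may leave `Y`; the indicator is therefore
  -- formed in `ℝᵖ × G(p,m)`.
  set B' := (fun z : Y × Grassmannian p m => ((z.1 : Euc p), z.2)) '' B
  have hB' : MeasurableSet B' := hι.measurableSet_image.2 hB
  have hBB' : ∀ (y : Y) (T : Grassmannian p m), ((y : Euc p), T) ∈ B' ↔ (y, T) ∈ B := fun y T =>
    hι.injective.mem_set_image (a := (y, T))
  rw [Measure.map_apply_of_aemeasurable (hΦ.mono_ac (jacobianMeasure_absolutelyContinuous m μ f)) hB,
    jacobianMeasure, withDensity_apply', ← lintegral_indicator₀ (hΦ.nullMeasurableSet_preimage hB),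
    h.isChartSum.lintegral_eq]
  have hsum : IsChartSum (Measure.sum fun j => ENNReal.ofReal (c j) •
    (hausdorff m : Measure Y).restrict (Q j)) c Q t' F σ :=
    ⟨h.isChart_image, h.isChartSum.pos, rfl⟩
  rw [hsum.chartVarifold_apply T₀ hB]
  refine tsum_congr fun j => ?_
  congr 1
  set g : Euc m → ℝ≥0∞ := fun u => B'.indicator 1 (F j u, rangePlane T₀ (fderiv ℝ (F j) u))
  have hg : Measurable g := by
    refine (measurable_one.indicator hB').comp ?_
    exact ((h.isChart_image j).continuous.measurable).prodMk
      ((measurable_rangePlane T₀).comp (measurable_fderiv ℝ (F j)))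
  have h1 : ∫⁻ x in P j, ((fun x => (f x, imagePlane T₀ μ f x)) ⁻¹' B).indicator
      (fun x => ENNReal.ofReal (apJacobian μ m (ambient f) x)) x ∂hausdorff m =
      ∫⁻ x : X in P j, ENNReal.ofReal (apJacobian μ m (ambient f) x) * g (ρ j x) ∂hausdorff m := by
    refine lintegral_congr_ae ?_
    filter_upwards [h.ae_imagePlane_eq hX T₀ j,
      ae_restrict_mem (h.isChartSum.isChart j).measurableSet] with x hx hxP
    simp only [g, ← h.eq_map j x hxP, ← hx]
    by_cases hxB : (f x, imagePlane T₀ μ f x) ∈ B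
    · rw [indicator_of_mem ((hBB' _ _).2 hxB), indicator_of_mem (by exact hxB), Pi.one_apply, mul_one]
    · rw [indicator_of_notMem (mt (hBB' _ _).1 hxB), indicator_of_notMem (by exact hxB), mul_zero]
  rw [h1, h.lintegral_apJacobian_mul hX j hg]
  have hm := hsum.measurable_graph T₀ j hB
  have h2 : ∫⁻ y : Y in Q j, g (σ j y) ∂hausdorff m = ∫⁻ y : Y in Q j,
      ((fun y : Y => (y, chartPlane T₀ (F j) (σ j) y)) ⁻¹' B).indicator 1 y ∂hausdorff m := by
    refine setLIntegral_congr_fun (h.isChart_image j).measurableSet fun y hy => ?_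
    simp only [g, ((h.isChart_image j).inv_mem hy).2]
    by_cases hyB : (y, chartPlane T₀ (F j) (σ j) y) ∈ B
    · rw [indicator_of_mem (by exact (hBB' _ _).2 hyB), indicator_of_mem (by exact hyB)]
      rfl
    · rw [indicator_of_notMem (by exact mt (hBB' _ _).1 hyB), indicator_of_notMem (by exact hyB)]
  rw [h2, lintegral_indicator_one hm, Measure.restrict_apply hm, inter_comm]
  rfl

theorem weight_chartVarifold_image (h : IsAdaptedSum f μ c P t ψ ρ F Q t' σ) (hX : IsOpen X)
    (hY : IsOpen Y) [IsLocallyFiniteMeasure μ] (hf : Continuous f) (T₀ : Grassmannian p m) :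
    weight (chartVarifold T₀ c Q F σ) = (jacobianMeasure m μ f).map f := by
  rw [weight, h.chartVarifold_eq_map hX hY hf T₀, AEMeasurable.map_map_of_aemeasurable
    measurable_fst.aemeasurable ((h.aemeasurable_prodMk hX hf T₀).mono_ac
      (jacobianMeasure_absolutelyContinuous m μ f))]
  rfl

/-- The change of variables bounds the contribution of a chart by `Hᵐ(f[P j ∩ U])`, hence by `Kᵐ
Hᵐ(P j ∩ U)`. No pointwise bound of the approximate Jacobian is required. -/
theorem jacobianMeasure_le (h : IsAdaptedSum f μ c P t ψ ρ F Q t' σ) (hX : IsOpen X)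
    [IsLocallyFiniteMeasure μ] {U : Set X} (hU : MeasurableSet U) {K : NNReal}
    (hK : LipschitzOnWith K f U) : jacobianMeasure m μ f U ≤ (K : ℝ≥0∞) ^ m * μ U := by
  classical
  rw [jacobianMeasure, withDensity_apply _ hU, ← lintegral_indicator hU, h.isChartSum.lintegral_eq]
  have hμU : μ U = ∑' j, ENNReal.ofReal (c j) * hausdorff m (P j ∩ U) := by
    conv_lhs => rw [h.isChartSum.eq_sum]
    rw [Measure.sum_apply _ hU]
    refine tsum_congr fun j => ?_
    rw [Measure.smul_apply, smul_eq_mul, Measure.restrict_apply hU, inter_comm]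
  rw [hμU, ← ENNReal.tsum_mul_left]
  refine ENNReal.tsum_le_tsum fun j => ?_
  rw [mul_left_comm]
  refine mul_le_mul_right ?_ _
  have hch := h.isChartSum.isChart j
  have hU' : MeasurableSet (Subtype.val '' U : Set (Euc n)) :=
    (MeasurableEmbedding.subtype_coe hX.measurableSet).measurableSet_image.2 hU
  set g : Euc m → ℝ≥0∞ := fun u => (Subtype.val '' U : Set (Euc n)).indicator 1 (ψ j u)
  have hg : Measurable g := (measurable_one.indicator hU').comp hch.continuous.measurable
  have h1 : ∫⁻ x in P j, U.indicator
      (fun x => ENNReal.ofReal (apJacobian μ m (ambient f) x)) x ∂hausdorff m =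
      ∫⁻ x : X in P j, ENNReal.ofReal (apJacobian μ m (ambient f) x) * g (ρ j x) ∂hausdorff m := by
    refine setLIntegral_congr_fun hch.measurableSet fun x hxP => ?_
    simp only [g, (hch.inv_mem hxP).2]
    by_cases hxU : x ∈ U
    · rw [indicator_of_mem hxU, indicator_of_mem (mem_image_of_mem _ hxU), Pi.one_apply, mul_one]
    · rw [indicator_of_notMem hxU,
        indicator_of_notMem (mt Subtype.val_injective.mem_set_image.1 hxU), mul_zero]
  rw [h1, h.lintegral_apJacobian_mul hX j hg]
  refine le_trans ?_ ((hK.mono inter_subset_right).hausdorff_image_le m (s := P j ∩ U))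
  have hm : MeasurableSet {y : Y | ψ j (σ j y) ∈ (Subtype.val '' U : Set (Euc n))} :=
    (hch.continuous.measurable.comp (h.isChart_image j).measurable_inv_coe) hU'
  have h2 : ∫⁻ y : Y in Q j, g (σ j y) ∂hausdorff m = ∫⁻ y : Y in Q j,
      {y : Y | ψ j (σ j y) ∈ (Subtype.val '' U : Set (Euc n))}.indicator 1 y ∂hausdorff m := rfl
  rw [h2, lintegral_indicator_one hm, Measure.restrict_apply hm]
  refine measure_mono ?_
  rintro y ⟨⟨x, hxU, hx⟩, hy⟩
  rcases h.dichotomy j with ⟨hQ, -⟩ | ⟨hQ, -⟩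
  · rw [hQ] at hy
    obtain ⟨x', hx', rfl⟩ := hy
    have hσ : σ j (f x') = ρ j x' := by
      rw [h.eq_map j x' hx', (h.isChart_image j).left_inv]
      rcases h.dichotomy j with ⟨-, ht⟩ | ⟨hQ', -⟩
      · rw [ht]
        exact (hch.inv_mem hx').1
      · rw [hQ', eq_comm, image_eq_empty] at hQ
        rw [hQ] at hx'
        exact hx'.elim
    rw [hσ, (hch.inv_mem hx').2] at hx
    rw [← Subtype.ext hx]
    refine mem_image_of_mem f ⟨?_, hxU⟩
    rwa [Subtype.ext hx]
  · rw [hQ] at hy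
    exact hy.elim

theorem isLocallyFiniteMeasure_jacobianMeasure (h : IsAdaptedSum f μ c P t ψ ρ F Q t' σ)
    (hX : IsOpen X) [IsLocallyFiniteMeasure μ] (hf : LocallyLipschitz f) :
    IsLocallyFiniteMeasure (jacobianMeasure m μ f) := by
  refine ⟨fun x => ?_⟩
  obtain ⟨K, U, hU, hK⟩ := hf x
  obtain ⟨U', hU', hfin⟩ := μ.finiteAt_nhds x
  obtain ⟨O, hO, hOo, hxO⟩ := mem_nhds_iff.1 (inter_mem hU hU')
  refine ⟨O, hOo.mem_nhds hxO, ?_⟩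
  refine (h.jacobianMeasure_le hX hOo.measurableSet
    (hK.mono (hO.trans inter_subset_left))).trans_lt ?_
  exact ENNReal.mul_lt_top (by finiteness) ((measure_mono (hO.trans inter_subset_right)).trans_lt hfin)

end IsAdaptedSum

/-- Push forward of a measure by a map that is proper on the support of a dominating measure. -/
theorem isFiniteMeasureOnCompacts_map_of_isProperMap {Z Z' : Type*} [TopologicalSpace Z] [HereditarilyLindelofSpace Z]
    [MeasurableSpace Z] [BorelSpace Z] [TopologicalSpace Z'] [T2Space Z'] [MeasurableSpace Z']
    [BorelSpace Z'] {μ κ : Measure Z} [IsFiniteMeasureOnCompacts κ] (hκ : κ ≪ μ) {f : Z → Z'}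
    (hf : Continuous f) (hprop : IsProperMap fun x : μ.support => f x) :
    IsFiniteMeasureOnCompacts (κ.map f) := by
  refine ⟨fun K hK => ?_⟩
  rw [Measure.map_apply hf.measurable hK.measurableSet]
  have h1 := (hprop.isCompact_preimage hK).image continuous_subtype_val
  refine (measure_mono (t := Subtype.val '' ((fun x : μ.support => f x) ⁻¹' K) ∪ μ.supportᶜ)
    ?_).trans_lt ((measure_union_le _ _).trans_lt ?_)
  · intro x hx
    by_cases hxs : x ∈ μ.support
    · exact Or.inl ⟨⟨x, hxs⟩, hx, rfl⟩
    · exact Or.inr hxs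
  · rw [hκ Measure.measure_compl_support, add_zero]
    exact h1.measure_lt_top

/-- Up to a null set, a measurable set is a countable union of compact sets. -/
theorem MeasurableSet.exists_iUnion_isCompact {Z : Type*} [TopologicalSpace Z] [T2Space Z]
    [SigmaCompactSpace Z] [MeasurableSpace Z] [BorelSpace Z] {κ : Measure Z} [κ.Regular] {A : Set Z}
    (hA : MeasurableSet A) : ∃ K : ℕ → ℕ → Set Z, (∀ i j, IsCompact (K i j)) ∧ (∀ i j, K i j ⊆ A) ∧
      κ (A \ ⋃ i, ⋃ j, K i j) = 0 := by
  have h1 : ∀ i j : ℕ, ∃ K ⊆ A ∩ compactCovering Z i, IsCompact K ∧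
      κ ((A ∩ compactCovering Z i) \ K) < ((j : ℝ≥0∞) + 1)⁻¹ := by
    intro i j
    refine (hA.inter (isCompact_compactCovering Z i).measurableSet).exists_isCompact_sdiff_lt ?_
      (by simp)
    exact ((measure_mono inter_subset_right).trans_lt
      (isCompact_compactCovering Z i).measure_lt_top).ne
  choose K hKA hK hlt using h1
  refine ⟨K, hK, fun i j => (hKA i j).trans inter_subset_left, ?_⟩
  refine measure_mono_null (t := ⋃ i, ((A ∩ compactCovering Z i) \ ⋃ j, K i j)) ?_
    (measure_iUnion_null fun i => ?_)
  · rintro x ⟨hxA, hx⟩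
    obtain ⟨i, hi⟩ := mem_iUnion.1 ((iUnion_compactCovering Z).ge (mem_univ x))
    exact mem_iUnion.2 ⟨i, ⟨hxA, hi⟩, fun h => hx (mem_iUnion.2 ⟨i, h⟩)⟩
  · by_contra h0
    obtain ⟨j, hj⟩ := ENNReal.exists_inv_nat_lt h0
    refine absurd ((measure_mono (sdiff_subset_sdiff_right (subset_iUnion _ j))).trans
      (hlt i j).le) (not_le.2 (lt_of_le_of_lt ?_ hj))
    exact ENNReal.inv_le_inv.2 le_self_add

/-- Regular Borel measures are pushed forward as outer measures. -/
theorem map_apply_of_regular {Z Z' : Type*} [TopologicalSpace Z] [T2Space Z]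
    [SigmaCompactSpace Z] [MeasurableSpace Z] [BorelSpace Z] [TopologicalSpace Z'] [T2Space Z']
    [MeasurableSpace Z'] [BorelSpace Z'] (κ : Measure Z) [κ.Regular] {f : Z → Z'}
    (hf : Continuous f) (B : Set Z') : κ.map f B = κ (f ⁻¹' B) := by
  refine le_antisymm ?_ (le_map_apply hf.measurable.aemeasurable B)
  obtain ⟨C, hBC, hCm, hC⟩ := exists_measurable_superset κ (f ⁻¹' B)
  obtain ⟨K, hK, hKC, h0⟩ := hCm.compl.exists_iUnion_isCompact (κ := κ)
  -- The compact sets exhaust the complement of a Borel hull `C` of the preimage of `B`, up to a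
  -- null set. Their images are compact and miss `B`, so `D` is a Borel set containing `B` whose
  -- preimage exceeds `C` by a null set only.
  set D := (⋃ i, ⋃ j, f '' K i j)ᶜ
  have hD : MeasurableSet D := (MeasurableSet.iUnion fun i => MeasurableSet.iUnion fun j =>
    ((hK i j).image hf).measurableSet).compl
  have hBD : B ⊆ D := by
    intro y hy hyK
    obtain ⟨i, hi⟩ := mem_iUnion.1 hyK
    obtain ⟨j, x, hx, rfl⟩ := mem_iUnion.1 hi
    exact hKC i j hx (hBC hy)
  calc κ.map f B ≤ κ.map f D := measure_mono hBD
    _ = κ (f ⁻¹' D) := Measure.map_apply hf.measurable hD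
    _ ≤ κ (C ∪ (Cᶜ \ ⋃ i, ⋃ j, K i j)) := by
      refine measure_mono fun x hx => ?_
      by_cases hxC : x ∈ C
      · exact Or.inl hxC
      · refine Or.inr ⟨hxC, fun hxK => hx ?_⟩
        obtain ⟨i, hi⟩ := mem_iUnion.1 hxK
        obtain ⟨j, hj⟩ := mem_iUnion.1 hi
        exact mem_iUnion.2 ⟨i, mem_iUnion.2 ⟨j, x, hj, rfl⟩⟩
    _ ≤ κ C + 0 := h0 ▸ measure_union_le _ _
    _ = κ (f ⁻¹' B) := by rw [add_zero, hC]

end AdaptedSum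

/-! ### Fibres -/

/-- The bad values `y` form the image of the exceptional null set, which is null. -/
theorem LocallyLipschitz.ae_forall_fiber {Z Z' : Type*} [EMetricSpace Z] [MeasurableSpace Z]
    [BorelSpace Z] [SecondCountableTopology Z] [EMetricSpace Z'] [MeasurableSpace Z']
    [BorelSpace Z'] {f : Z → Z'} (hf : LocallyLipschitz f) {m : ℕ} {q : Z → Prop}
    (h : ∀ᵐ x ∂(hausdorff m : Measure Z), q x) :
    ∀ᵐ y ∂(hausdorff m : Measure Z'), ∀ x, f x = y → q x := by
  rw [ae_iff] at h ⊢
  refine measure_mono_null ?_ (hf.hausdorff_image_null h)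
  intro y hy
  simp only [mem_ofPred_eq, not_forall] at hy
  obtain ⟨x, hxy, hx⟩ := hy
  exact ⟨x, hx, hxy⟩

section Chain

variable {m n p q : ℕ} {X : Set (Euc n)} {Y : Set (Euc p)} {f : X → Y} {μ : Measure X}
  {ν : Measure Y} {P : Set X} {t t' : Set (Euc m)} {ψ : Euc m → Euc n} {ρ : Euc n → Euc m}
  {Q : Set Y} {F : Euc m → Euc p} {σ : Euc p → Euc m} {x : X} {y : Y} {c c' : ℝ≥0∞}

/-- Both planes are the range of `DF(ρ x)`, because `F` parametrises the image chart and represents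
`f`. -/
theorem IsRegularPoint.apImage_eq_apTan (hx : IsRegularPoint μ P t ψ ρ x) (hP : IsChart P t ψ ρ)
    (hc : c ≠ 0) (hμ : c • (hausdorff m : Measure X).restrict P ≤ μ)
    (hy : IsRegularPoint ν Q t' F σ y) (hQ : IsChart Q t' F σ) (hc' : c' ≠ 0)
    (hν : c' • (hausdorff m : Measure Y).restrict Q ≤ ν)
    (hf : ∀ x ∈ P, (f x : Euc p) = F (ρ x)) (hxy : σ y = ρ x) :
    ((apImage μ m (ambient f) x : Submodule ℝ (Euc p)) : Set (Euc p)) = apTan ν m y ∧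
      Module.finrank ℝ (apImage μ m (ambient f) x) = m := by
  have h1 := hx.apImage_eq hP hc hμ hf (hxy ▸ hy.differentiableAt)
  have h2 := hy.finrank_range
  rw [hy.apTan_eq hQ hc' hν, h1]
  rw [hxy] at h2 ⊢
  exact ⟨rfl, h2⟩

/-- The chain rule in charts. -/
theorem IsRegularPoint.apDeriv_comp (hx : IsRegularPoint μ P t ψ ρ x) (hP : IsChart P t ψ ρ)
    (hc : c ≠ 0) (hμ : c • (hausdorff m : Measure X).restrict P ≤ μ)
    (hy : IsRegularPoint ν Q t' F σ y) (hQ : IsChart Q t' F σ) (hc' : c' ≠ 0)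
    (hν : c' • (hausdorff m : Measure Y).restrict Q ≤ ν)
    (hf : ∀ x ∈ P, (f x : Euc p) = F (ρ x)) (hxy : σ y = ρ x) {g : Y → Euc q} {G : Euc m → Euc q}
    (hg : ∀ y ∈ Q, g y = G (σ y)) (hgf : ∀ x ∈ P, (g ∘ f) x = G (ρ x))
    (hG : DifferentiableAt ℝ G (ρ x)) :
    ApDifferentiableAt ν m g y ∧ ApDifferentiableAt μ m (g ∘ f) x ∧
      ∀ v : apTanSpan μ m x, ∃ h : apDeriv μ m (ambient f) x v ∈ apTanSpan ν m y,
        apDeriv μ m (g ∘ f) x v = apDeriv ν m g y ⟨apDeriv μ m (ambient f) x v, h⟩ := by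
  have hG' : DifferentiableAt ℝ G (σ y) := hxy ▸ hG
  have hF : DifferentiableAt ℝ F (ρ x) := hxy ▸ hy.differentiableAt
  refine ⟨hy.apDifferentiableAt hQ hg hG', hx.apDifferentiableAt hP hgf hG, ?_⟩
  rintro ⟨v, hv⟩
  obtain ⟨w, rfl⟩ : v ∈ LinearMap.range (fderiv ℝ ψ (ρ x) : Euc m →ₗ[ℝ] Euc n) :=
    hx.apTanSpan_eq hP hc hμ ▸ hv
  have h1 : apDeriv μ m (ambient f) x ⟨fderiv ℝ ψ (ρ x) w, hv⟩ = fderiv ℝ F (σ y) w := by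
    rw [hxy]
    exact hx.apDeriv_apply hP hf hF w hv
  have h2 := hy.fderiv_mem hQ hc' hν w
  refine ⟨h1 ▸ h2, ?_⟩
  have h3 : apDeriv μ m (g ∘ f) x ⟨fderiv ℝ ψ (ρ x) w, hv⟩ = fderiv ℝ G (ρ x) w :=
    hx.apDeriv_apply hP hgf hG w hv
  have h4 := hy.apDeriv_apply hQ hg hG' w h2
  refine h3.trans ((show fderiv ℝ G (ρ x) w = fderiv ℝ G (σ y) w by rw [hxy]).trans
    (h4.symm.trans ?_))
  congr 1
  exact Subtype.ext h1.symm

end Chain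

/-! ### Densities, tangent planes and the chain rule on almost every fibre. -/

namespace IsAdaptedSum

variable {m n p : ℕ} {X : Set (Euc n)} {Y : Set (Euc p)} {f : X → Y} {μ : Measure X} {c : ℕ → ℝ}
  {P : ℕ → Set X} {t : ℕ → Set (Euc m)} {ψ : ℕ → Euc m → Euc n} {ρ : ℕ → Euc n → Euc m}
  {F : ℕ → Euc m → Euc p} {Q : ℕ → Set Y} {t' : ℕ → Set (Euc m)} {σ : ℕ → Euc p → Euc m}

theorem map_mem (h : IsAdaptedSum f μ c P t ψ ρ F Q t' σ) {j : ℕ}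
    (hj : Q j = f '' P j ∧ t' j = t j) {x : X} (hx : x ∈ P j) :
    f x ∈ Q j ∧ σ j (f x) = ρ j x := by
  refine ⟨hj.1 ▸ mem_image_of_mem f hx, ?_⟩
  rw [h.eq_map j x hx, (h.isChart_image j).left_inv]
  rw [hj.2]
  exact ((h.isChartSum.isChart j).inv_mem hx).1

/-- Almost all points of the image lie only on images of nondegenerate charts. -/
theorem ae_nondegenerate (h : IsAdaptedSum f μ c P t ψ ρ F Q t' σ) :
    ∀ᵐ y ∂(hausdorff m : Measure Y), ∀ j, ∀ x ∈ P j, f x = y →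
      Q j = f '' P j ∧ t' j = t j := by
  refine ae_all_iff.2 fun j => ?_
  rcases h.dichotomy j with h1 | ⟨-, -, h1⟩
  · exact Eventually.of_forall fun _ _ _ _ => h1
  · obtain ⟨K, hK⟩ := h.lipschitz_map j
    rw [ae_iff, ← hausdorff_image_val]
    refine measure_mono_null ?_ hK.hausdorff_image_not_injective
    -- Values taken on a degenerate chart are critical values of `F j`, null by Sard's lemma.
    rintro _ ⟨y, hy, rfl⟩
    simp only [mem_ofPred_eq, not_forall] at hy
    obtain ⟨x, hx, rfl, -⟩ := hy
    exact ⟨ρ j x, h1 _ ((h.isChartSum.isChart j).inv_mem hx).1, (h.eq_map j x hx).symm⟩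

/-- In the nondegenerate case `f` maps `P j` bijectively onto `Q j`, so the fibre meets `P j` in one
point or in none according to whether `y` lies in `Q j`. -/
theorem tsum_indicator_fiber (h : IsAdaptedSum f μ c P t ψ ρ F Q t' σ) {y : Y} {j : ℕ}
    (hy : ∀ x ∈ P j, f x = y → Q j = f '' P j ∧ t' j = t j) (κ : ℝ≥0∞) :
    ∑' x : f ⁻¹' {y}, (P j).indicator (fun _ => κ) (x : X) = (Q j).indicator (fun _ => κ) y := by
  have hQ : y ∈ Q j → ∃ x ∈ P j, f x = y := by
    intro hyQ
    rcases h.dichotomy j with ⟨h1, -⟩ | ⟨h1, -⟩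
    · rwa [h1] at hyQ
    · rw [h1] at hyQ
      exact hyQ.elim
  by_cases hyQ : y ∈ Q j
  · obtain ⟨x, hx, hxy⟩ := hQ hyQ
    rw [indicator_of_mem hyQ, tsum_eq_single (⟨x, hxy⟩ : f ⁻¹' {y}), indicator_of_mem hx]
    rintro ⟨x', hx'y⟩ hne
    refine indicator_of_notMem (fun hx' => hne (Subtype.ext ?_)) _
    have hj := hy x hx hxy
    have h1 := (h.map_mem hj hx).2
    have h2 := (h.map_mem hj hx').2
    rw [hxy] at h1
    rw [show f x' = y from hx'y, h1] at h2
    have hch := h.isChartSum.isChart j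
    exact Subtype.ext ((hch.inv_mem hx').2.symm.trans ((h2 ▸ (hch.inv_mem hx).2)))
  · rw [indicator_of_notMem hyQ, ENNReal.tsum_eq_zero]
    rintro ⟨x, hxy⟩
    refine indicator_of_notMem (fun hx => hyQ ?_) _
    have := (h.map_mem (hy x hx hxy) hx).1
    rwa [show f x = y from hxy] at this

/-- Both densities are `hausdorffConst m` times a multiplicity function. Interchanging the sums over
the fibre and over `j` reduces the identity to a count of points in each chart. -/
theorem ae_density (h : IsAdaptedSum f μ c P t ψ ρ F Q t' σ) [IsLocallyFiniteMeasure μ]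
    {ν : Measure Y} [IsLocallyFiniteMeasure ν] (hν : IsChartSum ν c Q t' F σ)
    (hf : LocallyLipschitz f) :
    ∀ᵐ y ∂(hausdorff m : Measure Y),
      (∀ x : X, f x = y → HasDensity μ m x (density μ m x)) ∧
      HasDensity ν m y (density ν m y) ∧
      density ν m y = ∑' x : f ⁻¹' {y}, density μ m (x : X) := by
  filter_upwards [hf.ae_forall_fiber h.isChartSum.ae_hasDensity, hν.ae_hasDensity,
    h.ae_nondegenerate] with y h1 h2 h3
  refine ⟨fun x hx => ?_, ?_, ?_⟩
  · rw [(h1 x hx).density_eq]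
    exact h1 x hx
  · rw [h2.density_eq]
    exact h2
  · rw [h2.density_eq]
    have h4 : ∀ x : f ⁻¹' {y}, density μ m (x : X) = ∑' j, ENNReal.ofReal (c j) *
        (P j).indicator (fun _ => hausdorffConst m) (x : X) := fun x => (h1 x x.2).density_eq
    rw [tsum_congr h4, ENNReal.tsum_comm]
    refine tsum_congr fun j => ?_
    rw [ENNReal.tsum_mul_left, h.tsum_indicator_fiber (h3 j)]

/-- Points of positive density lie on charts. -/
theorem ae_exists_mem (h : IsAdaptedSum f μ c P t ψ ρ F Q t' σ) [IsLocallyFiniteMeasure μ]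
    (hf : LocallyLipschitz f) :
    ∀ᵐ y ∂(hausdorff m : Measure Y), ∀ x : X, f x = y → 0 < density μ m x →
      ∃ j, x ∈ P j ∧ (Q j = f '' P j ∧ t' j = t j) := by
  filter_upwards [hf.ae_forall_fiber h.isChartSum.ae_hasDensity, h.ae_nondegenerate]
    with y h1 h2 x hx hpos
  rw [(h1 x hx).density_eq, pos_iff_ne_zero, Ne, ENNReal.tsum_eq_zero, not_forall] at hpos
  obtain ⟨j, hj⟩ := hpos
  have hxP : x ∈ P j := by
    by_contra hxP
    exact hj (by rw [indicator_of_notMem hxP, mul_zero])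
  exact ⟨j, hxP, h2 j x hxP hx⟩

theorem ae_apImage_eq_apTan (h : IsAdaptedSum f μ c P t ψ ρ F Q t' σ) (hX : IsOpen X)
    (hY : IsOpen Y) [IsLocallyFiniteMeasure μ] {ν : Measure Y} [IsLocallyFiniteMeasure ν]
    (hν : IsChartSum ν c Q t' F σ) (hf : LocallyLipschitz f) :
    ∀ᵐ y ∂(hausdorff m : Measure Y), ∀ x : X, f x = y → 0 < density μ m x →
      ApDifferentiableAt μ m (ambient f) x ∧
      (∃ S : Submodule ℝ (Euc n), Module.finrank ℝ S = m ∧ apTan μ m x = S) ∧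
      ((apImage μ m (ambient f) x : Submodule ℝ (Euc p)) : Set (Euc p)) = apTan ν m y ∧
      Module.finrank ℝ (apImage μ m (ambient f) x) = m := by
  filter_upwards [hf.ae_forall_fiber (h.ae_regular hX), hν.ae_isRegularPoint hY,
    h.ae_exists_mem hf] with y h1 h2 h3 x hx hpos
  obtain ⟨j, hxP, hj⟩ := h3 x hx hpos
  obtain ⟨hxr, hxF⟩ := h1 x hx j hxP
  obtain ⟨hyQ, hσ⟩ := h.map_mem hj hxP
  rw [hx] at hyQ hσ
  have hs := h.isChartSum
  exact ⟨hxr.apDifferentiableAt (hs.isChart j) (h.eq_map j) hxF,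
    ⟨_, hxr.finrank_range, hxr.apTan_eq (hs.isChart j) (hs.coeff_ne_zero j) (hs.le j)⟩,
    hxr.apImage_eq_apTan (hs.isChart j) (hs.coeff_ne_zero j) (hs.le j) (h2 j hyQ) (hν.isChart j)
      (hν.coeff_ne_zero j) (hν.le j) (h.eq_map j) hσ⟩

/-- The composition `g ∘ F j` need not be defined off `t' j`. Hence `Q j` is cut into countably many
pieces on which `g` is `G ∘ σ j` with `G` Lipschitzian on `ℝᵐ`; the same parameter sets cut `P j`,
and there `g ∘ f = G ∘ ρ j`. -/
theorem ae_apDeriv_comp (h : IsAdaptedSum f μ c P t ψ ρ F Q t' σ) (hX : IsOpen X)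
    (hY : IsOpen Y) [IsLocallyFiniteMeasure μ] {ν : Measure Y} [IsLocallyFiniteMeasure ν]
    (hν : IsChartSum ν c Q t' F σ) (hf : LocallyLipschitz f) {q : ℕ} {g : Y → Euc q}
    (hg : LocallyLipschitz g) :
    ∀ᵐ y ∂(hausdorff m : Measure Y), ∀ x : X, f x = y → 0 < density μ m x →
      ApDifferentiableAt ν m g y ∧ ApDifferentiableAt μ m (g ∘ f) x ∧
      ∀ v : apTanSpan μ m x, ∃ h : apDeriv μ m (ambient f) x v ∈ apTanSpan ν m y,
        apDeriv μ m (g ∘ f) x v = apDeriv ν m g y ⟨apDeriv μ m (ambient f) x v, h⟩ := by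
  have := hX.locallyCompactSpace
  have := hY.locallyCompactSpace
  have hs := h.isChartSum
  have h0 := fun j => (hν.isChart j).exists_lipschitz_pieces hg hY
  choose ι _ s G hsm hG hgG hcov using h0
  have h1 : ∀ᵐ x : X ∂(hausdorff m : Measure X), ∀ j, ∀ z : ι j,
      x ∈ {x : X | x ∈ P j ∧ ρ j x ∈ s j z} →
      IsRegularPoint μ {x : X | x ∈ P j ∧ ρ j x ∈ s j z} (t j ∩ s j z) (ψ j) (ρ j) x ∧
        DifferentiableAt ℝ (G j z) (ρ j x) := by
    refine ae_all_iff.2 fun j => ae_all_iff.2 fun z => ?_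
    have hch := (hs.isChart j).restrict (hsm j z)
    rw [← ae_restrict_iff' hch.measurableSet]
    obtain ⟨K, hK⟩ := hG j z
    exact (hch.ae_isRegularPoint μ inferInstance).and
      (hch.ae_of_ae_dom (ae_restrict_of_ae hK.ae_differentiableAt))
  have h2 : ∀ᵐ y : Y ∂(hausdorff m : Measure Y), ∀ j, ∀ z : ι j,
      y ∈ {y : Y | y ∈ Q j ∧ σ j y ∈ s j z} →
      IsRegularPoint ν {y : Y | y ∈ Q j ∧ σ j y ∈ s j z} (t' j ∩ s j z) (F j) (σ j) y := by
    refine ae_all_iff.2 fun j => ae_all_iff.2 fun z => ?_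
    have hch := (hν.isChart j).restrict (hsm j z)
    rw [← ae_restrict_iff' hch.measurableSet]
    exact hch.ae_isRegularPoint ν inferInstance
  filter_upwards [hf.ae_forall_fiber h1, h2, h.ae_exists_mem hf] with y h3 h4 h5 x hx hpos
  obtain ⟨j, hxP, hj⟩ := h5 x hx hpos
  obtain ⟨hyQ, hσ⟩ := h.map_mem hj hxP
  rw [hx] at hyQ hσ
  obtain ⟨z, hz⟩ := hcov j y hyQ
  obtain ⟨hxr, hxG⟩ := h3 x hx j z ⟨hxP, hσ ▸ hz⟩
  have hyr := h4 j z ⟨hyQ, hz⟩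
  have hμ : ENNReal.ofReal (c j) • (hausdorff m : Measure X).restrict
      {x : X | x ∈ P j ∧ ρ j x ∈ s j z} ≤ μ := by
    refine le_trans ?_ (hs.le j)
    gcongr
    exact fun x hx => hx.1
  have hν' : ENNReal.ofReal (c j) • (hausdorff m : Measure Y).restrict
      {y : Y | y ∈ Q j ∧ σ j y ∈ s j z} ≤ ν := by
    refine le_trans ?_ (hν.le j)
    gcongr
    exact fun x hx => hx.1
  refine hxr.apDeriv_comp ((hs.isChart j).restrict (hsm j z)) (hs.coeff_ne_zero j) hμ hyr
    ((hν.isChart j).restrict (hsm j z)) (hν.coeff_ne_zero j) hν' (fun x hx => h.eq_map j x hx.1) hσ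
    (fun y hy => hgG j z y hy.1 hy.2) (fun x hx => ?_) hxG
  obtain ⟨h6, h7⟩ := h.map_mem hj hx.1
  rw [Function.comp_apply, hgG j z (f x) h6 (h7 ▸ hx.2), h7]

end IsAdaptedSum

/-! ### The push forward varifold -/

section PushForward

variable {m n p : ℕ} {X : Set (Euc n)} {Y : Set (Euc p)} {f : X → Y} {μ : Measure X}

namespace IsAdaptedSum

variable {c : ℕ → ℝ} {P : ℕ → Set X} {t : ℕ → Set (Euc m)} {ψ : ℕ → Euc m → Euc n}
  {ρ : ℕ → Euc n → Euc m} {F : ℕ → Euc m → Euc p} {Q : ℕ → Set Y} {t' : ℕ → Set (Euc m)}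
  {σ : ℕ → Euc p → Euc m}

theorem ae_apDifferentiableAt (h : IsAdaptedSum f μ c P t ψ ρ F Q t' σ) (hX : IsOpen X)
    [IsLocallyFiniteMeasure μ] :
    ∀ᵐ x ∂μ, ApDifferentiableAt μ m (ambient f) x ∧
      (∃ S : Submodule ℝ (Euc n), Module.finrank ℝ S = m ∧ apTan μ m x = S) ∧
      (0 < apJacobian μ m (ambient f) x → Module.finrank ℝ (apImage μ m (ambient f) x) = m) := by
  have hs := h.isChartSum
  refine hs.ae_iff.2 fun j => ?_
  rw [ae_restrict_iff' (hs.isChart j).measurableSet]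
  filter_upwards [h.ae_regular hX] with x hx hxP
  obtain ⟨hxr, hxF⟩ := hx j hxP
  refine ⟨hxr.apDifferentiableAt (hs.isChart j) (h.eq_map j) hxF,
    ⟨_, hxr.finrank_range, hxr.apTan_eq (hs.isChart j) (hs.coeff_ne_zero j) (hs.le j)⟩,
    fun hpos => ?_⟩
  have h1 := hxr.apJacobian_eq (hs.isChart j) (hs.coeff_ne_zero j) (hs.le j) (h.eq_map j) hxF
  have h2 : Function.Injective (fderiv ℝ (F j) (ρ j x)) := by
    rw [← jacobian_pos_iff, ← h1]
    exact mul_pos hpos (jacobian_pos_iff.2 hxr.injective)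
  rw [hxr.apImage_eq (hs.isChart j) (hs.coeff_ne_zero j) (hs.le j) (h.eq_map j) hxF,
    LinearMap.finrank_range_of_inj h2, finrank_euclideanSpace_fin]

/-- Where the Jacobian vanishes both sides are zero, and elsewhere the image has dimension `m`
almost everywhere, so neither default value is visible. -/
theorem ae_pushIntegrand_eq (h : IsAdaptedSum f μ c P t ψ ρ F Q t' σ) (hX : IsOpen X)
    [IsLocallyFiniteMeasure μ] (T₀ : Grassmannian p m) (k : Y × Grassmannian p m → ℝ) :
    ∀ᵐ x ∂μ, (posJacobianSet μ m f).indicator (pushIntegrand μ f k) x =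
      (ENNReal.ofReal (apJacobian μ m (ambient f) x)).toReal • k (f x, imagePlane T₀ μ f x) := by
  filter_upwards [h.ae_apDifferentiableAt hX] with x hx
  rw [ENNReal.toReal_ofReal (apJacobian_nonneg _ _ _), smul_eq_mul]
  by_cases hpos : x ∈ posJacobianSet μ m f
  · rw [indicator_of_mem hpos, mul_comm]
    simp [pushIntegrand, imagePlane, hx.2.2 hpos]
  · rw [indicator_of_notMem hpos, le_antisymm (not_lt.1 hpos) (apJacobian_nonneg _ _ _), zero_mul]

theorem nullMeasurableSet_posJacobianSet (h : IsAdaptedSum f μ c P t ψ ρ F Q t' σ) (hX : IsOpen X)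
    [IsLocallyFiniteMeasure μ] : NullMeasurableSet (posJacobianSet μ m f) μ :=
  (h.aemeasurable_apJacobian hX).nullMeasurableSet_preimage measurableSet_Ioi

theorem integral_chartVarifold (h : IsAdaptedSum f μ c P t ψ ρ F Q t' σ) (hX : IsOpen X)
    (hY : IsOpen Y) [IsLocallyFiniteMeasure μ] (hf : Continuous f) (T₀ : Grassmannian p m)
    [IsFiniteMeasureOnCompacts (chartVarifold T₀ c Q F σ)] {k : Y × Grassmannian p m → ℝ}
    (hk : Continuous k) (hks : HasCompactSupport k) :
    IntegrableOn (pushIntegrand μ f k) (posJacobianSet μ m f) μ ∧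
      ∫ z, k z ∂chartVarifold T₀ c Q F σ = ∫ x in posJacobianSet μ m f, pushIntegrand μ f k x ∂μ := by
  have hW := h.chartVarifold_eq_map hX hY hf T₀
  have hJ := (h.aemeasurable_apJacobian hX).ennreal_ofReal
  have hJtop : ∀ᵐ x ∂μ, ENNReal.ofReal (apJacobian μ m (ambient f) x) < ∞ :=
    Eventually.of_forall fun x => ENNReal.ofReal_lt_top
  have hΦ := (h.aemeasurable_prodMk hX hf T₀).mono_ac (jacobianMeasure_absolutelyContinuous m μ f)
  have hae := h.ae_pushIntegrand_eq hX T₀ k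
  have hA := h.nullMeasurableSet_posJacobianSet hX
  constructor
  · have h1 : Integrable k (chartVarifold T₀ c Q F σ) := hk.integrable_of_hasCompactSupport hks
    rw [hW, integrable_map_measure hk.aestronglyMeasurable hΦ, jacobianMeasure,
      integrable_withDensity_iff_integrable_smul₀' hJ hJtop] at h1
    refine h1.integrableOn.congr_fun_ae ((ae_restrict_iff'₀ hA).2 (hae.mono fun x hx hxA => ?_))
    exact hx.symm.trans (indicator_of_mem hxA _)
  · rw [hW, integral_map hΦ hk.aestronglyMeasurable, jacobianMeasure,
      integral_withDensity_eq_integral_toReal_smul₀ hJ hJtop, ← integral_indicator₀ hA]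
    exact integral_congr_ae (hae.mono fun x hx => hx.symm)

end IsAdaptedSum

end PushForward

/-! ### Assembly of the theorem. -/

theorem mainTheorem12 {n p m : ℕ} (hmn : m ≤ n) (hmp : m ≤ p)
    (X : Set (EuclideanSpace ℝ (Fin n))) (hX : IsOpen X)
    (Y : Set (EuclideanSpace ℝ (Fin p))) (hY : IsOpen Y)
    (f : X → Y) (hf : LocallyLipschitz f)
    (V : Measure (X × Grassmannian n m)) (hV : IsRectifiableVarifold V)
    (hprop : IsProperMap fun x : (weight V).support => f x) :
    -- the integral formula is meaningful
    (∀ᵐ x ∂weight V, ApDifferentiableAt (weight V) m (ambient f) x ∧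
      (∃ S : Submodule ℝ (EuclideanSpace ℝ (Fin n)), Module.finrank ℝ S = m ∧
        apTan (weight V) m x = S) ∧
      (0 < apJacobian (weight V) m (ambient f) x →
        Module.finrank ℝ (apImage (weight V) m (ambient f) x) = m)) ∧
    AEMeasurable (apJacobian (weight V) m (ambient f)) (weight V) ∧
    (∀ k : Y × Grassmannian p m → ℝ, Continuous k → HasCompactSupport k →
      IntegrableOn (pushIntegrand (weight V) f k) (posJacobianSet (weight V) m f) (weight V)) ∧
    -- it defines a varifold, and this varifold is rectifiable
    ∃ W : Measure (Y × Grassmannian p m),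
      IsPushForward f V W ∧
      (∀ W' : Measure (Y × Grassmannian p m), IsPushForward f V W' → W' = W) ∧
      IsRectifiableVarifold W ∧
      -- the weight, as an equality of outer measures on all subsets of `Y`
      (∀ B : Set Y, weight W B =
        ((weight V).withDensity fun x => ENNReal.ofReal (apJacobian (weight V) m (ambient f) x))
          (f ⁻¹' B)) ∧
      -- densities
      (∀ᵐ y ∂(hausdorff m : Measure Y),
        (∀ x : X, f x = y → HasDensity (weight V) m x (density (weight V) m x)) ∧
        HasDensity (weight W) m y (density (weight W) m y) ∧
        density (weight W) m y = ∑' x : f ⁻¹' {y}, density (weight V) m (x : X)) ∧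
      -- tangent planes
      (∀ᵐ y ∂(hausdorff m : Measure Y), ∀ x : X, f x = y → 0 < density (weight V) m x →
        ApDifferentiableAt (weight V) m (ambient f) x ∧
        (∃ S : Submodule ℝ (EuclideanSpace ℝ (Fin n)), Module.finrank ℝ S = m ∧
          apTan (weight V) m x = S) ∧
        (apImage (weight V) m (ambient f) x : Set (EuclideanSpace ℝ (Fin p))) = apTan (weight W) m y ∧
        Module.finrank ℝ (apImage (weight V) m (ambient f) x) = m) ∧
      -- chain rule
      ∀ (q : ℕ) (g : Y → EuclideanSpace ℝ (Fin q)), LocallyLipschitz g →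
        ∀ᵐ y ∂(hausdorff m : Measure Y), ∀ x : X, f x = y → 0 < density (weight V) m x →
          ApDifferentiableAt (weight W) m g y ∧
          ApDifferentiableAt (weight V) m (g ∘ f) x ∧
          ∀ v : apTanSpan (weight V) m x,
            ∃ h : apDeriv (weight V) m (ambient f) x v ∈ apTanSpan (weight W) m y,
              apDeriv (weight V) m (g ∘ f) x v =
                apDeriv (weight W) m g y ⟨apDeriv (weight V) m (ambient f) x v, h⟩ := by
  have := hV.radon
  have := hX.locallyCompactSpace
  have := hY.locallyCompactSpace
  have := isFiniteMeasureOnCompacts_weight V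
  -- A default plane, present only to make the plane-valued maps total.
  obtain ⟨T₀⟩ := nonempty_grassmannian hmp
  obtain ⟨c, P, t, ψ, ρ, F, Q, t', σ, h⟩ := hV.exists_isAdaptedSum hX hf
  have hν : IsChartSum (weight (chartVarifold T₀ c Q F σ)) c Q t' F σ := by
    have h1 : IsChartSum (Measure.sum fun j => ENNReal.ofReal (c j) •
        (hausdorff m : Measure Y).restrict (Q j)) c Q t' F σ :=
      ⟨h.isChart_image, h.isChartSum.pos, rfl⟩
    rwa [h1.weight_chartVarifold T₀]
  have hνmap := h.weight_chartVarifold_image hX hY hf.continuous T₀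
  -- Local finiteness, from the Lipschitz condition alone, makes `‖V‖ ⌞ Jₘf` regular; this extends
  -- the weight formula from Borel sets to all subsets of `Y`.
  have hκ := h.isLocallyFiniteMeasure_jacobianMeasure hX hf
  -- Properness enters here: compact sets of `Y` have compact preimages in the support, and its
  -- complement is null.
  have hνfin : IsFiniteMeasureOnCompacts (weight (chartVarifold T₀ c Q F σ)) := by
    rw [hνmap]
    exact isFiniteMeasureOnCompacts_map_of_isProperMap
      (jacobianMeasure_absolutelyContinuous m (weight V) f) hf.continuous hprop
  have hW := hν.isRectifiableVarifold hY T₀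
  have := hW.radon
  have hint := fun (k : Y × Grassmannian p m → ℝ) (hk : Continuous k) (hks : HasCompactSupport k) =>
    h.integral_chartVarifold hX hY hf.continuous T₀ hk hks
  refine ⟨h.ae_apDifferentiableAt hX, h.aemeasurable_apJacobian hX,
    fun k hk hks => (hint k hk hks).1, chartVarifold T₀ c Q F σ,
    ⟨hW.radon, fun k hk hks => (hint k hk hks).2⟩, ?_, hW, ?_, h.ae_density hν hf,
    h.ae_apImage_eq_apTan hX hY hν hf, fun q g hg => h.ae_apDeriv_comp hX hY hν hf hg⟩
  · rintro W' ⟨hW', hint'⟩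
    exact eq_of_integral_eq fun k hk hks => (hint' k hk hks).trans (hint k hk hks).2.symm
  · intro B
    rw [hνmap]
    exact map_apply_of_regular (jacobianMeasure m (weight V) f) hf.continuous B
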